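/- Let $\mathbb T=\mathbb R/2\pi\mathbb Z$, $\lambda\in\mathbb R$, $\alpha=\begin{pmatrix}0&1\\1&0\end{pmatrix}$, $\beta=\begin{pmatrix}1&0\\0&-1\end{pmatrix}$, $\Pi_\pm=\frac12(\mathrm{Id}\pm\alpha)$. For $\Psi=(\psi_1,\psi_2)^T:\mathbb T\to\mathbb C^2$ put $\psi_\pm=\psi_1\pm\psi_2$, $|\Psi|^2=|\psi_1|^2+|\psi_2|^2$, $F(\Psi)=\lambda(|\psi_1|^2-|\psi_2|^2)\beta\Psi$. Functions of $\partial_x$ are Fourier multipliers ($\partial_x\leftrightarrow il$); $\mathrm e^{s\alpha\partial_x}=\mathrm e^{s\partial_x}\Pi_++\mathrm e^{-s\partial_x}\Pi_-$; $\varphi_1(z)=(\mathrm e^z-1)/z$, $\varphi_1(0)=1$; and $\partial_{xx}^{-1}f=-\sum_{l\ne0}l^{-2}\hat f_l\mathrm e^{ilx}$. Consider $$i\partial_t\Phi=-i\alpha\partial_x\Phi+G(\Phi),\qquad \Phi(0)=\Phi_0,\qquad t>0,\ x\in\mathbb T,$$ in one of two cases: (DP) the Dirac–Poisson system, $G(\Psi)=\beta\Psi+V\Psi+F(\Psi)$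 with $V=-\partial_{xx}^{-1}|\Psi|^2$ (the mean-zero solution of $-\partial_{xx}V=|\Psi|^2-\frac1{2\pi}\int_{\mathbb T}|\Psi|^2dx$); (ext) $G(\Psi)=\beta\Psi+V\Psi+F(\Psi)$ with a given real-valued $V\in H^1(\mathbb T)$ (for instance any smooth $V$). For $\tau>0$ set $$\Theta(\Psi)=\mathrm e^{-\tau\alpha\partial_x}\Psi-i\mathrm e^{-\tau\alpha\partial_x}(I_1+I_2+I_3),$$ $$I_1=\tau\left[\varphi_1(2\tau\partial_x)\beta\Pi_-+\varphi_1(-2\tau\partial_x)\beta\Pi_+\right]\Psi,\qquad I_3=\tfrac{\tau\lambda}{4}\begin{pmatrix}p+q\\p-q\end{pmatrix},$$ $$p=\overline{\psi_+}\,\varphi_1(2\tau\partial_x)(\psi_-^2)+\psi_+\,\varphi_1(2\tau\partial_x)|\psi_-|^2,\qquad q=\psi_-\,\varphi_1(-2\tau\partial_x)|\psi_+|^2+\overline{\psi_-}\,\varphi_1(-2\tau\partial_x)(\psi_+^2),$$ where in case (ext) $I_2=\tau\left[(\varphi_1(\tau\partial_x)V)\Pi_++(\varphi_1(-\tau\partial_x)V)\Pi_-\right]\Psi$,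 and in case (DP) $$I_2=-\tfrac{\tau}{4}\begin{pmatrix}a+b\\a-b\end{pmatrix},\quad a=\psi_+\,\partial_{xx}^{-1}\left[\varphi_1(2\tau\partial_x)|\psi_-|^2+|\psi_+|^2\right],\quad b=\psi_-\,\partial_{xx}^{-1}\left[\varphi_1(-2\tau\partial_x)|\psi_+|^2+|\psi_-|^2\right].$$ The second-order ultra low-regularity integrator (ULI) is $\Phi^0=\Phi_0$ and, with $(\phi_1,\phi_2)^T=\Phi^n$ and $(G_1,G_2)^T=G^n=G(\Phi^n)$, in case (ext) $$\Phi^{n+1}=\Theta(\Phi^n)-\tfrac{\tau^2}{2}(\beta+V)G^n-\tfrac{\lambda\tau^2}{2}(|\phi_1|^2-|\phi_2|^2)\beta G^n+i\lambda\tau^2\,\mathrm{Im}\left[\phi_1\overline{G_1}+\overline{\phi_2}G_2\right]\beta\Phi^n,$$ and in case (DP) $$\Phi^{n+1}=\Theta(\Phi^n)-\tfrac{\tau^2}{2}\beta G^n-\tfrac{\lambda\tau^2}{2}(|\phi_1|^2-|\phi_2|^2)\beta G^n+i\lambda\tau^2\,\mathrm{Im}\left[\phi_1\overline{G_1}+\overline{\phi_2}G_2\right]\beta\Phi^n$$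 $$\qquad+\tfrac{\tau^2}{2}\left(\partial_{xx}^{-1}|\Phi^n|^2\right)G^n-i\tau^2\left(\partial_{xx}^{-1}\mathrm{Im}\left[\phi_1\overline{G_1}-\overline{\phi_2}G_2\right]\right)\Phi^n.$$ **Corollary 4.2.** In either case let $T>0$ and let $\Phi$ be a solution on $(0,T)\times\mathbb T$ with $\Phi\in L^\infty((0,T);H^1)$ and $\partial_t\Phi\in L^\infty((0,T);L^2)$ (so that $\Phi\in C([0,T];L^2)$). Then there are constants $\tau_0,C>0$, depending only on $\|\Phi\|_{L^\infty((0,T);H^1)}$, $\|\partial_t\Phi\|_{L^\infty((0,T);L^2)}$, $T$ and the data $\lambda$ (and $V$ in case (ext)) of the equation, such that for all $0<\tau\le\tau_0$ and all $n\ge0$ with $t_n=n\tau\le T$, $\Phi^n\in L^2$ and $$\|\Phi(t_n)-\Phi^n\|_{L^2}\le C\tau^2.$$ -/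

import Mathlib

open MeasureTheory

namespace NonlinearDirac

noncomputable section

instance fact_two_pi_pos : Fact (0 < 2 * Real.pi) := ⟨Real.two_pi_pos⟩

/-- The torus `ℝ / 2πℤ`; its `volume` is Lebesgue measure, of total mass `2π`. -/
abbrev Torus : Type := AddCircle (2 * Real.pi)

/-- The space `ℂ²` with its Hermitian norm. -/
abbrev Spinor : Type := EuclideanSpace ℂ (Fin 2)

/-- Spinor fields `Ψ = (ψ₁, ψ₂)ᵀ : 𝕋 → ℂ²`. -/
abbrev Field : Type := Torus → Spinor

/-- The Hilbert space `L²(𝕋; ℂ²)`, with `‖Ψ‖² = ∫ (|ψ₁|² + |ψ₂|²) dx`. -/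
abbrev L2 : Type := Lp Spinor 2 (volume : Measure Torus)

section Sobolev

variable {E : Type*} [NormedAddCommGroup E] [NormedSpace ℂ E]

/-- `f ∈ H^r(𝕋)`, for `r ≥ 0`: `f ∈ L²` and `∑ (1 + l²)^r |f̂_l|² < ∞`. The Fourier coefficients
are normalized so that `f = ∑ f̂_l e^{ilx}`. -/
def MemSobolev (r : ℝ) (f : Torus → E) : Prop :=
  MemLp f 2 volume ∧
    Summable fun l : ℤ => (1 + (l : ℝ) ^ 2) ^ r * ‖fourierCoeff f l‖ ^ 2

/-- The norm of `H^r(𝕋)`; the factor `2π` makes it the `L²` norm for `r = 0`. -/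
def sobolevNorm (r : ℝ) (f : Torus → E) : ℝ :=
  Real.sqrt (2 * Real.pi *
    ∑' l : ℤ, (1 + (l : ℝ) ^ 2) ^ r * ‖fourierCoeff f l‖ ^ 2)

/-- `g ∈ L²(𝕋)` is the weak derivative `∂ₓ f` of the periodic function `f`: tested against
the trigonometric monomials, `ĝ_l = i l f̂_l` for all `l`. -/
def IsWeakDeriv (f g : Torus → E) : Prop :=
  MemLp g 2 volume ∧
    ∀ l : ℤ, fourierCoeff g l = (Complex.I * (l : ℂ)) • fourierCoeff f l

/-- The Fourier multiplier `f ↦ ∑ m(l) f̂_l e^{ilx}`. -/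
def fourierMul (m : ℤ → ℂ) (f : Torus → E) : Torus → E :=
  fun x => ∑' l : ℤ, (m l * fourier l x) • fourierCoeff f l

/-- The operator `e^{s ∂ₓ}`. -/
def expDx (s : ℝ) (f : Torus → E) : Torus → E :=
  fourierMul (fun l => Complex.exp (Complex.I * ((s : ℂ) * (l : ℂ)))) f

/-- The entire function `φ₁(z) = (e^z - 1) / z`, with `φ₁(0) = 1`. -/
def phi1 (z : ℂ) : ℂ := if z = 0 then 1 else (Complex.exp z - 1) / z

/-- The operator `φ₁(s ∂ₓ)`. -/
def phi1Dx (s : ℝ) (f : Torus → E) : Torus → E :=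
  fourierMul (fun l => phi1 (Complex.I * ((s : ℂ) * (l : ℂ)))) f

/-- The operator `∂ₓₓ⁻¹ f = - ∑_{l ≠ 0} l⁻² f̂_l e^{ilx}`. -/
def invDxx (f : Torus → E) : Torus → E :=
  fourierMul (fun l => if l = 0 then 0 else -1 / (l : ℂ) ^ 2) f

end Sobolev

/-- A `2 × 2` matrix acting on a spinor. -/
def act (A : Matrix (Fin 2) (Fin 2) ℂ) (w : Spinor) : Spinor :=
  WithLp.toLp 2 (A.mulVec w.ofLp)

def alpha : Matrix (Fin 2) (Fin 2) ℂ := !![0, 1; 1, 0]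

def beta : Matrix (Fin 2) (Fin 2) ℂ := !![1, 0; 0, -1]

def projPlus : Matrix (Fin 2) (Fin 2) ℂ := !![1 / 2, 1 / 2; 1 / 2, 1 / 2]

def projMinus : Matrix (Fin 2) (Fin 2) ℂ := !![1 / 2, -1 / 2; -1 / 2, 1 / 2]

/-- `e^{s α ∂ₓ} = e^{s ∂ₓ} Π₊ + e^{-s ∂ₓ} Π₋`, because `α = Π₊ - Π₋` with complementary
projections `Π₊`, `Π₋`. -/
def expAlphaDx (s : ℝ) (Ψ : Field) : Field := fun x =>
  expDx s (fun y => act projPlus (Ψ y)) x + expDx (-s) (fun y => act projMinus (Ψ y)) x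

/-- `|Ψ|² = |ψ₁|² + |ψ₂|²`, as a complex-valued function. -/
def density (Ψ : Field) : Torus → ℂ := fun x =>
  (‖Ψ x 0‖ : ℂ) ^ 2 + (‖Ψ x 1‖ : ℂ) ^ 2

/-- `Ψ* β Ψ = |ψ₁|² - |ψ₂|²`, as a complex-valued function. -/
def scalarDensity (Ψ : Field) : Torus → ℂ := fun x =>
  (‖Ψ x 0‖ : ℂ) ^ 2 - (‖Ψ x 1‖ : ℂ) ^ 2

/-- The Thirring-type nonlinearity `F(Ψ) = lam (|ψ₁|² - |ψ₂|²) β Ψ`. -/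
def thirring (lam : ℝ) (Ψ : Field) : Field := fun x =>
  ((lam : ℂ) * scalarDensity Ψ x) • act beta (Ψ x)

/-- `G(Ψ) = β Ψ + V Ψ + F(Ψ)` for an external potential `V`. -/
def forceExt (lam : ℝ) (V : Torus → ℝ) (Ψ : Field) : Field := fun x =>
  act beta (Ψ x) + (V x : ℂ) • Ψ x + thirring lam Ψ x

/-- `G(Ψ) = β Ψ + V Ψ + F(Ψ)` for the self-consistent potential `V = -∂ₓₓ⁻¹ |Ψ|²`, the mean-zero
solution of `-∂ₓₓ V = |Ψ|² - (2π)⁻¹ ∫ |Ψ|²`. -/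
def forceDP (lam : ℝ) (Ψ : Field) : Field := fun x =>
  act beta (Ψ x) - invDxx (density Ψ) x • Ψ x + thirring lam Ψ x

/-- `Φ` solves `i ∂ₜΦ = -i α ∂ₓΦ + G(Φ)` on `(0,T) × 𝕋` with time derivative `Φt = ∂ₜΦ`:
`Φ : [0,T] → L²` is the absolutely continuous curve with derivative `Φt` (so that the values
`Φ t` are meaningful for every `t ∈ [0,T]`), and the equation holds in `L²` for almost
every `t ∈ (0,T)`. -/
structure IsSolution (G : Field → Field) (T : ℝ) (Φ Φt : ℝ → L2) : Prop where
  integrable : IntervalIntegrable Φt volume 0 T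
  primitive : ∀ t ∈ Set.Icc 0 T, Φ t = Φ 0 + ∫ s in (0 : ℝ)..t, Φt s
  equation : ∀ᵐ t ∂(volume.restrict (Set.Ioo 0 T)),
    ∃ D : Field, IsWeakDeriv (Φ t) D ∧
      ∀ᵐ x ∂(volume : Measure Torus),
        Complex.I • Φt t x = -(Complex.I • act alpha (D x)) + G (Φ t) x

/-- `‖Φ‖_{L^∞((0,T);H^r)} ≤ M`. -/
def BoundedSobolev (r T M : ℝ) (Φ : ℝ → L2) : Prop :=
  ∀ᵐ t ∂(volume.restrict (Set.Ioo 0 T)), MemSobolev r (Φ t) ∧ sobolevNorm r (Φ t) ≤ M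

/-- `‖Φ‖_{L^∞((0,T);L²)} ≤ M`. -/
def BoundedL2 (T M : ℝ) (Φ : ℝ → L2) : Prop :=
  AEStronglyMeasurable Φ (volume.restrict (Set.Ioo 0 T)) ∧
    ∀ᵐ t ∂(volume.restrict (Set.Ioo 0 T)), ‖Φ t‖ ≤ M

/-- `ψ₊ = ψ₁ + ψ₂`. -/
def compPlus (Ψ : Field) : Torus → ℂ := fun x => Ψ x 0 + Ψ x 1

/-- `ψ₋ = ψ₁ - ψ₂`. -/
def compMinus (Ψ : Field) : Torus → ℂ := fun x => Ψ x 0 - Ψ x 1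

/-- `|f|²`, as a complex-valued function. -/
def absSq (f : Torus → ℂ) : Torus → ℂ := fun x => (‖f x‖ : ℂ) ^ 2

/-- `I₁ = τ [φ₁(2τ∂ₓ) β Π₋ + φ₁(-2τ∂ₓ) β Π₊] Ψ`. -/
def termI1 (τ : ℝ) (Ψ : Field) : Field := fun x =>
  (τ : ℂ) • (phi1Dx (2 * τ) (fun y => act (beta * projMinus) (Ψ y)) x
    + phi1Dx (-2 * τ) (fun y => act (beta * projPlus) (Ψ y)) x)

/-- `I₂ = τ [(φ₁(τ∂ₓ)V) Π₊ + (φ₁(-τ∂ₓ)V) Π₋] Ψ`, for an external potential. -/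
def termI2Ext (V : Torus → ℝ) (τ : ℝ) (Ψ : Field) : Field := fun x =>
  (τ : ℂ) • (phi1Dx τ (fun y => (V y : ℂ)) x • act projPlus (Ψ x)
    + phi1Dx (-τ) (fun y => (V y : ℂ)) x • act projMinus (Ψ x))

/-- `I₂` for the Dirac-Poisson system, with
`p = ψ₊ ∂ₓₓ⁻¹[φ₁(2τ∂ₓ)|ψ₋|² + |ψ₊|²]` and `q = ψ₋ ∂ₓₓ⁻¹[φ₁(-2τ∂ₓ)|ψ₊|² + |ψ₋|²]`:
`I₂ = -(τ/4) (p + q, p - q)ᵀ`. -/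
def termI2DP (τ : ℝ) (Ψ : Field) : Field := fun x =>
  let p : ℂ := compPlus Ψ x * invDxx (fun y =>
    phi1Dx (2 * τ) (absSq (compMinus Ψ)) y + absSq (compPlus Ψ) y) x
  let q : ℂ := compMinus Ψ x * invDxx (fun y =>
    phi1Dx (-2 * τ) (absSq (compPlus Ψ)) y + absSq (compMinus Ψ) y) x
  (-(τ : ℂ) / 4) • !₂[p + q, p - q]

/-- `I₃ = (τ lam/4) (p + q, p - q)ᵀ` with
`p = conj(ψ₊) φ₁(2τ∂ₓ)(ψ₋²) + ψ₊ φ₁(2τ∂ₓ)|ψ₋|²` and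
`q = ψ₋ φ₁(-2τ∂ₓ)|ψ₊|² + conj(ψ₋) φ₁(-2τ∂ₓ)(ψ₊²)`. -/
def termI3 (lam τ : ℝ) (Ψ : Field) : Field := fun x =>
  let p : ℂ :=
    (starRingEnd ℂ) (compPlus Ψ x) * phi1Dx (2 * τ) (fun y => compMinus Ψ y ^ 2) x
      + compPlus Ψ x * phi1Dx (2 * τ) (absSq (compMinus Ψ)) x
  let q : ℂ :=
    compMinus Ψ x * phi1Dx (-2 * τ) (absSq (compPlus Ψ)) x
      + (starRingEnd ℂ) (compMinus Ψ x) * phi1Dx (-2 * τ) (fun y => compPlus Ψ y ^ 2) x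
  ((τ : ℂ) * (lam : ℂ) / 4) • !₂[p + q, p - q]

/-- The first-order map `Θ_ext(Ψ) = e^{-τα∂ₓ} Ψ - i e^{-τα∂ₓ} (I₁ + I₂ + I₃)`. -/
def thetaExt (lam : ℝ) (V : Torus → ℝ) (τ : ℝ) (Ψ : Field) : Field := fun x =>
  expAlphaDx (-τ) Ψ x - Complex.I • expAlphaDx (-τ)
    (fun y => termI1 τ Ψ y + termI2Ext V τ Ψ y + termI3 lam τ Ψ y) x

/-- The first-order map `Θ_DP(Ψ) = e^{-τα∂ₓ} Ψ - i e^{-τα∂ₓ} (I₁ + I₂ + I₃)`. -/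
def thetaDP (lam τ : ℝ) (Ψ : Field) : Field := fun x =>
  expAlphaDx (-τ) Ψ x - Complex.I • expAlphaDx (-τ)
    (fun y => termI1 τ Ψ y + termI2DP τ Ψ y + termI3 lam τ Ψ y) x

/-- `Im[ψ₁ conj(G₁) + conj(ψ₂) G₂]`. -/
def imPlus (Ψ G : Field) : Torus → ℝ := fun x =>
  (Ψ x 0 * (starRingEnd ℂ) (G x 0) + (starRingEnd ℂ) (Ψ x 1) * G x 1).im

/-- `Im[ψ₁ conj(G₁) - conj(ψ₂) G₂]`. -/
def imMinus (Ψ G : Field) : Torus → ℝ := fun x =>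
  (Ψ x 0 * (starRingEnd ℂ) (G x 0) - (starRingEnd ℂ) (Ψ x 1) * G x 1).im

/-- One step of the second-order scheme for an external potential `V`, where `G = G(Ψ)`:
`Θ_ext(Ψ) - (τ²/2)(β + V)G - (lam τ²/2)(|ψ₁|² - |ψ₂|²) β G
  + i lam τ² Im[ψ₁ conj(G₁) + conj(ψ₂) G₂] β Ψ`. -/
def stepExt (lam : ℝ) (V : Torus → ℝ) (τ : ℝ) (Ψ : Field) : Field := fun x =>
  let G : Field := forceExt lam V Ψ
  thetaExt lam V τ Ψ x
    - ((τ : ℂ) ^ 2 / 2) • (act beta (G x) + (V x : ℂ) • G x)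
    - ((lam : ℂ) * (τ : ℂ) ^ 2 / 2 * scalarDensity Ψ x) • act beta (G x)
    + (Complex.I * (lam : ℂ) * (τ : ℂ) ^ 2 * (imPlus Ψ G x : ℂ)) • act beta (Ψ x)

/-- One step of the second-order scheme for the Dirac-Poisson system, where `G = G(Ψ)`:
`Θ_DP(Ψ) - (τ²/2) β G - (lam τ²/2)(|ψ₁|² - |ψ₂|²) β G
  + i lam τ² Im[ψ₁ conj(G₁) + conj(ψ₂) G₂] β Ψ
  + (τ²/2) (∂ₓₓ⁻¹|Ψ|²) G - i τ² (∂ₓₓ⁻¹ Im[ψ₁ conj(G₁) - conj(ψ₂) G₂]) Ψ`. -/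
def stepDP (lam τ : ℝ) (Ψ : Field) : Field := fun x =>
  let G : Field := forceDP lam Ψ
  thetaDP lam τ Ψ x
    - ((τ : ℂ) ^ 2 / 2) • act beta (G x)
    - ((lam : ℂ) * (τ : ℂ) ^ 2 / 2 * scalarDensity Ψ x) • act beta (G x)
    + (Complex.I * (lam : ℂ) * (τ : ℂ) ^ 2 * (imPlus Ψ G x : ℂ)) • act beta (Ψ x)
    + ((τ : ℂ) ^ 2 / 2 * invDxx (density Ψ) x) • G x
    - (Complex.I * (τ : ℂ) ^ 2 * invDxx (fun y => (imMinus Ψ G y : ℂ)) x) • Ψ x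

/-- The numerical solution `Φⁿ` of a one-step scheme `Φⁿ⁺¹ = step(Φⁿ)`, `Φ⁰ = Φ₀`. -/
def numSol (step : Field → Field) (Φ₀ : Field) : ℕ → Field
  | 0 => Φ₀
  | n + 1 => step (numSol step Φ₀ n)

end

end NonlinearDirac

open NonlinearDirac

/-! In the variables `ψ₊`, `ψ₋` the matrix `α` is diagonal, so the free group translates `ψ₊` and
`ψ₋` in opposite directions and is isometric both in the supremum norm and in `L²`. Pulling the
Duhamel integrand back along the free evolution freezes one component and translates the other by
twice the elapsed time (and `V` by once that time). The integrals of these translates are exactly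
the `φ₁` operators. Hence `Θ` is Duhamel's formula with the solution inside `G` replaced by its free
evolution, without further quadrature, and the remaining terms of the scheme are
`(τ²/2)(-i)G'(Φ)[-iG(Φ)]`, the leading effect of that replacement.

The error analysis uses two norms on pairs of continuous functions: the supremum norm (strong) and
the `L²` norm (weak). In each cubic product any one factor can be measured weakly and the others
strongly (`CubicSystem.Compatible`), so Lipschitz, Taylor and stability estimates hold in both
norms. The local error is `O(τ²)` strongly, by boundedness alone (`norm_local_error_le`), and
`O(τ³)` weakly, because an `H¹` solution is Lipschitz along translations in `L²`
(`norm_map_local_error_le`). Opposite translations do not commute with products, but the increment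
of a pair under the flow has the same weak norm as its increment under a common translation, and the
latter does commute with the cubic terms (`Translations.force_lipschitz`). A Gronwall argument in
the strong norm gives a global error `O(τ)`, which keeps the iterates in a fixed ball; on that ball
weak stability turns the weak local error into a global error `O(τ²)` (`CubicSystem.convergence`).
No `H¹` bound on the iterates is needed.

The link with the concrete objects is the Wiener algebra of absolutely convergent Fourier series. It
contains `H¹`, is preserved by every operation of the scheme, and on it the pointwise Fourier sums
agree with the operators on continuous functions. So the scheme coincides almost everywhere with the
abstract step (`stepExt_ae`, `stepDP_ae`). The given `L²` solution becomes a mild solution by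
solving a scalar equation for each Fourier coefficient (`IsSolution.exists_isMild`); its continuity
in the supremum norm comes from the uniform smallness of `H¹` Fourier tails (`continuous_series`).
-/

namespace NonlinearDirac

/-! ### Abstract cubic systems: Lipschitz, Taylor and stability estimates, first-order local theory.
-/

section Abstract

variable {X H : Type*} [NormedAddCommGroup X] [NormedSpace ℂ X]
  [NormedAddCommGroup H] [NormedSpace ℂ H]

/-- The data of a semilinear equation `∂ₜ x = A x - i G(x)` in pulled-back form: the group
`flow s = e^{-sA}` and the cubic polynomial `G(x) = lin x + cub x x x`, with `cub` real-trilinear. -/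
structure CubicSystem (X : Type*) [NormedAddCommGroup X] [NormedSpace ℂ X] where
  flow : ℝ → X →L[ℂ] X
  lin : X →L[ℂ] X
  cub : X → X → X → X
  bound : ℝ
  bound_nonneg : 0 ≤ bound
  flow_zero : ∀ x, flow 0 x = x
  flow_add : ∀ s t x, flow (s + t) x = flow s (flow t x)
  continuous_flow : Continuous fun p : ℝ × X => flow p.1 p.2
  continuous_cub : Continuous fun x => cub x x x
  cub_add₁ : ∀ x x' y z, cub (x + x') y z = cub x y z + cub x' y z
  cub_add₂ : ∀ x y y' z, cub x (y + y') z = cub x y z + cub x y' z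
  cub_add₃ : ∀ x y z z', cub x y (z + z') = cub x y z + cub x y z'
  cub_smul₁ : ∀ (r : ℝ) x y z, cub ((r : ℂ) • x) y z = (r : ℂ) • cub x y z
  cub_smul₂ : ∀ (r : ℝ) x y z, cub x ((r : ℂ) • y) z = (r : ℂ) • cub x y z
  cub_smul₃ : ∀ (r : ℝ) x y z, cub x y ((r : ℂ) • z) = (r : ℂ) • cub x y z

/-- The (semi)norm `‖ι ·‖` is invariant under the flow and controls the nonlinearity, with the
remaining factors of each product measured in the norm of `X`. -/
structure CubicSystem.Compatible (A : CubicSystem X) (ι : X →L[ℂ] H) : Prop where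
  norm_flow : ∀ s x, ‖ι (A.flow s x)‖ = ‖ι x‖
  norm_lin : ∀ x, ‖ι (A.lin x)‖ ≤ A.bound * ‖ι x‖
  norm_cub₁ : ∀ x y z, ‖ι (A.cub x y z)‖ ≤ A.bound * (‖ι x‖ * ‖y‖ * ‖z‖)
  norm_cub₂ : ∀ x y z, ‖ι (A.cub x y z)‖ ≤ A.bound * (‖x‖ * ‖ι y‖ * ‖z‖)
  norm_cub₃ : ∀ x y z, ‖ι (A.cub x y z)‖ ≤ A.bound * (‖x‖ * ‖y‖ * ‖ι z‖)

/-- A group of translations commuting with the nonlinearity, up to a Lipschitz error in the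
linear part, and with the same increments as the flow. -/
structure CubicSystem.Translations (A : CubicSystem X) (ι : X →L[ℂ] H) where
  shift : ℝ → X →L[ℂ] X
  norm_shift : ∀ s x, ‖shift s x‖ = ‖x‖
  shift_cub : ∀ s x y z, shift s (A.cub x y z) = A.cub (shift s x) (shift s y) (shift s z)
  const : ℝ
  const_nonneg : 0 ≤ const
  shift_lin : ∀ s x, ‖ι (shift s (A.lin x) - A.lin (shift s x))‖ ≤ const * |s| * ‖x‖
  norm_shift_sub : ∀ s x, ‖ι (shift s x - x)‖ = ‖ι (A.flow s x - x)‖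

namespace CubicSystem

variable (A : CubicSystem X)

/-- The nonlinearity `G`. -/
def force (x : X) : X := A.lin x + A.cub x x x

/-- The derivative of `G` at `x` in the direction `h`. -/
def dforce (x h : X) : X := A.lin h + A.cub h x x + A.cub x h x + A.cub x x h

/-- The second-order correction `-i G'(x)[-i G(x)]`. -/
noncomputable def corr (x : X) : X := -Complex.I • A.dforce x (-Complex.I • A.force x)

/-- One step of the second-order integrator. -/
noncomputable def step (τ : ℝ) (x : X) : X :=
  A.flow (-τ) (x - Complex.I • ∫ r in (0 : ℝ)..τ, A.flow r (A.force (A.flow (-r) x)))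
    + ((τ : ℂ) ^ 2 / 2) • A.corr x

/-- The Lipschitz constant of `G` on the ball of radius `R`. -/
def lip (R : ℝ) : ℝ := A.bound * (1 + 3 * R ^ 2)

lemma lip_nonneg (R : ℝ) : 0 ≤ A.lip R := mul_nonneg A.bound_nonneg (by positivity)

lemma flow_neg_flow (s : ℝ) (x : X) : A.flow (-s) (A.flow s x) = x := by
  rw [← A.flow_add, neg_add_cancel, A.flow_zero]

lemma flow_flow_neg (s : ℝ) (x : X) : A.flow s (A.flow (-s) x) = x := by
  rw [← A.flow_add, add_neg_cancel, A.flow_zero]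

lemma continuous_force : Continuous A.force := A.lin.continuous.add A.continuous_cub

lemma continuous_pullback {y : ℝ → X} (hy : Continuous y) :
    Continuous fun r => A.flow r (A.force (y r)) :=
  A.continuous_flow.comp (continuous_id.prodMk (A.continuous_force.comp hy))

lemma continuous_flow_neg (x : X) : Continuous fun r : ℝ => A.flow (-r) x :=
  A.continuous_flow.comp (continuous_neg.prodMk continuous_const)

lemma cub_sub₁ (x x' y z : X) : A.cub (x - x') y z = A.cub x y z - A.cub x' y z := by
  rw [eq_sub_iff_add_eq, ← A.cub_add₁, sub_add_cancel]

lemma cub_sub₂ (x y y' z : X) : A.cub x (y - y') z = A.cub x y z - A.cub x y' z := by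
  rw [eq_sub_iff_add_eq, ← A.cub_add₂, sub_add_cancel]

lemma cub_sub₃ (x y z z' : X) : A.cub x y (z - z') = A.cub x y z - A.cub x y z' := by
  rw [eq_sub_iff_add_eq, ← A.cub_add₃, sub_add_cancel]

lemma dforce_sub (x h k : X) : A.dforce x (h - k) = A.dforce x h - A.dforce x k := by
  simp only [dforce, map_sub, cub_sub₁, cub_sub₂, cub_sub₃]; abel

/-- Only real scalars come out: the nonlinearity contains complex conjugates, which is also why the
inner factor `-i` in `corr` cannot be extracted. -/
lemma dforce_smul (r : ℝ) (x h : X) :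
    A.dforce x ((r : ℂ) • h) = (r : ℂ) • A.dforce x h := by
  simp only [dforce, map_smul, cub_smul₁, cub_smul₂, cub_smul₃, smul_add]

lemma force_zero : A.force 0 = 0 := by
  have := A.cub_smul₁ 0 0 0 0
  simp only [Complex.ofReal_zero, zero_smul] at this
  simp [force, this]

namespace Compatible

variable {A} {ι : X →L[ℂ] H} (hA : A.Compatible ι)
include hA

lemma norm_dforce_le {R : ℝ} {x : X} (hx : ‖x‖ ≤ R) (h : X) :
    ‖ι (A.dforce x h)‖ ≤ A.lip R * ‖ι h‖ := by
  have hb := A.bound_nonneg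
  have hR : 0 ≤ R := (norm_nonneg x).trans hx
  have e : A.bound * (‖ι h‖ * R * R) = A.bound * R ^ 2 * ‖ι h‖ := by ring
  have h1 : ‖ι (A.cub h x x)‖ ≤ A.bound * (‖ι h‖ * R * R) :=
    (hA.norm_cub₁ h x x).trans (by gcongr)
  have h2 : ‖ι (A.cub x h x)‖ ≤ A.bound * (R * ‖ι h‖ * R) :=
    (hA.norm_cub₂ x h x).trans (by gcongr)
  have h3 : ‖ι (A.cub x x h)‖ ≤ A.bound * (R * R * ‖ι h‖) :=
    (hA.norm_cub₃ x x h).trans (by gcongr)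
  have h0 := hA.norm_lin h
  rw [dforce, map_add, map_add, map_add]
  refine (norm_add₄_le).trans ?_
  unfold lip
  linarith

/-- The linear part cancels. Telescoping the three derivative terms leaves six products, each with
one factor `x - y`, placed in the weak norm, and one factor `k`, kept in the strong norm. -/
lemma norm_dforce_sub_le {R : ℝ} {x y : X} (hx : ‖x‖ ≤ R) (hy : ‖y‖ ≤ R) (k : X) :
    ‖ι (A.dforce x k - A.dforce y k)‖ ≤ 6 * A.bound * R * ‖k‖ * ‖ι (x - y)‖ := by
  have hb := A.bound_nonneg
  have hR : 0 ≤ R := (norm_nonneg x).trans hx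
  have e : A.dforce x k - A.dforce y k
      = (A.cub k (x - y) x + A.cub k y (x - y)) + (A.cub (x - y) k x + A.cub y k (x - y))
        + (A.cub (x - y) x k + A.cub y (x - y) k) := by
    simp only [dforce, cub_sub₁, cub_sub₂, cub_sub₃]; abel
  have b1 : ‖ι (A.cub k (x - y) x)‖ ≤ A.bound * (‖k‖ * ‖ι (x - y)‖ * R) :=
    (hA.norm_cub₂ _ _ _).trans (by gcongr)
  have b2 : ‖ι (A.cub k y (x - y))‖ ≤ A.bound * (‖k‖ * R * ‖ι (x - y)‖) :=
    (hA.norm_cub₃ _ _ _).trans (by gcongr)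
  have b3 : ‖ι (A.cub (x - y) k x)‖ ≤ A.bound * (‖ι (x - y)‖ * ‖k‖ * R) :=
    (hA.norm_cub₁ _ _ _).trans (by gcongr)
  have b4 : ‖ι (A.cub y k (x - y))‖ ≤ A.bound * (R * ‖k‖ * ‖ι (x - y)‖) :=
    (hA.norm_cub₃ _ _ _).trans (by gcongr)
  have b5 : ‖ι (A.cub (x - y) x k)‖ ≤ A.bound * (‖ι (x - y)‖ * R * ‖k‖) :=
    (hA.norm_cub₁ _ _ _).trans (by gcongr)
  have b6 : ‖ι (A.cub y (x - y) k)‖ ≤ A.bound * (R * ‖ι (x - y)‖ * ‖k‖) :=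
    (hA.norm_cub₂ _ _ _).trans (by gcongr)
  rw [e]
  simp only [map_add]
  refine (norm_add₃_le).trans ?_
  have n1 := norm_add_le (ι (A.cub k (x - y) x)) (ι (A.cub k y (x - y)))
  have n2 := norm_add_le (ι (A.cub (x - y) k x)) (ι (A.cub y k (x - y)))
  have n3 := norm_add_le (ι (A.cub (x - y) x k)) (ι (A.cub y (x - y) k))
  linarith

lemma norm_force_sub_le {R : ℝ} {x y : X} (hx : ‖x‖ ≤ R) (hy : ‖y‖ ≤ R) :
    ‖ι (A.force x - A.force y)‖ ≤ A.lip R * ‖ι (x - y)‖ := by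
  have hb := A.bound_nonneg
  have hR : 0 ≤ R := (norm_nonneg x).trans hx
  have e : A.force x - A.force y
      = A.lin (x - y) + A.cub (x - y) x x + A.cub y (x - y) x + A.cub y y (x - y) := by
    simp only [force, cub_sub₁, cub_sub₂, cub_sub₃, map_sub]; abel
  have b1 : ‖ι (A.cub (x - y) x x)‖ ≤ A.bound * (‖ι (x - y)‖ * R * R) :=
    (hA.norm_cub₁ _ _ _).trans (by gcongr)
  have b2 : ‖ι (A.cub y (x - y) x)‖ ≤ A.bound * (R * ‖ι (x - y)‖ * R) :=
    (hA.norm_cub₂ _ _ _).trans (by gcongr)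
  have b3 : ‖ι (A.cub y y (x - y))‖ ≤ A.bound * (R * R * ‖ι (x - y)‖) :=
    (hA.norm_cub₃ _ _ _).trans (by gcongr)
  have b0 := hA.norm_lin (x - y)
  rw [e, map_add, map_add, map_add]
  refine (norm_add₄_le).trans ?_
  unfold lip
  linarith

/-- Every term of the remainder contains `h` at least twice: one copy is measured weakly and another
strongly. The bound `‖h‖ ≤ R` absorbs the third copy in the purely cubic term. -/
lemma norm_taylor_le {R : ℝ} {x h : X} (hx : ‖x‖ ≤ R) (hh : ‖h‖ ≤ R) :
    ‖ι (A.force (x + h) - A.force x - A.dforce x h)‖ ≤ 4 * A.bound * R * ‖h‖ * ‖ι h‖ := by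
  have hb := A.bound_nonneg
  have hR : 0 ≤ R := (norm_nonneg x).trans hx
  have e : A.force (x + h) - A.force x - A.dforce x h
      = A.cub h h x + A.cub h x h + A.cub x h h + A.cub h h h := by
    simp only [force, dforce, cub_add₁, cub_add₂, cub_add₃, map_add]; abel
  have b1 : ‖ι (A.cub h h x)‖ ≤ A.bound * (‖ι h‖ * ‖h‖ * R) :=
    (hA.norm_cub₁ _ _ _).trans (by gcongr)
  have b2 : ‖ι (A.cub h x h)‖ ≤ A.bound * (‖ι h‖ * R * ‖h‖) :=
    (hA.norm_cub₁ _ _ _).trans (by gcongr)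
  have b3 : ‖ι (A.cub x h h)‖ ≤ A.bound * (R * ‖ι h‖ * ‖h‖) :=
    (hA.norm_cub₂ _ _ _).trans (by gcongr)
  have b4 : ‖ι (A.cub h h h)‖ ≤ A.bound * (‖ι h‖ * ‖h‖ * R) :=
    (hA.norm_cub₁ _ _ _).trans (by gcongr)
  rw [e, map_add, map_add, map_add]
  refine (norm_add₄_le).trans ?_
  linarith

end Compatible

/-- Compatibility with the norm of `X` itself. -/
abbrev StrongCompatible : Prop := A.Compatible (ContinuousLinearMap.id ℂ X)

variable {A}

lemma StrongCompatible.norm_flow (hS : A.StrongCompatible) (s : ℝ) (x : X) :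
    ‖A.flow s x‖ = ‖x‖ := Compatible.norm_flow hS s x

lemma StrongCompatible.norm_force_le (hS : A.StrongCompatible) {R : ℝ} {x : X} (hx : ‖x‖ ≤ R) :
    ‖A.force x‖ ≤ A.lip R * R := by
  have h := Compatible.norm_force_sub_le hS hx (y := 0) (by simpa using (norm_nonneg x).trans hx)
  simp only [A.force_zero, sub_zero, ContinuousLinearMap.id_apply] at h
  exact h.trans (mul_le_mul_of_nonneg_left hx (A.lip_nonneg R))

/-- The direction `-iG` and the base point of the derivative are changed one at a time. The
direction that stays fixed is needed in the strong norm, hence the second compatibility hypothesis.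
-/
lemma Compatible.norm_corr_sub_le {ι : X →L[ℂ] H} (hA : A.Compatible ι)
    (hS : A.StrongCompatible) {R : ℝ} {x y : X} (hx : ‖x‖ ≤ R) (hy : ‖y‖ ≤ R) :
    ‖ι (A.corr x - A.corr y)‖
      ≤ (A.lip R * A.lip R + 6 * A.bound * R * (A.lip R * R)) * ‖ι (x - y)‖ := by
  have hR : 0 ≤ R := (norm_nonneg x).trans hx
  have hb := A.bound_nonneg
  have hl := A.lip_nonneg R
  have e : A.corr x - A.corr y = -Complex.I •
      (A.dforce x (-Complex.I • (A.force x - A.force y))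
        + (A.dforce x (-Complex.I • A.force y) - A.dforce y (-Complex.I • A.force y))) := by
    rw [smul_sub, dforce_sub, corr, corr, ← smul_sub]; congr 1; abel
  rw [e, map_smul, norm_smul, norm_neg, Complex.norm_I, one_mul, map_add]
  have h1 := hA.norm_dforce_le hx (-Complex.I • (A.force x - A.force y))
  rw [map_smul, norm_smul, norm_neg, Complex.norm_I, one_mul] at h1
  have h2 := hA.norm_force_sub_le hx hy
  have h3 := hA.norm_dforce_sub_le hx hy (-Complex.I • A.force y)
  rw [norm_smul, norm_neg, Complex.norm_I, one_mul] at h3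
  have h4 := hS.norm_force_le hy
  have h5 : A.lip R * ‖ι (A.force x - A.force y)‖ ≤ A.lip R * (A.lip R * ‖ι (x - y)‖) := by gcongr
  have h6 : 6 * A.bound * R * ‖A.force y‖ * ‖ι (x - y)‖
      ≤ 6 * A.bound * R * (A.lip R * R) * ‖ι (x - y)‖ := by gcongr
  refine (norm_add_le _ _).trans ?_
  linarith

lemma StrongCompatible.norm_corr_le (hS : A.StrongCompatible) {R : ℝ} {x : X} (hx : ‖x‖ ≤ R) :
    ‖A.corr x‖ ≤ A.lip R * (A.lip R * R) := by
  have hl := A.lip_nonneg R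
  rw [corr, norm_smul, norm_neg, Complex.norm_I, one_mul]
  have h1 := Compatible.norm_dforce_le hS hx (-Complex.I • A.force x)
  simp only [ContinuousLinearMap.id_apply] at h1
  rw [norm_smul, norm_neg, Complex.norm_I, one_mul] at h1
  exact h1.trans (mul_le_mul_of_nonneg_left (hS.norm_force_le hx) hl)

lemma norm_map_integral_le [CompleteSpace X] [CompleteSpace H] (ι : X →L[ℂ] H) {f : ℝ → X}
    (hf : Continuous f) {τ C : ℝ} (hτ : 0 ≤ τ) (hC : ∀ r, 0 ≤ r → r ≤ τ → ‖ι (f r)‖ ≤ C) :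
    ‖ι (∫ r in (0 : ℝ)..τ, f r)‖ ≤ C * τ := by
  rw [← ContinuousLinearMap.intervalIntegral_comp_comm ι (hf.intervalIntegrable 0 τ)]
  refine (intervalIntegral.norm_integral_le_of_norm_le_const (C := C) fun r hr => ?_).trans_eq ?_
  · rw [Set.uIoc_of_le hτ] at hr
    exact hC r hr.1.le hr.2
  · rw [sub_zero, abs_of_nonneg hτ]

/-- The constant in the stability estimate. -/
def stab (A : CubicSystem X) (R : ℝ) : ℝ :=
  A.lip R + (A.lip R * A.lip R + 6 * A.bound * R * (A.lip R * R))

lemma stab_nonneg {R : ℝ} (hR : 0 ≤ R) : 0 ≤ A.stab R := by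
  have := A.bound_nonneg
  have := A.lip_nonneg R
  unfold stab; positivity

/-- The isometric flow contributes the factor `1`, and the integral and the correction contribute
`O(τ)`; `τ ≤ 1` is used to bound `τ²/2` by `τ`. The balls are strong balls even when the difference
is measured weakly. -/
lemma Compatible.norm_step_sub_le [CompleteSpace X] [CompleteSpace H] {ι : X →L[ℂ] H}
    (hA : A.Compatible ι) (hS : A.StrongCompatible) {R : ℝ} {x y : X} (hx : ‖x‖ ≤ R) (hy : ‖y‖ ≤ R)
    {τ : ℝ} (h0 : 0 ≤ τ) (h1 : τ ≤ 1) :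
    ‖ι (A.step τ x - A.step τ y)‖ ≤ (1 + A.stab R * τ) * ‖ι (x - y)‖ := by
  have hR : 0 ≤ R := (norm_nonneg x).trans hx
  have hb := A.bound_nonneg
  have hl := A.lip_nonneg R
  have cx := A.continuous_pullback (A.continuous_flow_neg x)
  have cy := A.continuous_pullback (A.continuous_flow_neg y)
  have e : A.step τ x - A.step τ y = A.flow (-τ) (x - y) - Complex.I • A.flow (-τ)
      (∫ r in (0 : ℝ)..τ, (A.flow r (A.force (A.flow (-r) x)) - A.flow r (A.force (A.flow (-r) y))))
      + ((τ : ℂ) ^ 2 / 2) • (A.corr x - A.corr y) := by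
    rw [intervalIntegral.integral_sub (cx.intervalIntegrable _ _) (cy.intervalIntegrable _ _)]
    simp only [step, map_sub, map_smul, smul_sub]
    abel
  have hI : ‖ι (∫ r in (0 : ℝ)..τ,
      (A.flow r (A.force (A.flow (-r) x)) - A.flow r (A.force (A.flow (-r) y))))‖
        ≤ A.lip R * ‖ι (x - y)‖ * τ := by
    refine norm_map_integral_le ι (cx.sub cy) h0 fun r _ _ => ?_
    rw [Pi.sub_apply, ← map_sub, hA.norm_flow]
    refine (hA.norm_force_sub_le (R := R) ?_ ?_).trans_eq ?_
    · rwa [hS.norm_flow]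
    · rwa [hS.norm_flow]
    · rw [← map_sub, hA.norm_flow]
  have hK := hA.norm_corr_sub_le hS hx hy
  set K := A.lip R * A.lip R + 6 * A.bound * R * (A.lip R * R) with hKdef
  have hK0 : 0 ≤ K := by positivity
  have hτ : ‖((τ : ℂ) ^ 2 / 2)‖ ≤ τ := by
    rw [norm_div, norm_pow, Complex.norm_real, Real.norm_of_nonneg h0, Complex.norm_ofNat]
    nlinarith
  rw [e, map_add, map_sub, map_smul, map_smul]
  refine (norm_add_le _ _).trans ((add_le_add (norm_sub_le _ _) le_rfl).trans ?_)
  rw [norm_smul, norm_smul, Complex.norm_I, one_mul, hA.norm_flow, hA.norm_flow]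
  have h3 : ‖((τ : ℂ) ^ 2 / 2)‖ * ‖ι (A.corr x - A.corr y)‖ ≤ τ * (K * ‖ι (x - y)‖) := by gcongr
  have : A.stab R = A.lip R + K := rfl
  rw [this]
  linarith

/-- A curve `x` solving `∂ₜ x = A x - i G(x)` in mild form on `[0,T]`. -/
structure IsMild (A : CubicSystem X) (ι : X →L[ℂ] H) (T R : ℝ) (x : ℝ → X) : Prop where
  continuous : Continuous x
  norm_le : ∀ t, ‖x t‖ ≤ R
  lipschitz : ∀ t s, ‖ι (A.flow s (x t) - x t)‖ ≤ R * |s|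
  mild : ∀ t, 0 ≤ t → t ≤ T →
    A.flow t (x t) = x 0 - Complex.I • ∫ r in (0 : ℝ)..t, A.flow r (A.force (x r))

namespace IsMild

variable {ι : X →L[ℂ] H} {T R : ℝ} {x : ℝ → X}

/-- The mild formula is restarted at time `t` through the group law, so that one step of the scheme
can be compared with the solution from `t` onwards. -/
lemma mild_step [CompleteSpace X] (h : IsMild A ι T R x) {t s : ℝ} (ht : 0 ≤ t) (hs : 0 ≤ s)
    (hT : t + s ≤ T) :
    A.flow s (x (t + s)) = x t - Complex.I • ∫ r in (0 : ℝ)..s, A.flow r (A.force (x (t + r))) := by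
  have c := A.continuous_pullback h.continuous
  have e1 := h.mild (t + s) (by linarith) hT
  have e2 := h.mild t ht (by linarith)
  rw [← intervalIntegral.integral_add_adjacent_intervals (c.intervalIntegrable 0 t)
    (c.intervalIntegrable t (t + s)), smul_add, ← sub_sub, ← e2] at e1
  have e3 : (∫ r in t..(t + s), A.flow r (A.force (x r)))
      = A.flow t (∫ r in (0 : ℝ)..s, A.flow r (A.force (x (t + r)))) := by
    have c' : Continuous fun r => A.flow r (A.force (x (t + r))) :=
      A.continuous_pullback (h.continuous.comp (by fun_prop))
    rw [← ContinuousLinearMap.intervalIntegral_comp_comm _ (c'.intervalIntegrable _ _)]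
    have := intervalIntegral.integral_comp_add_left (a := 0) (b := s)
      (fun r => A.flow r (A.force (x r))) t
    rw [add_zero] at this
    rw [← this]
    simp only [A.flow_add]
  rw [e3, A.flow_add, ← map_smul, ← map_sub] at e1
  have := congrArg (A.flow (-t)) e1
  rwa [A.flow_neg_flow, A.flow_neg_flow] at this

/-- The increment of the solution along the flow. -/
lemma increment [CompleteSpace X] (h : IsMild A ι T R x) {t s : ℝ} (ht : 0 ≤ t) (hs : 0 ≤ s)
    (hT : t + s ≤ T) : x (t + s) - A.flow (-s) (x t)
      = -Complex.I • A.flow (-s) (∫ r in (0 : ℝ)..s, A.flow r (A.force (x (t + r)))) := by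
  have := congrArg (A.flow (-s)) (h.mild_step ht hs hT)
  rw [A.flow_neg_flow, map_sub, map_smul] at this
  rw [this, neg_smul]; abel

lemma norm_increment_le [CompleteSpace X] (hS : A.StrongCompatible) (h : IsMild A ι T R x)
    {t s : ℝ} (ht : 0 ≤ t) (hs : 0 ≤ s) (hT : t + s ≤ T) :
    ‖x (t + s) - A.flow (-s) (x t)‖ ≤ A.lip R * R * s := by
  rw [h.increment ht hs hT, norm_smul, norm_neg, Complex.norm_I, one_mul, hS.norm_flow]
  have c : Continuous fun r => A.flow r (A.force (x (t + r))) :=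
    A.continuous_pullback (h.continuous.comp (by fun_prop))
  refine norm_map_integral_le (ContinuousLinearMap.id ℂ X) c hs fun r _ _ => ?_
  rw [ContinuousLinearMap.id_apply, hS.norm_flow]
  exact hS.norm_force_le (h.norm_le _)

/-- The pulled-back local error. -/
lemma flow_local_error [CompleteSpace X] (h : IsMild A ι T R x) {t τ : ℝ} (ht : 0 ≤ t)
    (hτ : 0 ≤ τ) (hT : t + τ ≤ T) :
    A.flow τ (x (t + τ) - A.step τ (x t))
      = -Complex.I • (∫ r in (0 : ℝ)..τ,
          A.flow r (A.force (x (t + r)) - A.force (A.flow (-r) (x t))))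
        - ((τ : ℂ) ^ 2 / 2) • A.flow τ (A.corr (x t)) := by
  have c : Continuous fun r => A.flow r (A.force (x (t + r))) :=
    A.continuous_pullback (h.continuous.comp (by fun_prop))
  have c' := A.continuous_pullback (A.continuous_flow_neg (x t))
  simp only [map_sub]
  rw [intervalIntegral.integral_sub (c.intervalIntegrable _ _) (c'.intervalIntegrable _ _),
    h.mild_step ht hτ hT, step, map_add, A.flow_flow_neg, map_smul, neg_smul, smul_sub]
  abel

/-- This estimate uses only boundedness: the integral and the correction are each `O(τ²)` and are
not played off against each other. It serves solely to keep the iterates in a strong ball. -/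
lemma norm_local_error_le [CompleteSpace X] (hS : A.StrongCompatible) (h : IsMild A ι T R x)
    {t τ : ℝ} (ht : 0 ≤ t) (hτ : 0 ≤ τ) (hT : t + τ ≤ T) :
    ‖x (t + τ) - A.step τ (x t)‖ ≤ 2 * (A.lip R * (A.lip R * R)) * τ ^ 2 := by
  have hl := A.lip_nonneg R
  have hR : 0 ≤ R := (norm_nonneg _).trans (h.norm_le 0)
  rw [← hS.norm_flow τ, h.flow_local_error ht hτ hT]
  refine (norm_sub_le _ _).trans ?_
  rw [norm_smul, norm_smul, norm_neg, Complex.norm_I, one_mul, hS.norm_flow]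
  have c : Continuous fun r =>
      A.flow r (A.force (x (t + r)) - A.force (A.flow (-r) (x t))) := by
    refine A.continuous_flow.comp (continuous_id.prodMk ?_)
    exact (A.continuous_force.comp (h.continuous.comp (by fun_prop))).sub
      (A.continuous_force.comp (A.continuous_flow_neg _))
  have hI : ‖∫ r in (0 : ℝ)..τ, A.flow r (A.force (x (t + r)) - A.force (A.flow (-r) (x t)))‖
      ≤ A.lip R * (A.lip R * R * τ) * τ := by
    refine norm_map_integral_le (ContinuousLinearMap.id ℂ X) c hτ fun r hr hrτ => ?_
    rw [ContinuousLinearMap.id_apply, hS.norm_flow]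
    refine (Compatible.norm_force_sub_le hS (h.norm_le _) (R := R) ?_).trans ?_
    · rw [hS.norm_flow]; exact h.norm_le _
    · rw [ContinuousLinearMap.id_apply]
      have := h.norm_increment_le hS ht hr (by linarith)
      gcongr
      exact this.trans (by gcongr)
  have hK := hS.norm_corr_le (h.norm_le t)
  have hn : ‖((τ : ℂ) ^ 2 / 2)‖ ≤ τ ^ 2 := by
    rw [norm_div, norm_pow, Complex.norm_real, Real.norm_of_nonneg hτ, Complex.norm_ofNat]
    nlinarith
  have h2 : ‖((τ : ℂ) ^ 2 / 2)‖ * ‖A.corr (x t)‖ ≤ τ ^ 2 * (A.lip R * (A.lip R * R)) := by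
    gcongr
  linarith

end IsMild

end CubicSystem

end Abstract

end NonlinearDirac

/-! ### Third-order local error in the weak norm, and global convergence. -/

namespace NonlinearDirac

section Abstract

variable {X H : Type*} [NormedAddCommGroup X] [NormedSpace ℂ X]
  [NormedAddCommGroup H] [NormedSpace ℂ H]

namespace CubicSystem

variable {A : CubicSystem X} {ι : X →L[ℂ] H}

/-- The Lipschitz constant of `s ↦ flow s (G(x))` for the weak norm. -/
def forceReg (A : CubicSystem X) (κ R : ℝ) : ℝ := κ * R + A.lip R * R

/-- The Lipschitz constant of `s ↦ flow s (corr x)` for the weak norm. -/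
def corrReg (A : CubicSystem X) (κ R : ℝ) : ℝ :=
  κ * (A.lip R * R) + A.lip R * A.forceReg κ R + 6 * A.bound * R * (A.lip R * R) * R

/-- The flow does not commute with products of components moving in opposite directions. The
increment along it has the same weak norm as the increment under `shift`, which commutes with `cub`,
so the Lipschitz bound for the force applies; the commutator of `shift` with `lin` costs `P.const`.
-/
lemma Translations.force_lipschitz (P : A.Translations ι) (hA : A.Compatible ι)
    {R : ℝ} {x : X} (hx : ‖x‖ ≤ R)
    (hreg : ∀ s, ‖ι (A.flow s x - x)‖ ≤ R * |s|) (s : ℝ) :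
    ‖ι (A.flow s (A.force x) - A.force x)‖ ≤ A.forceReg P.const R * |s| := by
  have hκ := P.const_nonneg
  have hl := A.lip_nonneg R
  rw [← P.norm_shift_sub]
  have e : P.shift s (A.force x) - A.force x
      = (P.shift s (A.lin x) - A.lin (P.shift s x))
        + (A.force (P.shift s x) - A.force x) := by
    simp only [force, map_add, P.shift_cub]; abel
  have h1 := P.shift_lin s x
  have h2 := hA.norm_force_sub_le (R := R) ((P.norm_shift s x).trans_le hx) hx
  rw [P.norm_shift_sub] at h2
  have h3 : P.const * |s| * ‖x‖ ≤ P.const * |s| * R := by gcongr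
  have h4 : A.lip R * ‖ι (A.flow s x - x)‖ ≤ A.lip R * (R * |s|) := by
    gcongr; exact hreg s
  rw [e, map_add]
  refine (norm_add_le _ _).trans ?_
  unfold forceReg
  linarith

/-- The same exchange of flow and translation is applied to `G'(x)[k]` with `k = -iG(x)`. The
translation acts on the linear part, on the direction and on the base point, one term for each. -/
lemma Translations.corr_lipschitz (P : A.Translations ι) (hA : A.Compatible ι)
    (hS : A.StrongCompatible) {R : ℝ} {x : X} (hx : ‖x‖ ≤ R)
    (hreg : ∀ s, ‖ι (A.flow s x - x)‖ ≤ R * |s|) (s : ℝ) :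
    ‖ι (A.flow s (A.corr x) - A.corr x)‖ ≤ A.corrReg P.const R * |s| := by
  have hκ := P.const_nonneg
  have hl := A.lip_nonneg R
  have hb := A.bound_nonneg
  have hR : 0 ≤ R := (norm_nonneg x).trans hx
  rw [← P.norm_shift_sub]
  set k : X := -Complex.I • A.force x with hk
  have hkn : ‖k‖ ≤ A.lip R * R := by
    rw [hk, norm_smul, norm_neg, Complex.norm_I, one_mul]; exact hS.norm_force_le hx
  have e : P.shift s (A.corr x) - A.corr x = -Complex.I •
      ((P.shift s (A.lin k) - A.lin (P.shift s k))
        + A.dforce (P.shift s x) (P.shift s k - k)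
        + (A.dforce (P.shift s x) k - A.dforce x k)) := by
    have : P.shift s (A.dforce x k) = P.shift s (A.lin k) - A.lin (P.shift s k)
        + A.dforce (P.shift s x) (P.shift s k) := by
      simp only [dforce, map_add, P.shift_cub]; abel
    rw [corr, map_smul, ← smul_sub, ← hk, this, dforce_sub]
    congr 1; abel
  rw [e, map_smul, norm_smul, norm_neg, Complex.norm_I, one_mul, map_add, map_add]
  have hPx : ‖P.shift s x‖ ≤ R := (P.norm_shift s x).trans_le hx
  have h1 : ‖ι (P.shift s (A.lin k) - A.lin (P.shift s k))‖ ≤ P.const * |s| * (A.lip R * R) :=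
    (P.shift_lin s k).trans (by gcongr)
  have h2 : ‖ι (A.dforce (P.shift s x) (P.shift s k - k))‖
      ≤ A.lip R * (A.forceReg P.const R * |s|) := by
    refine (hA.norm_dforce_le hPx _).trans ?_
    have := P.force_lipschitz hA hx hreg s
    rw [← P.norm_shift_sub] at this
    rw [hk, map_smul, ← smul_sub, map_smul, norm_smul, norm_neg, Complex.norm_I, one_mul]
    gcongr
  have h3 : ‖ι (A.dforce (P.shift s x) k - A.dforce x k)‖
      ≤ 6 * A.bound * R * (A.lip R * R) * (R * |s|) := by
    refine (hA.norm_dforce_sub_le hPx hx k).trans ?_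
    rw [P.norm_shift_sub]
    gcongr
    exact hreg s
  refine norm_add₃_le.trans ?_
  unfold corrReg
  linarith

namespace IsMild

variable {T R : ℝ} {x : ℝ → X}

/-- The constant in `‖ι (h + i r G(x))‖ ≤ C r²` for the increment `h` of the solution. -/
def incrConst (A : CubicSystem X) (ν κ R : ℝ) : ℝ :=
  A.lip R * (ν * (A.lip R * R) + R) + A.forceReg κ R + A.forceReg κ R

/-- The deviation of the solution from its free evolution is `-i s G(x(t))` up to `O(s²)`. Replacing
the Duhamel integrand by its value at zero costs the Lipschitz regularity of the solution and of the
force along the flow, and removing the outer flow costs the latter once more. -/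
lemma norm_increment_add_le [CompleteSpace X] [CompleteSpace H] (P : A.Translations ι)
    (hA : A.Compatible ι) (hS : A.StrongCompatible) (h : IsMild A ι T R x)
    {t s : ℝ} (ht : 0 ≤ t) (hs : 0 ≤ s) (hT : t + s ≤ T) :
    ‖ι (x (t + s) - A.flow (-s) (x t) - (s : ℂ) • (-Complex.I • A.force (x t)))‖
      ≤ incrConst A ‖ι‖ P.const R * s ^ 2 := by
  have hl := A.lip_nonneg R
  have hreg := P.force_lipschitz hA (h.norm_le t) (h.lipschitz t)
  have c : Continuous fun r => A.flow r (A.force (x (t + r))) :=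
    A.continuous_pullback (h.continuous.comp (by fun_prop))
  set J := ∫ r in (0 : ℝ)..s, (A.flow r (A.force (x (t + r))) - A.force (x t)) with hJ
  have hJ' : ∫ r in (0 : ℝ)..s, A.flow r (A.force (x (t + r))) = J + (s : ℂ) • A.force (x t) := by
    rw [hJ, intervalIntegral.integral_sub (c.intervalIntegrable _ _) (by simp),
      intervalIntegral.integral_const, sub_zero, Complex.coe_smul, sub_add_cancel]
  have hJn : ‖ι J‖ ≤ (A.lip R * (‖ι‖ * (A.lip R * R) + R) + A.forceReg P.const R) * s * s := by
    refine norm_map_integral_le ι (c.sub continuous_const) hs fun r hr hrs => ?_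
    have e : A.flow r (A.force (x (t + r))) - A.force (x t)
        = A.flow r (A.force (x (t + r)) - A.force (x t))
          + (A.flow r (A.force (x t)) - A.force (x t)) := by rw [map_sub]; abel
    have h1 := hA.norm_force_sub_le (h.norm_le (t + r)) (h.norm_le t)
    have h2 : ‖ι (x (t + r) - x t)‖ ≤ ‖ι‖ * (A.lip R * R * r) + R * r := by
      have e' : x (t + r) - x t
          = (x (t + r) - A.flow (-r) (x t)) + (A.flow (-r) (x t) - x t) := by abel
      rw [e', map_add]
      refine (norm_add_le _ _).trans (add_le_add ?_ ?_)
      · exact (ι.le_opNorm _).trans (by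
          gcongr; exact h.norm_increment_le hS ht hr (by linarith))
      · have := h.lipschitz t (-r)
        rwa [abs_neg, abs_of_nonneg hr] at this
    have h3 := hreg r
    rw [abs_of_nonneg hr] at h3
    have h4 : A.lip R * ‖ι (x (t + r) - x t)‖
        ≤ A.lip R * (‖ι‖ * (A.lip R * R * r) + R * r) := by gcongr
    have h5 : (A.lip R * (‖ι‖ * (A.lip R * R) + R) + A.forceReg P.const R) * r
        ≤ (A.lip R * (‖ι‖ * (A.lip R * R) + R) + A.forceReg P.const R) * s := by
      have hR : 0 ≤ R := (norm_nonneg _).trans (h.norm_le 0)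
      have := P.const_nonneg
      have : 0 ≤ A.forceReg P.const R := by unfold forceReg; positivity
      gcongr
    change ‖ι (A.flow r (A.force (x (t + r))) - A.force (x t))‖ ≤ _
    rw [e, map_add]
    refine (norm_add_le _ _).trans ?_
    rw [hA.norm_flow]
    linarith
  have e : x (t + s) - A.flow (-s) (x t) - (s : ℂ) • (-Complex.I • A.force (x t))
      = -Complex.I • (A.flow (-s) J
        + (s : ℂ) • (A.flow (-s) (A.force (x t)) - A.force (x t))) := by
    rw [h.increment ht hs hT, hJ', map_add, map_smul, smul_comm (s : ℂ) (-Complex.I), ← smul_sub,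
      smul_sub (s : ℂ)]
    congr 1; abel
  have h6 := hreg (-s)
  rw [abs_neg, abs_of_nonneg hs] at h6
  rw [e, map_smul, norm_smul, norm_neg, Complex.norm_I, one_mul, map_add, map_smul]
  refine (norm_add_le _ _).trans ?_
  rw [hA.norm_flow, norm_smul, Complex.norm_real, Real.norm_of_nonneg hs]
  have h7 : s * ‖ι (A.flow (-s) (A.force (x t)) - A.force (x t))‖
      ≤ s * (A.forceReg P.const R * s) := by gcongr
  unfold incrConst
  linarith

/-- The constant in the integrand of the weak local error. -/
def integrandConst (A : CubicSystem X) (ν κ R : ℝ) : ℝ :=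
  4 * A.bound * (2 * R) * (A.lip R * R) * (ν * (A.lip R * R)) + A.lip R * incrConst A ν κ R
    + 6 * A.bound * R * (A.lip R * R) * R + A.corrReg κ R

/-- To first order in `s` the neglected part of the Duhamel integrand is `s • (I • corr)`, whose
integral is the correction added in `step`. -/
lemma norm_integrand_le [CompleteSpace X] [CompleteSpace H] (P : A.Translations ι)
    (hA : A.Compatible ι) (hS : A.StrongCompatible) (h : IsMild A ι T R x)
    {t s : ℝ} (ht : 0 ≤ t) (hs : 0 ≤ s) (hT : t + s ≤ T) :
    ‖ι (A.flow s (A.force (x (t + s)) - A.force (A.flow (-s) (x t)))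
        - (s : ℂ) • (Complex.I • A.corr (x t)))‖ ≤ integrandConst A ‖ι‖ P.const R * s ^ 2 := by
  have hl := A.lip_nonneg R
  have hb := A.bound_nonneg
  have hR : 0 ≤ R := (norm_nonneg _).trans (h.norm_le 0)
  set y := A.flow (-s) (x t) with hy
  set k : X := -Complex.I • A.force (x t) with hk
  set g := x (t + s) - y with hg
  have hyR : ‖y‖ ≤ R := by rw [hy, hS.norm_flow]; exact h.norm_le t
  have hkn : ‖k‖ ≤ A.lip R * R := by
    rw [hk, norm_smul, norm_neg, Complex.norm_I, one_mul]; exact hS.norm_force_le (h.norm_le t)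
  have hgn : ‖g‖ ≤ A.lip R * R * s := h.norm_increment_le hS ht hs hT
  have hZ : Complex.I • A.corr (x t) = A.dforce (x t) k := by
    rw [corr, ← hk, smul_smul]; simp
  -- The four terms are the Taylor remainder at the free evolution, the deviation of `g` from its
  -- leading part `s k`, the change of base point from `flow (-s) (x t)` to `x t`, and the increment
  -- of the correction along the flow.
  have e : A.flow s (A.force (x (t + s)) - A.force y) - (s : ℂ) • (Complex.I • A.corr (x t))
      = A.flow s (A.force (y + g) - A.force y - A.dforce y g)
        + A.flow s (A.dforce y (g - (s : ℂ) • k))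
        + (s : ℂ) • A.flow s (A.dforce y k - A.dforce (x t) k)
        + (s : ℂ) • (Complex.I • (A.flow s (A.corr (x t)) - A.corr (x t))) := by
    have : y + g = x (t + s) := by rw [hg]; abel
    have hZ' : Complex.I • A.flow s (A.corr (x t)) = A.flow s (A.dforce (x t) k) := by
      rw [← map_smul, hZ]
    rw [this, A.dforce_sub y g, dforce_smul, smul_sub Complex.I, hZ', hZ]
    simp only [map_sub, map_smul, smul_sub]
    abel
  have h1 : ‖ι (A.flow s (A.force (y + g) - A.force y - A.dforce y g))‖
      ≤ 4 * A.bound * (2 * R) * (A.lip R * R) * (‖ι‖ * (A.lip R * R)) * s ^ 2 := by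
    rw [hA.norm_flow]
    -- The increment `g` is a difference of two vectors of norm at most `R`, so the Taylor bound is
    -- used with radius `2 * R`.
    refine (hA.norm_taylor_le (R := 2 * R) (hyR.trans (by linarith)) ?_).trans ?_
    · refine (norm_sub_le _ _).trans ?_
      have := h.norm_le (t + s)
      linarith
    · have hι : ‖ι g‖ ≤ ‖ι‖ * (A.lip R * R * s) := (ι.le_opNorm g).trans (by gcongr)
      calc 4 * A.bound * (2 * R) * ‖g‖ * ‖ι g‖
          ≤ 4 * A.bound * (2 * R) * (A.lip R * R * s) * (‖ι‖ * (A.lip R * R * s)) := by gcongr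
        _ = _ := by ring
  have h2 : ‖ι (A.flow s (A.dforce y (g - (s : ℂ) • k)))‖
      ≤ A.lip R * (incrConst A ‖ι‖ P.const R * s ^ 2) := by
    rw [hA.norm_flow]
    refine (hA.norm_dforce_le hyR _).trans ?_
    gcongr
    exact h.norm_increment_add_le P hA hS ht hs hT
  have h3 : ‖ι ((s : ℂ) • A.flow s (A.dforce y k - A.dforce (x t) k))‖
      ≤ s * (6 * A.bound * R * (A.lip R * R) * (R * s)) := by
    rw [map_smul, norm_smul, Complex.norm_real, Real.norm_of_nonneg hs, hA.norm_flow]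
    gcongr
    refine (hA.norm_dforce_sub_le hyR (h.norm_le t) k).trans ?_
    have := h.lipschitz t (-s)
    rw [abs_neg, abs_of_nonneg hs] at this
    gcongr
  have h4 : ‖ι ((s : ℂ) • (Complex.I • (A.flow s (A.corr (x t)) - A.corr (x t))))‖
      ≤ s * (A.corrReg P.const R * s) := by
    rw [map_smul, norm_smul, Complex.norm_real, Real.norm_of_nonneg hs, map_smul, norm_smul,
      Complex.norm_I, one_mul]
    have := P.corr_lipschitz hA hS (h.norm_le t) (h.lipschitz t) s
    rw [abs_of_nonneg hs] at this
    gcongr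
  rw [e, map_add, map_add, map_add]
  refine norm_add₄_le.trans ?_
  unfold integrandConst
  linarith

/-- The constant in the weak local error. -/
def localConst (A : CubicSystem X) (ν κ R : ℝ) : ℝ := integrandConst A ν κ R + A.corrReg κ R

/-- The first-order part of the integrand integrates to `(τ²/2)K` and the scheme supplies `(τ²/2)K`
after the flow. What remains is the increment of `K` along the flow, of size `τ` times `τ²/2`, and
the integrated `O(r²)` error. -/
lemma norm_map_local_error_le [CompleteSpace X] [CompleteSpace H] (P : A.Translations ι)
    (hA : A.Compatible ι) (hS : A.StrongCompatible) (h : IsMild A ι T R x)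
    {t τ : ℝ} (ht : 0 ≤ t) (hτ : 0 ≤ τ) (hT : t + τ ≤ T) :
    ‖ι (x (t + τ) - A.step τ (x t))‖ ≤ localConst A ‖ι‖ P.const R * τ ^ 3 := by
  have hl := A.lip_nonneg R
  have hb := A.bound_nonneg
  have hκ := P.const_nonneg
  have hR : 0 ≤ R := (norm_nonneg _).trans (h.norm_le 0)
  have hc0 : 0 ≤ A.corrReg P.const R := by unfold corrReg forceReg; positivity
  have hi0 : 0 ≤ integrandConst A ‖ι‖ P.const R := by
    unfold integrandConst incrConst forceReg; positivity
  have c : Continuous fun r =>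
      A.flow r (A.force (x (t + r)) - A.force (A.flow (-r) (x t))) := by
    refine A.continuous_flow.comp (continuous_id.prodMk ?_)
    exact (A.continuous_force.comp (h.continuous.comp (by fun_prop))).sub
      (A.continuous_force.comp (A.continuous_flow_neg _))
  set K := A.corr (x t) with hK
  have c' : Continuous fun r : ℝ => (r : ℂ) • (Complex.I • K) := by fun_prop
  have hint : ∫ r in (0 : ℝ)..τ, (r : ℂ) • (Complex.I • K) = ((τ : ℂ) ^ 2 / 2) • (Complex.I • K) := by
    rw [intervalIntegral.integral_smul_const]
    congr 1
    rw [intervalIntegral.integral_ofReal, integral_id]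
    push_cast; ring
  have e : A.flow τ (x (t + τ) - A.step τ (x t)) = -Complex.I • (∫ r in (0 : ℝ)..τ,
      (A.flow r (A.force (x (t + r)) - A.force (A.flow (-r) (x t))) - (r : ℂ) • (Complex.I • K)))
      - ((τ : ℂ) ^ 2 / 2) • (A.flow τ K - K) := by
    rw [intervalIntegral.integral_sub (c.intervalIntegrable _ _) (c'.intervalIntegrable _ _), hint,
      h.flow_local_error ht hτ hT, smul_sub (-Complex.I), smul_comm (-Complex.I) _ (Complex.I • K),
      smul_smul (-Complex.I) Complex.I, neg_mul, Complex.I_mul_I, neg_neg, one_smul, smul_sub]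
    abel
  rw [← hA.norm_flow τ, e, map_sub, map_smul, map_smul]
  refine (norm_sub_le _ _).trans ?_
  rw [norm_smul, norm_smul, norm_neg, Complex.norm_I, one_mul]
  have h1 : ‖ι (∫ r in (0 : ℝ)..τ,
      (A.flow r (A.force (x (t + r)) - A.force (A.flow (-r) (x t))) - (r : ℂ) • (Complex.I • K)))‖
      ≤ integrandConst A ‖ι‖ P.const R * τ ^ 2 * τ := by
    refine norm_map_integral_le ι (c.sub c') hτ fun r hr hrτ => ?_
    refine (h.norm_integrand_le P hA hS ht hr (by linarith)).trans ?_
    gcongr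
  have hn : ‖((τ : ℂ) ^ 2 / 2)‖ ≤ τ ^ 2 := by
    rw [norm_div, norm_pow, Complex.norm_real, Real.norm_of_nonneg hτ, Complex.norm_ofNat]
    nlinarith
  have h2 := P.corr_lipschitz hA hS (h.norm_le t) (h.lipschitz t) τ
  rw [abs_of_nonneg hτ] at h2
  have h3 : ‖((τ : ℂ) ^ 2 / 2)‖ * ‖ι (A.flow τ K - K)‖ ≤ τ ^ 2 * (A.corrReg P.const R * τ) := by
    gcongr
  unfold localConst
  linarith

end IsMild

/-- A discrete Gronwall inequality in which the recursion may use the bound obtained so far. -/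
lemma discrete_gronwall {a : ℕ → ℝ} {τ L δ T : ℝ} (hτ : 0 ≤ τ) (hL : 0 ≤ L) (hδ : 0 ≤ δ)
    (h0 : a 0 ≤ 0)
    (hstep : ∀ n : ℕ, ((n + 1 : ℕ) : ℝ) * τ ≤ T → a n ≤ n * δ * Real.exp (L * (n * τ)) →
      a (n + 1) ≤ (1 + L * τ) * a n + δ) :
    ∀ n : ℕ, (n : ℝ) * τ ≤ T → a n ≤ n * δ * Real.exp (L * (n * τ)) := by
  intro n
  induction n with
  | zero => intro _; simpa using h0
  | succ n ih =>
    intro hn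
    have hn' : (n : ℝ) * τ ≤ T := by push_cast at hn; linarith
    have ha := ih hn'
    refine (hstep n hn ha).trans ?_
    have h1 : 1 + L * τ ≤ Real.exp (L * τ) := by
      rw [add_comm]; exact Real.add_one_le_exp _
    have h2 : Real.exp (L * ((n + 1 : ℕ) * τ)) = Real.exp (L * τ) * Real.exp (L * (n * τ)) := by
      rw [← Real.exp_add]; push_cast; ring_nf
    have h3 : (1 : ℝ) ≤ Real.exp (L * ((n + 1 : ℕ) * τ)) := Real.one_le_exp (by positivity)
    calc (1 + L * τ) * a n + δ
        ≤ (1 + L * τ) * (n * δ * Real.exp (L * (n * τ))) + δ := by gcongr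
      _ ≤ Real.exp (L * τ) * (n * δ * Real.exp (L * (n * τ))) + δ * 1 := by
          rw [mul_one]; gcongr
      _ ≤ Real.exp (L * τ) * (n * δ * Real.exp (L * (n * τ)))
          + δ * Real.exp (L * ((n + 1 : ℕ) * τ)) := by gcongr
      _ = _ := by rw [h2]; push_cast; ring

/-- Second-order convergence in the weak norm. -/
theorem convergence [CompleteSpace X] [CompleteSpace H] (P : A.Translations ι)
    (hA : A.Compatible ι) (hS : A.StrongCompatible) {T R : ℝ} (hT : 0 < T) (hR : 0 ≤ R) :
    ∃ τ₀ C : ℝ, 0 < τ₀ ∧ 0 < C ∧ ∀ x : ℝ → X, IsMild A ι T R x →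
      ∀ τ : ℝ, 0 < τ → τ ≤ τ₀ → ∀ n : ℕ, (n : ℝ) * τ ≤ T →
        ‖ι (x (n * τ) - (A.step τ)^[n] (x 0))‖ ≤ C * τ ^ 2 := by
  set L := A.stab (R + 1) with hLdef
  have hL : 0 ≤ L := A.stab_nonneg (by linarith)
  have hl := A.lip_nonneg R
  have hb := A.bound_nonneg
  have hκ := P.const_nonneg
  set D := 2 * (A.lip R * (A.lip R * R)) with hD
  have hD0 : 0 ≤ D := by positivity
  set E := IsMild.localConst A ‖ι‖ P.const R with hE
  have hE0 : 0 ≤ E := by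
    rw [hE]
    unfold IsMild.localConst IsMild.integrandConst IsMild.incrConst corrReg forceReg
    positivity
  -- The second entry of the minimum makes the strong global error bound `T D e^{LT} τ` at most `1`.
  -- The iterates then stay in the ball of radius `R + 1`, for which `L` was chosen.
  refine ⟨min 1 (1 / (T * D * Real.exp (L * T) + 1)), T * E * Real.exp (L * T) + 1,
    by positivity, by positivity, ?_⟩
  intro x hx τ hτ hτ₀ n hn
  have hτ1 : τ ≤ 1 := hτ₀.trans (min_le_left _ _)
  have hτ2 : T * D * Real.exp (L * T) * τ ≤ 1 := by
    have h1 := hτ₀.trans (min_le_right _ _)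
    rw [le_div_iff₀ (by positivity)] at h1
    linarith
  have key : ∀ (c : ℝ), 0 ≤ c → ∀ m : ℕ, (m : ℝ) * τ ≤ T →
      m * (c * τ) * Real.exp (L * (m * τ)) ≤ T * c * Real.exp (L * T) := by
    intro c hc m hm
    calc (m : ℝ) * (c * τ) * Real.exp (L * (m * τ))
        = (m * τ) * c * Real.exp (L * (m * τ)) := by ring
      _ ≤ T * c * Real.exp (L * T) := by gcongr
  have iter : ∀ m : ℕ, (A.step τ)^[m + 1] (x 0) = A.step τ ((A.step τ)^[m] (x 0)) := fun m =>
    Function.iterate_succ_apply' _ _ _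
  have hsplit : ∀ m : ℕ, x ((m + 1 : ℕ) * τ) - (A.step τ)^[m + 1] (x 0)
      = (A.step τ (x (m * τ)) - A.step τ ((A.step τ)^[m] (x 0)))
        + (x (m * τ + τ) - A.step τ (x (m * τ))) := by
    intro m
    have : ((m + 1 : ℕ) : ℝ) * τ = m * τ + τ := by push_cast; ring
    rw [iter, this]; abel
  have hball : ∀ m : ℕ, ‖x (m * τ) - (A.step τ)^[m] (x 0)‖ ≤ 1 →
      ‖(A.step τ)^[m] (x 0)‖ ≤ R + 1 := by
    intro m hm
    have h1 := norm_sub_le (x (m * τ)) (x (m * τ) - (A.step τ)^[m] (x 0))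
    rw [sub_sub_cancel] at h1
    have := hx.norm_le (m * τ)
    linarith
  -- This is the bootstrap: the bound already obtained at step `m` places the iterate in the ball
  -- where the stability estimate for the next step is valid.
  have strong : ∀ m : ℕ, (m : ℝ) * τ ≤ T →
      ‖x (m * τ) - (A.step τ)^[m] (x 0)‖ ≤ m * (D * τ * τ) * Real.exp (L * (m * τ)) := by
    refine discrete_gronwall hτ.le hL (by positivity) (by simp) fun m hm hb => ?_
    have hm' : (m : ℝ) * τ + τ ≤ T := by push_cast at hm; linarith
    have h1 : ‖x (m * τ) - (A.step τ)^[m] (x 0)‖ ≤ 1 := by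
      have := key (D * τ) (by positivity) m (by linarith)
      linarith
    rw [hsplit]
    refine (norm_add_le _ _).trans (add_le_add ?_ ?_)
    · exact Compatible.norm_step_sub_le hS hS ((hx.norm_le _).trans (by linarith)) (hball m h1)
        hτ.le hτ1
    · have := hx.norm_local_error_le hS (t := m * τ) (by positivity) hτ.le hm'
      linarith
  -- The ball comes from `strong`, not from the weak bound, since the weak norm does not control the
  -- strong one.
  have weak : ∀ m : ℕ, (m : ℝ) * τ ≤ T →
      ‖ι (x (m * τ) - (A.step τ)^[m] (x 0))‖
        ≤ m * (E * τ ^ 2 * τ) * Real.exp (L * (m * τ)) := by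
    refine discrete_gronwall hτ.le hL (by positivity) (by simp) fun m hm hb => ?_
    have hm' : (m : ℝ) * τ + τ ≤ T := by push_cast at hm; linarith
    have h1 : ‖x (m * τ) - (A.step τ)^[m] (x 0)‖ ≤ 1 := by
      have := key (D * τ) (by positivity) m (by linarith)
      have := strong m (by linarith)
      linarith
    rw [hsplit, map_add]
    refine (norm_add_le _ _).trans (add_le_add ?_ ?_)
    · exact hA.norm_step_sub_le hS ((hx.norm_le _).trans (by linarith)) (hball m h1) hτ.le hτ1
    · have := hx.norm_map_local_error_le P hA hS (t := m * τ) (by positivity) hτ.le hm'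
      linarith
  have h1 := weak n hn
  have h2 := key (E * τ ^ 2) (by positivity) n hn
  have h3 : 0 ≤ τ ^ 2 := by positivity
  linarith

end CubicSystem

end Abstract

end NonlinearDirac

/-! ### The Wiener algebra, translations and Fourier multipliers on continuous functions. -/

namespace NonlinearDirac

noncomputable section

/-- Continuous complex-valued functions on the torus. -/
abbrev CT : Type := C(Torus, ℂ)

/-- The normalized Haar measure of the torus. -/
abbrev haar : Measure Torus := AddCircle.haarAddCircle

lemma fourier_coe_eq (n : ℤ) (s : ℝ) :
    fourier n (s : Torus) = Complex.exp (Complex.I * ((s : ℂ) * (n : ℂ))) := by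
  rw [fourier_coe_apply]
  congr 1
  have : (Real.pi : ℂ) ≠ 0 := Complex.ofReal_ne_zero.2 Real.pi_ne_zero
  push_cast
  field_simp

lemma norm_fourier_apply (n : ℤ) (x : Torus) : ‖fourier n x‖ = 1 := by
  rw [fourier_apply]; exact Circle.norm_coe _

lemma integrable_coe (f : CT) : Integrable f haar :=
  f.continuous.integrable_of_hasCompactSupport (HasCompactSupport.of_compactSpace _)

/-- The Fourier coefficient as a continuous linear functional. -/
def coeff (n : ℤ) : CT →L[ℂ] ℂ :=
  LinearMap.mkContinuous
    { toFun := fun f => fourierCoeff f n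
      map_add' := fun f g => congrFun (fourierCoeff.add (integrable_coe f) (integrable_coe g)) n
      map_smul' := fun c f => fourierCoeff.const_smul f c n } 1 fun f => by
    simp only [LinearMap.coe_mk, AddHom.coe_mk, one_mul, fourierCoeff]
    refine (norm_integral_le_of_norm_le_const (C := ‖f‖) (ae_of_all _ fun x => ?_)).trans ?_
    · rw [norm_smul, norm_fourier_apply, one_mul]; exact f.norm_coe_le_norm x
    · simp

lemma coeff_apply (n : ℤ) (f : CT) : coeff n f = fourierCoeff f n := rfl

/-- The functions with absolutely convergent Fourier series. -/
def Wiener (f : CT) : Prop := Summable fun n : ℤ => coeff n f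

lemma Wiener.hasSum {f : CT} (hf : Wiener f) (x : Torus) :
    HasSum (fun n : ℤ => coeff n f * fourier n x) (f x) :=
  has_pointwise_sum_fourier_series_of_summable (f := f) hf x

lemma Wiener.hasSum_uniform {f : CT} (hf : Wiener f) :
    HasSum (fun n : ℤ => coeff n f • (fourier n : CT)) f :=
  hasSum_fourier_series_of_summable (f := f) hf

/-- The difference has vanishing, hence summable, coefficients, so it is the sum of its own Fourier
series. This permits coefficientwise proofs without assuming `Wiener`. -/
lemma ext_coeff {f g : CT} (h : ∀ n, coeff n f = coeff n g) : f = g := by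
  have h0 : ∀ n, coeff n (f - g) = 0 := fun n => by rw [map_sub, h, sub_self]
  have hW : Wiener (f - g) := by simp only [Wiener, h0]; exact summable_zero
  have := hW.hasSum_uniform
  simp only [h0, zero_smul] at this
  exact sub_eq_zero.1 (this.unique hasSum_zero)

lemma coeff_fourier (n m : ℤ) : coeff n (fourier m : CT) = if n = m then 1 else 0 := by
  rw [coeff_apply, fourierCoeff_fourier, Pi.single_apply]

lemma wiener_of_le {f g : CT} (C : ℝ) (hg : Wiener g)
    (h : ∀ n, ‖coeff n f‖ ≤ C * ‖coeff n g‖) : Wiener f :=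
  Summable.of_norm_bounded (hg.norm.mul_left C) h

lemma Wiener.add {f g : CT} (hf : Wiener f) (hg : Wiener g) : Wiener (f + g) := by
  simp only [Wiener, map_add]; exact Summable.add hf hg

lemma Wiener.smul {f : CT} (hf : Wiener f) (c : ℂ) : Wiener (c • f) := by
  simp only [Wiener, map_smul]; exact Summable.const_smul c hf

lemma Wiener.neg {f : CT} (hf : Wiener f) : Wiener (-f) := by
  simpa using hf.smul (-1)

lemma Wiener.sub {f g : CT} (hf : Wiener f) (hg : Wiener g) : Wiener (f - g) := by
  rw [sub_eq_add_neg]; exact hf.add hg.neg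

lemma coeff_star (f : CT) (n : ℤ) : coeff n (star f) = star (coeff (-n) f) := by
  simp only [coeff_apply, fourierCoeff, smul_eq_mul]
  rw [show (star (∫ t, fourier (- -n) t * f t ∂haar) : ℂ)
    = ∫ t, star (fourier (- -n) t * f t) ∂haar from integral_conj.symm]
  refine integral_congr_ae (ae_of_all _ fun x => ?_)
  simp only [ContinuousMap.star_apply, star_mul', neg_neg]
  rw [fourier_neg]; rfl

lemma Wiener.star {f : CT} (hf : Wiener f) : Wiener (star f) := by
  have h : Summable fun n : ℤ => ‖coeff (-n) f‖ :=
    (Equiv.neg ℤ).summable_iff.2 (Summable.norm hf)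
  refine Summable.of_norm_bounded h fun n => ?_
  rw [coeff_star, norm_star]

lemma coeff_fourier_mul (n m : ℤ) (g : CT) :
    coeff n ((fourier m : CT) * g) = coeff (n - m) g := by
  simp only [coeff_apply, fourierCoeff, smul_eq_mul, ContinuousMap.mul_apply, ← mul_assoc,
    ← fourier_add]
  rw [show -(n - m) = -n + m by ring]

lemma summable_convolution {a b : ℤ → ℝ} (h : Summable fun p : ℤ × ℤ => a p.1 * b p.2) :
    Summable fun p : ℤ × ℤ => a p.2 * b (p.1 - p.2) := by
  let e : ℤ × ℤ ≃ ℤ × ℤ :=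
    { toFun := fun p => (p.2, p.1 - p.2)
      invFun := fun p => (p.1 + p.2, p.1)
      left_inv := fun p => by simp
      right_inv := fun p => by simp }
  exact (e.summable_iff (f := fun p : ℤ × ℤ => a p.1 * b p.2)).2 h

/-- The coefficients of a product form a convolution, and `ℓ¹` is closed under convolution.
Expanding `f` uniformly and applying `coeff n` termwise gives the convolution formula. -/
lemma Wiener.mul {f g : CT} (hf : Wiener f) (hg : Wiener g) : Wiener (f * g) := by
  have hs : Summable fun p : ℤ × ℤ => ‖coeff p.1 f‖ * ‖coeff p.2 g‖ :=
    Summable.mul_of_nonneg (f := fun n : ℤ => ‖coeff n f‖) (g := fun n : ℤ => ‖coeff n g‖)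
      (Summable.norm hf) (Summable.norm hg) (fun _ => norm_nonneg _) fun _ => norm_nonneg _
  have hs' : Summable fun p : ℤ × ℤ => ‖coeff p.2 f‖ * ‖coeff (p.1 - p.2) g‖ :=
    summable_convolution (a := fun n => ‖coeff n f‖) (b := fun n => ‖coeff n g‖) hs
  have h2 := (summable_prod_of_nonneg (fun p => by positivity)).1 hs'
  refine Summable.of_norm_bounded h2.2 fun n => ?_
  have h3 : HasSum (fun m : ℤ => coeff m f * coeff (n - m) g) (coeff n (f * g)) := by
    have := (coeff n).hasSum (hf.hasSum_uniform.mul_right g)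
    simpa only [smul_mul_assoc, map_smul, coeff_fourier_mul, smul_eq_mul] using this
  rw [← h3.tsum_eq]
  have h4 := h2.1 n
  simp only [← norm_mul] at h4 ⊢
  exact norm_tsum_le_tsum_norm h4

/-- Translation `f ↦ f(· + s)`. -/
def shift (s : ℝ) : CT →L[ℂ] CT :=
  LinearMap.mkContinuous
    { toFun := fun f => f.comp (ContinuousMap.addRight (s : Torus))
      map_add' := fun _ _ => rfl
      map_smul' := fun _ _ => rfl } 1 fun f => by
    rw [one_mul]
    exact (ContinuousMap.norm_le _ (norm_nonneg f)).2 fun _ => f.norm_coe_le_norm _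

lemma shift_apply (s : ℝ) (f : CT) (x : Torus) : shift s f x = f (x + (s : Torus)) := rfl

lemma shift_zero (f : CT) : shift 0 f = f := by
  ext x; simp [shift_apply]

lemma shift_add (s t : ℝ) (f : CT) : shift (s + t) f = shift s (shift t f) := by
  ext x; simp [shift_apply, add_assoc]

lemma shift_mul (s : ℝ) (f g : CT) : shift s (f * g) = shift s f * shift s g := rfl

lemma shift_star (s : ℝ) (f : CT) : shift s (star f) = star (shift s f) := rfl

lemma norm_shift_le (s : ℝ) (f : CT) : ‖shift s f‖ ≤ ‖f‖ :=
  (ContinuousMap.norm_le _ (norm_nonneg f)).2 fun _ => f.norm_coe_le_norm _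

lemma norm_shift (s : ℝ) (f : CT) : ‖shift s f‖ = ‖f‖ := by
  refine le_antisymm (norm_shift_le s f) ?_
  have := norm_shift_le (-s) (shift s f)
  rwa [← shift_add, neg_add_cancel, shift_zero] at this

/-- Joint continuity rests on uniform continuity over the compact torus; in operator norm the
translations would not be continuous in `s`. -/
lemma continuous_shift : Continuous fun p : ℝ × CT => shift p.1 p.2 := by
  have h : Continuous fun p : ℝ × CT => (ContinuousMap.addRight ((p.1 : ℝ) : Torus)) := by
    refine ContinuousMap.continuous_of_continuous_uncurry _ ?_
    have h1 : Continuous fun q : (ℝ × CT) × Torus => ((q.1.1 : ℝ) : Torus) :=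
      (AddCircle.continuous_mk' _).comp (continuous_fst.comp continuous_fst)
    exact continuous_snd.add h1
  exact continuous_snd.compCM h

lemma coeff_shift (n : ℤ) (s : ℝ) (f : CT) :
    coeff n (shift s f) = Complex.exp (Complex.I * ((s : ℂ) * (n : ℂ))) * coeff n f := by
  have h := integral_add_right_eq_self (μ := haar)
    (fun t => fourier (-n) (t - (s : Torus)) * f t) (s : Torus)
  simp only [add_sub_cancel_right] at h
  simp only [coeff_apply, fourierCoeff, smul_eq_mul, shift_apply]
  rw [h, ← fourier_coe_eq, ← integral_const_mul]
  refine integral_congr_ae (ae_of_all _ fun x => ?_)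
  simp only
  rw [← mul_assoc]
  congr 1
  rw [fourier_apply, fourier_apply, fourier_apply, ← Circle.coe_mul, ← AddCircle.toCircle_add]
  congr 2
  simp only [smul_sub, neg_smul]
  abel

lemma norm_coeff_shift (n : ℤ) (s : ℝ) (f : CT) : ‖coeff n (shift s f)‖ = ‖coeff n f‖ := by
  rw [coeff_shift, norm_mul, ← fourier_coe_eq, norm_fourier_apply, one_mul]

lemma Wiener.shift {f : CT} (hf : Wiener f) (s : ℝ) : Wiener (shift s f) :=
  wiener_of_le 1 hf fun n => by rw [norm_coeff_shift, one_mul]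

lemma coeff_integral (n : ℤ) {f : ℝ → CT} (hf : Continuous f) (a b : ℝ) :
    coeff n (∫ r in a..b, f r) = ∫ r in a..b, coeff n (f r) :=
  (ContinuousLinearMap.intervalIntegral_comp_comm (coeff n) (hf.intervalIntegrable a b)).symm

lemma continuous_shift_mul (c : ℝ) (f : CT) : Continuous fun r : ℝ => shift (c * r) f :=
  continuous_shift.comp ((continuous_const.mul continuous_id).prodMk continuous_const)

/-- Because `φ₁(z) = ∫₀¹ e^{θz} dθ`, averaging translations over `[0, τ]` realizes `τ φ₁(cτ∂ₓ)`. The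
zero-frequency case is the convention `φ₁(0) = 1`. -/
lemma coeff_integral_shift (n : ℤ) (c τ : ℝ) (f : CT) :
    coeff n (∫ r in (0 : ℝ)..τ, shift (c * r) f)
      = τ * phi1 (Complex.I * (((c * τ : ℝ) : ℂ) * (n : ℂ))) * coeff n f := by
  rw [coeff_integral n (continuous_shift_mul c f)]
  simp only [coeff_shift]
  rw [intervalIntegral.integral_mul_const]
  congr 1
  have e : ∀ r : ℝ, Complex.I * (((c * r : ℝ) : ℂ) * (n : ℂ)) = (Complex.I * c * n) * (r : ℂ) := by
    intro r; push_cast; ring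
  simp only [e]
  unfold phi1
  by_cases h : Complex.I * c * n = 0
  · simp [h]
  · rw [integral_exp_mul_complex h]
    by_cases hτ : τ = 0
    · simp [hτ]
    · have hτ' : (τ : ℂ) ≠ 0 := Complex.ofReal_ne_zero.2 hτ
      rw [if_neg (mul_ne_zero h hτ')]
      simp only [Complex.ofReal_zero, mul_zero, Complex.exp_zero]
      field_simp

lemma Wiener.integral_shift {f : CT} (hf : Wiener f) (c τ : ℝ) :
    Wiener (∫ r in (0 : ℝ)..τ, NonlinearDirac.shift (c * r) f) := by
  refine wiener_of_le |τ| hf fun n => ?_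
  rw [coeff_integral n (continuous_shift_mul c f)]
  refine (intervalIntegral.norm_integral_le_of_norm_le_const (C := ‖coeff n f‖) fun r _ => ?_).trans ?_
  · rw [norm_coeff_shift]
  · rw [sub_zero, mul_comm]

/-- The symbol of `∂ₓₓ⁻¹`. -/
def invSymbol (l : ℤ) : ℂ := if l = 0 then 0 else -1 / (l : ℂ) ^ 2

lemma norm_invSymbol_le (l : ℤ) : ‖invSymbol l‖ ≤ 1 := by
  unfold invSymbol
  split_ifs with h
  · simp
  · have h1 : (1 : ℝ) ≤ |(l : ℝ)| := by
      exact_mod_cast Int.one_le_abs h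
    rw [norm_div, norm_neg, norm_one, norm_pow, Complex.norm_intCast]
    rw [div_le_one (by positivity)]
    nlinarith

lemma summable_invSymbol : Summable fun l : ℤ => ‖invSymbol l‖ := by
  refine Summable.of_nonneg_of_le (fun _ => norm_nonneg _) (fun l => ?_)
    (Real.summable_one_div_int_pow.2 one_lt_two)
  unfold invSymbol
  split_ifs with h
  · rw [norm_zero]; positivity
  · rw [norm_div, norm_neg, norm_one, norm_pow, Complex.norm_intCast, sq_abs]

/-- The operator `∂ₓₓ⁻¹` on continuous functions. -/
def invDxxC : CT →L[ℂ] CT :=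
  ∑' l : ℤ, invSymbol l • (coeff l).smulRight (fourier l : CT)

lemma norm_coeff_le (l : ℤ) (f : CT) : ‖coeff l f‖ ≤ ‖f‖ := by
  have := (coeff l).le_of_opNorm_le (LinearMap.mkContinuous_norm_le _ zero_le_one _) f
  rwa [one_mul] at this

lemma summable_invDxxC :
    Summable fun l : ℤ => invSymbol l • (coeff l).smulRight (fourier l : CT) := by
  refine Summable.of_norm_bounded summable_invSymbol fun l => ?_
  rw [norm_smul]
  refine mul_le_of_le_one_right (norm_nonneg _) ?_
  refine ContinuousLinearMap.opNorm_le_bound _ zero_le_one fun f => ?_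
  rw [ContinuousLinearMap.smulRight_apply, norm_smul, fourier_norm, mul_one, one_mul]
  exact norm_coeff_le l f

lemma coeff_invDxxC (n : ℤ) (f : CT) : coeff n (invDxxC f) = invSymbol n * coeff n f := by
  have h1 := (ContinuousLinearMap.apply ℂ CT f).hasSum summable_invDxxC.hasSum
  rw [← invDxxC] at h1
  simp only [ContinuousLinearMap.apply_apply, smul_apply,
    ContinuousLinearMap.smulRight_apply] at h1
  have h2 := (coeff n).hasSum h1
  simp only [map_smul, coeff_fourier, smul_eq_mul] at h2
  refine h2.unique ?_
  have h3 := hasSum_ite_eq n (invSymbol n * coeff n f)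
  convert h3 using 2 with l
  by_cases h : n = l
  · subst h; simp
  · simp [h, Ne.symm h]

lemma invDxxC_shift (s : ℝ) (f : CT) : shift s (invDxxC f) = invDxxC (shift s f) :=
  ext_coeff fun n => by simp only [coeff_shift, coeff_invDxxC]; ring

lemma Wiener.invDxxC {f : CT} (hf : Wiener f) : Wiener (invDxxC f) :=
  wiener_of_le 1 hf fun n => by
    rw [coeff_invDxxC, norm_mul]
    gcongr
    exact norm_invSymbol_le n

/-- The embedding into `L²`. -/
def toL2 : CT →L[ℂ] Lp ℂ 2 haar := ContinuousMap.toLp 2 haar ℂ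

lemma hasSum_norm_toL2 (f : CT) : HasSum (fun n => ‖coeff n f‖ ^ 2) (‖toL2 f‖ ^ 2) := by
  have h := hasSum_sq_fourierCoeff (toL2 f)
  have e : ∫ t, ‖toL2 f t‖ ^ 2 ∂haar = ‖toL2 f‖ ^ 2 := by
    have h1 := congrArg RCLike.re (L2.inner_def (𝕜 := ℂ) (toL2 f) (toL2 f))
    rw [← integral_re (L2.integrable_inner _ _)] at h1
    simp only [← norm_sq_eq_re_inner] at h1
    exact h1.symm
  rw [e] at h
  simpa only [toL2, fourierCoeff_toLp, ← coeff_apply] using h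

/-- By Parseval, multipliers of modulus at most one contract `L²`; this covers both translations and
`∂ₓₓ⁻¹`. -/
lemma norm_toL2_le_of_coeff {f g : CT} (h : ∀ n, ‖coeff n f‖ ≤ ‖coeff n g‖) :
    ‖toL2 f‖ ≤ ‖toL2 g‖ := by
  refine (sq_le_sq₀ (norm_nonneg _) (norm_nonneg _)).1 ?_
  refine hasSum_le (fun n => ?_) (hasSum_norm_toL2 f) (hasSum_norm_toL2 g)
  have := h n
  gcongr

lemma norm_toL2_shift (s : ℝ) (f : CT) : ‖toL2 (shift s f)‖ = ‖toL2 f‖ :=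
  le_antisymm (norm_toL2_le_of_coeff fun n => (norm_coeff_shift n s f).le)
    (norm_toL2_le_of_coeff fun n => (norm_coeff_shift n s f).ge)

lemma norm_toL2_invDxxC (f : CT) : ‖toL2 (invDxxC f)‖ ≤ ‖toL2 f‖ :=
  norm_toL2_le_of_coeff fun n => by
    rw [coeff_invDxxC, norm_mul]
    exact mul_le_of_le_one_left (norm_nonneg _) (norm_invSymbol_le n)

lemma norm_toL2_le_of_ae {f g : CT} {c : ℝ} (h : ∀ x, ‖f x‖ ≤ c * ‖g x‖) :
    ‖toL2 f‖ ≤ c * ‖toL2 g‖ := by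
  refine Lp.norm_le_mul_norm_of_ae_le_mul ?_
  filter_upwards [ContinuousMap.coeFn_toLp (p := 2) (𝕜 := ℂ) haar f,
    ContinuousMap.coeFn_toLp (p := 2) (𝕜 := ℂ) haar g] with x hf hg
  rw [toL2, hf, hg]; exact h x

lemma norm_toL2_mul_le (f g : CT) : ‖toL2 (f * g)‖ ≤ ‖f‖ * ‖toL2 g‖ :=
  norm_toL2_le_of_ae fun x => by
    rw [ContinuousMap.mul_apply, norm_mul]
    gcongr
    exact f.norm_coe_le_norm x

lemma norm_toL2_mul_le' (f g : CT) : ‖toL2 (f * g)‖ ≤ ‖toL2 f‖ * ‖g‖ := by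
  rw [mul_comm f g, mul_comm _ ‖g‖]; exact norm_toL2_mul_le g f

lemma norm_toL2_star (f : CT) : ‖toL2 (star f)‖ = ‖toL2 f‖ := by
  refine le_antisymm ?_ ?_
  · refine (norm_toL2_le_of_ae (c := 1) (g := f) fun x => ?_).trans_eq (one_mul _)
    simp
  · refine (norm_toL2_le_of_ae (c := 1) (g := star f) fun x => ?_).trans_eq (one_mul _)
    simp

/-- A Fourier multiplier applied to a function with the symbol known on the level of continuous
functions. -/
lemma fourierMul_eq {m : ℤ → ℂ} {f : Torus → ℂ} {g h : CT} (hfg : f =ᵐ[volume] g)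
    (hh : Wiener h) (hm : ∀ n, coeff n h = m n * coeff n g) : fourierMul m f = h := by
  have hfg' : f =ᵐ[haar] g := by
    rw [AddCircle.volume_eq_smul_haarAddCircle] at hfg
    exact (Measure.absolutelyContinuous_smul
      (by simpa using Real.pi_pos)).ae_le hfg
  funext x
  rw [fourierMul, fourierCoeff_congr_ae hfg', ← (hh.hasSum x).tsum_eq]
  refine tsum_congr fun n => ?_
  rw [hm, coeff_apply, smul_eq_mul]; ring

lemma fourierMul_smul_const {m : ℤ → ℂ} (f : Torus → ℂ) (e : Spinor) :
    fourierMul m (fun y => f y • e) = fun x => fourierMul m f x • e := by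
  funext x
  have h : ∀ n, fourierCoeff (fun y => f y • e) n = fourierCoeff f n • e := by
    intro n
    simp only [fourierCoeff, smul_eq_mul, ← smul_assoc]
    exact integral_smul_const _ _
  simp only [fourierMul, h, ← smul_assoc]
  by_cases he : e = 0
  · simp [he]
  · by_cases hs : Summable fun l : ℤ => (m l * fourier l x) • fourierCoeff f l
    · exact hs.tsum_smul_const e
    -- Without summability both sums take the default value zero. Pairing with the nonzero vector
    -- `e` shows that the vector series cannot converge when the scalar one does not.
    · rw [tsum_eq_zero_of_not_summable hs, tsum_eq_zero_of_not_summable, zero_smul]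
      intro h'
      apply hs
      have h2 := (innerSL ℂ e).summable h'
      simp only [map_smul, innerSL_apply_apply, smul_eq_mul] at h2
      have h3 : inner ℂ e e ≠ 0 := by simpa using he
      exact (summable_mul_right_iff h3).1 h2

lemma expDx_eq {f : Torus → ℂ} {g : CT} (hfg : f =ᵐ[volume] g) (hg : Wiener g) (s : ℝ) :
    expDx s f = shift s g :=
  fourierMul_eq hfg (hg.shift s) fun n => coeff_shift n s g

lemma phi1Dx_eq {f : Torus → ℂ} {g : CT} (hfg : f =ᵐ[volume] g) (hg : Wiener g) (c τ : ℝ)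
    (x : Torus) : (τ : ℂ) * phi1Dx (c * τ) f x = (∫ r in (0 : ℝ)..τ, shift (c * r) g) x := by
  by_cases hτ : τ = 0
  · simp [hτ]
  · have hτ' : (τ : ℂ) ≠ 0 := Complex.ofReal_ne_zero.2 hτ
    have := fourierMul_eq (h := (τ : ℂ)⁻¹ • ∫ r in (0 : ℝ)..τ, shift (c * r) g) hfg
      ((hg.integral_shift c τ).smul _)
      (m := fun l => phi1 (Complex.I * (((c * τ : ℝ) : ℂ) * (l : ℂ)))) fun n => by
        rw [map_smul, coeff_integral_shift, smul_eq_mul]; field_simp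
    rw [phi1Dx, this, ContinuousMap.smul_apply, smul_eq_mul]
    field_simp

lemma invDxx_eq {f : Torus → ℂ} {g : CT} (hfg : f =ᵐ[volume] g) (hg : Wiener g) :
    invDxx f = invDxxC g :=
  fourierMul_eq hfg hg.invDxxC fun n => coeff_invDxxC n g

end

end NonlinearDirac

/-! ### The Dirac nonlinearity in `(ψ₊, ψ₋)` as a cubic system. -/

namespace NonlinearDirac

noncomputable section

/-- The pairs `(ψ₊, ψ₋)` of continuous functions. -/
abbrev Pair : Type := CT × CT

/-- A norm `‖ι ·‖` on continuous functions that is invariant under the symmetries of `L²` and for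
which multiplication by bounded functions is bounded. -/
structure ModuleNorm {E : Type*} [NormedAddCommGroup E] [NormedSpace ℂ E] (ι : CT →L[ℂ] E) :
    Prop where
  shift : ∀ s f, ‖ι (shift s f)‖ = ‖ι f‖
  star : ∀ f, ‖ι (star f)‖ = ‖ι f‖
  mul : ∀ f g, ‖ι (f * g)‖ ≤ ‖f‖ * ‖ι g‖
  -- One constant serves both norms: `∂ₓₓ⁻¹` has bound `1` on `L²` and `‖invDxxC‖` in the supremum
  -- norm.
  invDxx : ∀ f, ‖ι (invDxxC f)‖ ≤ (‖invDxxC‖ + 1) * ‖ι f‖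

lemma moduleNorm_toL2 : ModuleNorm toL2 where
  shift := norm_toL2_shift
  star := norm_toL2_star
  mul := norm_toL2_mul_le
  invDxx f := (norm_toL2_invDxxC f).trans
    (le_mul_of_one_le_left (norm_nonneg _) (by linarith [norm_nonneg invDxxC]))

lemma moduleNorm_id : ModuleNorm (ContinuousLinearMap.id ℂ CT) where
  shift := norm_shift
  star f := norm_star f
  mul := norm_mul_le
  invDxx f := (invDxxC.le_opNorm f).trans (by
    rw [ContinuousLinearMap.id_apply]; gcongr; linarith)

/-- The first component of the cubic part of the nonlinearity; the coefficient `κ` of the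
self-consistent potential is `0` or `1`. -/
def tri (lam κ : ℝ) (x₁ x₂ y₁ y₂ z₁ z₂ : CT) : CT :=
  -- Here `|ψ₁|² - |ψ₂|² = ½(ψ₊ψ̄₋ + ψ̄₊ψ₋)`, `|Ψ|² = ½(|ψ₊|² + |ψ₋|²)`, and `β` exchanges `ψ₊` and
  -- `ψ₋`. The second component arises by exchanging the indices.
  ((lam / 2 : ℝ) : ℂ) • (x₁ * star y₂ * z₂ + star x₁ * y₂ * z₂)
    - ((κ / 2 : ℝ) : ℂ) • (invDxxC (x₁ * star y₁ + x₂ * star y₂) * z₁)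

/-- The cubic part of the nonlinearity. -/
def diracCub (lam κ : ℝ) (x y z : Pair) : Pair :=
  (tri lam κ x.1 x.2 y.1 y.2 z.1 z.2, tri lam κ x.2 x.1 y.2 y.1 z.2 z.1)

/-- Multiplication by a continuous function. -/
def mulC (f : CT) : CT →L[ℂ] CT := ContinuousLinearMap.mul ℂ CT f

@[simp] lemma mulC_apply (f g : CT) : mulC f g = f * g := rfl

/-- The linear part `β + V` of the nonlinearity. -/
def diracLin (V : CT) : Pair →L[ℂ] Pair :=
  (ContinuousLinearMap.snd ℂ CT CT + (mulC V).comp (ContinuousLinearMap.fst ℂ CT CT)).prod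
    (ContinuousLinearMap.fst ℂ CT CT + (mulC V).comp (ContinuousLinearMap.snd ℂ CT CT))

/-- The group `e^{sα∂ₓ}`. -/
def diracFlow (s : ℝ) : Pair →L[ℂ] Pair := (shift s).prodMap (shift (-s))

lemma diracFlow_apply (s : ℝ) (x : Pair) : diracFlow s x = (shift s x.1, shift (-s) x.2) := rfl

/-- The bound for the nonlinearity. -/
def diracBound (lam κ : ℝ) (V : CT) : ℝ := 1 + ‖V‖ + |lam| + |κ| * (‖invDxxC‖ + 1)

section tri

variable {lam κ : ℝ} {x₁ x₂ x₁' x₂' y₁ y₂ y₁' y₂' z₁ z₂ z₁' z₂' : CT}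

lemma tri_add₁ : tri lam κ (x₁ + x₁') (x₂ + x₂') y₁ y₂ z₁ z₂
    = tri lam κ x₁ x₂ y₁ y₂ z₁ z₂ + tri lam κ x₁' x₂' y₁ y₂ z₁ z₂ := by
  simp only [tri, add_mul, star_add, map_add, smul_add]; abel

lemma tri_add₂ : tri lam κ x₁ x₂ (y₁ + y₁') (y₂ + y₂') z₁ z₂
    = tri lam κ x₁ x₂ y₁ y₂ z₁ z₂ + tri lam κ x₁ x₂ y₁' y₂' z₁ z₂ := by
  simp only [tri, add_mul, mul_add, star_add, map_add, smul_add]; abel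

lemma tri_add₃ : tri lam κ x₁ x₂ y₁ y₂ (z₁ + z₁') (z₂ + z₂')
    = tri lam κ x₁ x₂ y₁ y₂ z₁ z₂ + tri lam κ x₁ x₂ y₁ y₂ z₁' z₂' := by
  simp only [tri, mul_add, smul_add]; abel

lemma star_ofReal_smul (r : ℝ) (f : CT) : star ((r : ℂ) • f) = (r : ℂ) • star f := by
  rw [star_smul]; simp

lemma tri_smul₁ (r : ℝ) : tri lam κ ((r : ℂ) • x₁) ((r : ℂ) • x₂) y₁ y₂ z₁ z₂
    = (r : ℂ) • tri lam κ x₁ x₂ y₁ y₂ z₁ z₂ := by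
  simp only [tri, star_ofReal_smul, smul_mul_assoc, ← smul_add, map_smul, smul_sub,
    smul_comm (r : ℂ)]

lemma tri_smul₂ (r : ℝ) : tri lam κ x₁ x₂ ((r : ℂ) • y₁) ((r : ℂ) • y₂) z₁ z₂
    = (r : ℂ) • tri lam κ x₁ x₂ y₁ y₂ z₁ z₂ := by
  simp only [tri, star_ofReal_smul, smul_mul_assoc, mul_smul_comm, ← smul_add, map_smul, smul_sub,
    smul_comm (r : ℂ)]

lemma tri_smul₃ (r : ℝ) : tri lam κ x₁ x₂ y₁ y₂ ((r : ℂ) • z₁) ((r : ℂ) • z₂)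
    = (r : ℂ) • tri lam κ x₁ x₂ y₁ y₂ z₁ z₂ := by
  simp only [tri, mul_smul_comm, ← smul_add, smul_sub, smul_comm (r : ℂ)]

lemma shift_tri (s : ℝ) : shift s (tri lam κ x₁ x₂ y₁ y₂ z₁ z₂)
    = tri lam κ (shift s x₁) (shift s x₂) (shift s y₁) (shift s y₂) (shift s z₁) (shift s z₂) := by
  simp only [tri, map_sub, map_smul, map_add, shift_mul, shift_star, invDxxC_shift]

variable {E : Type*} [NormedAddCommGroup E] [NormedSpace ℂ E] {ι : CT →L[ℂ] E}

lemma norm_tri_le (V : CT) {m : ℝ}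
    (h1 : ‖ι (x₁ * star y₂ * z₂)‖ ≤ m) (h2 : ‖ι (star x₁ * y₂ * z₂)‖ ≤ m)
    (h3 : ‖ι (invDxxC (x₁ * star y₁) * z₁)‖ ≤ (‖invDxxC‖ + 1) * m)
    (h4 : ‖ι (invDxxC (x₂ * star y₂) * z₁)‖ ≤ (‖invDxxC‖ + 1) * m) :
    ‖ι (tri lam κ x₁ x₂ y₁ y₂ z₁ z₂)‖ ≤ diracBound lam κ V * m := by
  have hm : 0 ≤ m := (norm_nonneg _).trans h1
  have hV : 0 ≤ (1 + ‖V‖) * m := by positivity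
  have e1 : ‖((lam / 2 : ℝ) : ℂ)‖ = |lam| / 2 := by
    rw [Complex.norm_real, Real.norm_eq_abs, abs_div, abs_two]
  have e2 : ‖((κ / 2 : ℝ) : ℂ)‖ = |κ| / 2 := by
    rw [Complex.norm_real, Real.norm_eq_abs, abs_div, abs_two]
  rw [tri, map_sub, map_smul, map_smul, map_add, map_add invDxxC, add_mul, map_add]
  refine (norm_sub_le _ _).trans ?_
  rw [norm_smul, norm_smul, e1, e2]
  have h5 := (norm_add_le (ι (x₁ * star y₂ * z₂)) (ι (star x₁ * y₂ * z₂))).trans (add_le_add h1 h2)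
  have h6 := (norm_add_le (ι (invDxxC (x₁ * star y₁) * z₁)) (ι (invDxxC (x₂ * star y₂) * z₁))).trans
    (add_le_add h3 h4)
  have h7 := mul_le_mul_of_nonneg_left h5 (by positivity : 0 ≤ |lam| / 2)
  have h8 := mul_le_mul_of_nonneg_left h6 (by positivity : 0 ≤ |κ| / 2)
  unfold diracBound
  linarith

end tri

namespace ModuleNorm

variable {E : Type*} [NormedAddCommGroup E] [NormedSpace ℂ E] {ι : CT →L[ℂ] E} (h : ModuleNorm ι)
include h

lemma mul' (f g : CT) : ‖ι (f * g)‖ ≤ ‖ι f‖ * ‖g‖ := by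
  rw [mul_comm f g, mul_comm _ ‖g‖]; exact h.mul g f

lemma mul₁ {f g k : CT} {a b c : ℝ} (ha : ‖ι f‖ ≤ a) (hb : ‖g‖ ≤ b) (hc : ‖k‖ ≤ c) :
    ‖ι (f * g * k)‖ ≤ a * b * c := by
  have := (norm_nonneg _).trans ha
  have := (norm_nonneg _).trans hb
  have h1 : ‖ι (f * g)‖ ≤ a * b := (h.mul' f g).trans (by gcongr)
  exact (h.mul' _ _).trans (by gcongr)

lemma mul₂ {f g k : CT} {a b c : ℝ} (ha : ‖f‖ ≤ a) (hb : ‖ι g‖ ≤ b) (hc : ‖k‖ ≤ c) :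
    ‖ι (f * g * k)‖ ≤ a * b * c := by
  rw [mul_comm f g, mul_comm a b]; exact h.mul₁ hb ha hc

lemma mul₃ {f g k : CT} {a b c : ℝ} (ha : ‖f‖ ≤ a) (hb : ‖g‖ ≤ b) (hc : ‖ι k‖ ≤ c) :
    ‖ι (f * g * k)‖ ≤ a * b * c := by
  have := (norm_nonneg _).trans ha
  have := (norm_nonneg _).trans hb
  have h1 : ‖f * g‖ ≤ a * b := (norm_mul_le f g).trans (by gcongr)
  exact (h.mul _ _).trans (by gcongr)

lemma invDxx_mul₁ {f g k : CT} {a b c : ℝ} (ha : ‖ι f‖ ≤ a) (hb : ‖g‖ ≤ b) (hc : ‖k‖ ≤ c) :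
    ‖ι (invDxxC (f * g) * k)‖ ≤ (‖invDxxC‖ + 1) * (a * b * c) := by
  have := (norm_nonneg _).trans ha
  have := (norm_nonneg _).trans hb
  have h1 : ‖ι (f * g)‖ ≤ a * b := (h.mul' f g).trans (by gcongr)
  have h2 : ‖ι (invDxxC (f * g))‖ ≤ (‖invDxxC‖ + 1) * (a * b) := (h.invDxx _).trans (by gcongr)
  calc _ ≤ ‖ι (invDxxC (f * g))‖ * ‖k‖ := h.mul' _ _
    _ ≤ (‖invDxxC‖ + 1) * (a * b) * c := by gcongr
    _ = _ := by ring

lemma invDxx_mul₂ {f g k : CT} {a b c : ℝ} (ha : ‖f‖ ≤ a) (hb : ‖ι g‖ ≤ b) (hc : ‖k‖ ≤ c) :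
    ‖ι (invDxxC (f * g) * k)‖ ≤ (‖invDxxC‖ + 1) * (a * b * c) := by
  rw [mul_comm f g, mul_comm a b]; exact h.invDxx_mul₁ hb ha hc

lemma invDxx_mul₃ {f g k : CT} {a b c : ℝ} (ha : ‖f‖ ≤ a) (hb : ‖g‖ ≤ b) (hc : ‖ι k‖ ≤ c) :
    ‖ι (invDxxC (f * g) * k)‖ ≤ (‖invDxxC‖ + 1) * (a * b * c) := by
  have := (norm_nonneg _).trans ha
  have := (norm_nonneg _).trans hb
  have h1 : ‖f * g‖ ≤ a * b := (norm_mul_le f g).trans (by gcongr)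
  have h2 : ‖invDxxC (f * g)‖ ≤ (‖invDxxC‖ + 1) * (a * b) :=
    (invDxxC.le_opNorm _).trans (by gcongr; linarith)
  calc _ ≤ ‖invDxxC (f * g)‖ * ‖ι k‖ := h.mul _ _
    _ ≤ (‖invDxxC‖ + 1) * (a * b) * c := by gcongr
    _ = _ := by ring

end ModuleNorm

/-- The system for `(ψ₊, ψ₋)`: the coefficient `κ` of the self-consistent potential and the
external potential `V`. -/
def diracSystem (lam κ : ℝ) (V : CT) : CubicSystem Pair where
  flow := diracFlow
  lin := diracLin V
  cub := diracCub lam κ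
  bound := diracBound lam κ V
  bound_nonneg := by unfold diracBound; positivity
  flow_zero x := by simp [diracFlow_apply, shift_zero]
  flow_add s t x := by
    rw [diracFlow_apply, diracFlow_apply, diracFlow_apply, neg_add, shift_add, shift_add]
  continuous_flow := by
    refine Continuous.prodMk ?_ ?_
    · exact continuous_shift.comp (continuous_fst.prodMk (continuous_fst.comp continuous_snd))
    · exact continuous_shift.comp (continuous_fst.neg.prodMk (continuous_snd.comp continuous_snd))
  continuous_cub := by unfold diracCub tri; fun_prop
  cub_add₁ _ _ _ _ := Prod.ext tri_add₁ tri_add₁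
  cub_add₂ _ _ _ _ := Prod.ext tri_add₂ tri_add₂
  cub_add₃ _ _ _ _ := Prod.ext tri_add₃ tri_add₃
  cub_smul₁ r _ _ _ := Prod.ext (tri_smul₁ r) (tri_smul₁ r)
  cub_smul₂ r _ _ _ := Prod.ext (tri_smul₂ r) (tri_smul₂ r)
  cub_smul₃ r _ _ _ := Prod.ext (tri_smul₃ r) (tri_smul₃ r)

section compatible

variable {lam κ : ℝ} {V : CT} {E : Type*} [NormedAddCommGroup E] [NormedSpace ℂ E]
  {ι : CT →L[ℂ] E}

lemma norm_prodMap_fst_le (ι : CT →L[ℂ] E) (x : Pair) : ‖ι x.1‖ ≤ ‖(ι.prodMap ι) x‖ :=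
  norm_fst_le ((ι.prodMap ι) x)

lemma norm_prodMap_snd_le (ι : CT →L[ℂ] E) (x : Pair) : ‖ι x.2‖ ≤ ‖(ι.prodMap ι) x‖ :=
  norm_snd_le ((ι.prodMap ι) x)

/-- Stating this for a general `ModuleNorm` yields weak compatibility from `moduleNorm_toL2` and
strong compatibility from `moduleNorm_id`. -/
lemma ModuleNorm.compatible (h : ModuleNorm ι) :
    (diracSystem lam κ V).Compatible (ι.prodMap ι) where
  norm_flow s x := by
    change max ‖ι (NonlinearDirac.shift s x.1)‖ ‖ι (NonlinearDirac.shift (-s) x.2)‖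
      = max ‖ι x.1‖ ‖ι x.2‖
    rw [h.shift, h.shift]
  norm_lin x := by
    have h1 := norm_prodMap_fst_le ι x
    have h2 := norm_prodMap_snd_le ι x
    set m := ‖(ι.prodMap ι) x‖ with hm
    have hm0 : 0 ≤ m := norm_nonneg _
    have h3 : (1 + ‖V‖) * m ≤ diracBound lam κ V * m := by
      unfold diracBound
      have : 0 ≤ |lam| + |κ| * (‖invDxxC‖ + 1) := by positivity
      exact mul_le_mul_of_nonneg_right (by linarith) hm0
    refine max_le ?_ ?_
    · change ‖ι (x.2 + V * x.1)‖ ≤ _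
      rw [map_add]
      refine (norm_add_le _ _).trans ?_
      have : ‖ι (V * x.1)‖ ≤ ‖V‖ * m := (h.mul _ _).trans (by gcongr)
      change _ ≤ diracBound lam κ V * m
      linarith
    · change ‖ι (x.1 + V * x.2)‖ ≤ _
      rw [map_add]
      refine (norm_add_le _ _).trans ?_
      have : ‖ι (V * x.2)‖ ≤ ‖V‖ * m := (h.mul _ _).trans (by gcongr)
      change _ ≤ diracBound lam κ V * m
      linarith
  norm_cub₁ x y z := by
    have hx1 := norm_prodMap_fst_le ι x
    have hx2 := norm_prodMap_snd_le ι x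
    have sx1 := (h.star x.1).trans_le hx1
    have sx2 := (h.star x.2).trans_le hx2
    have sy1 := (norm_star y.1).trans_le (norm_fst_le y)
    have sy2 := (norm_star y.2).trans_le (norm_snd_le y)
    exact max_le
      (norm_tri_le V (h.mul₁ hx1 sy2 (norm_snd_le z)) (h.mul₁ sx1 (norm_snd_le y) (norm_snd_le z))
        (h.invDxx_mul₁ hx1 sy1 (norm_fst_le z)) (h.invDxx_mul₁ hx2 sy2 (norm_fst_le z)))
      (norm_tri_le V (h.mul₁ hx2 sy1 (norm_fst_le z)) (h.mul₁ sx2 (norm_fst_le y) (norm_fst_le z))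
        (h.invDxx_mul₁ hx2 sy2 (norm_snd_le z)) (h.invDxx_mul₁ hx1 sy1 (norm_snd_le z)))
  norm_cub₂ x y z := by
    have hy1 := norm_prodMap_fst_le ι y
    have hy2 := norm_prodMap_snd_le ι y
    have sy1 := (h.star y.1).trans_le hy1
    have sy2 := (h.star y.2).trans_le hy2
    have sx1 := (norm_star x.1).trans_le (norm_fst_le x)
    have sx2 := (norm_star x.2).trans_le (norm_snd_le x)
    exact max_le
      (norm_tri_le V (h.mul₂ (norm_fst_le x) sy2 (norm_snd_le z)) (h.mul₂ sx1 hy2 (norm_snd_le z))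
        (h.invDxx_mul₂ (norm_fst_le x) sy1 (norm_fst_le z))
        (h.invDxx_mul₂ (norm_snd_le x) sy2 (norm_fst_le z)))
      (norm_tri_le V (h.mul₂ (norm_snd_le x) sy1 (norm_fst_le z)) (h.mul₂ sx2 hy1 (norm_fst_le z))
        (h.invDxx_mul₂ (norm_snd_le x) sy2 (norm_snd_le z))
        (h.invDxx_mul₂ (norm_fst_le x) sy1 (norm_snd_le z)))
  norm_cub₃ x y z := by
    have hz1 := norm_prodMap_fst_le ι z
    have hz2 := norm_prodMap_snd_le ι z
    have sx1 := (norm_star x.1).trans_le (norm_fst_le x)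
    have sx2 := (norm_star x.2).trans_le (norm_snd_le x)
    have sy1 := (norm_star y.1).trans_le (norm_fst_le y)
    have sy2 := (norm_star y.2).trans_le (norm_snd_le y)
    exact max_le
      (norm_tri_le V (h.mul₃ (norm_fst_le x) sy2 hz2) (h.mul₃ sx1 (norm_snd_le y) hz2)
        (h.invDxx_mul₃ (norm_fst_le x) sy1 hz1) (h.invDxx_mul₃ (norm_snd_le x) sy2 hz1))
      (norm_tri_le V (h.mul₃ (norm_snd_le x) sy1 hz1) (h.mul₃ sx2 (norm_fst_le y) hz1)
        (h.invDxx_mul₃ (norm_snd_le x) sy2 hz2) (h.invDxx_mul₃ (norm_fst_le x) sy1 hz2))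

/-- The embedding of pairs into `L² × L²`. -/
def pairL2 : Pair →L[ℂ] Lp ℂ 2 haar × Lp ℂ 2 haar := toL2.prodMap toL2

lemma diracSystem_compatible : (diracSystem lam κ V).Compatible pairL2 :=
  moduleNorm_toL2.compatible

lemma diracSystem_strongCompatible : (diracSystem lam κ V).StrongCompatible :=
  moduleNorm_id.compatible

/-- The increments of translations in the two directions have the same size. -/
lemma norm_toL2_shift_neg_sub (s : ℝ) (f : CT) :
    ‖toL2 (shift (-s) f - f)‖ = ‖toL2 (shift s f - f)‖ := by
  rw [← norm_toL2_shift s, map_sub, ← shift_add, add_neg_cancel, shift_zero, ← neg_sub, map_neg,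
    norm_neg]

/-- The translations of a system whose external potential is Lipschitz along translations. -/
def diracTranslations {κV : ℝ} (hκ : 0 ≤ κV)
    (hV : ∀ s, ‖toL2 (shift s V - V)‖ ≤ κV * |s|) :
    (diracSystem lam κ V).Translations pairL2 where
  shift s := (shift s).prodMap (shift s)
  norm_shift s x := by
    change max ‖shift s x.1‖ ‖shift s x.2‖ = max ‖x.1‖ ‖x.2‖
    rw [norm_shift, norm_shift]
  shift_cub s x y z := Prod.ext (shift_tri s) (shift_tri s)
  const := κV
  const_nonneg := hκ
  shift_lin s x := by
    have key : ∀ f g : CT, ‖g‖ ≤ ‖x‖ →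
        ‖toL2 (shift s (f + V * g) - (shift s f + V * shift s g))‖ ≤ κV * |s| * ‖x‖ := by
      intro f g hg
      -- The commutator with multiplication by `V` only sees the increment of `V`, which may be
      -- taken in `L²` while the other factor is taken in the supremum norm. This is why `V ∈ H¹`
      -- suffices.
      have e : shift s (f + V * g) - (shift s f + V * shift s g)
          = (shift s V - V) * shift s g := by
        rw [map_add, shift_mul]; ring
      rw [e]
      refine (norm_toL2_mul_le' _ _).trans ?_
      rw [norm_shift]
      have := hV s
      gcongr
    exact max_le (key _ _ (norm_fst_le x)) (key _ _ (norm_snd_le x))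
  norm_shift_sub s x := by
    change max ‖toL2 (shift s x.1 - x.1)‖ ‖toL2 (shift s x.2 - x.2)‖
      = max ‖toL2 (shift s x.1 - x.1)‖ ‖toL2 (shift (-s) x.2 - x.2)‖
    rw [norm_toL2_shift_neg_sub]

end compatible

end

end NonlinearDirac

/-! ### Closed form of the Duhamel integral, and the terms of `Θ` for spinor fields. -/

namespace NonlinearDirac

noncomputable section

/-- The integral of a continuous curve on `[0, τ]`. -/
def HasPrimitive (τ : ℝ) (F : ℝ → CT) (J : CT) : Prop :=
  Continuous F ∧ ∫ r in (0 : ℝ)..τ, F r = J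

namespace HasPrimitive

variable {τ : ℝ} {F G : ℝ → CT} {J K : CT}

lemma add (hF : HasPrimitive τ F J) (hG : HasPrimitive τ G K) :
    HasPrimitive τ (fun r => F r + G r) (J + K) :=
  ⟨hF.1.add hG.1, by
    rw [intervalIntegral.integral_add (hF.1.intervalIntegrable _ _)
      (hG.1.intervalIntegrable _ _), hF.2, hG.2]⟩

lemma sub (hF : HasPrimitive τ F J) (hG : HasPrimitive τ G K) :
    HasPrimitive τ (fun r => F r - G r) (J - K) :=
  ⟨hF.1.sub hG.1, by
    rw [intervalIntegral.integral_sub (hF.1.intervalIntegrable _ _)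
      (hG.1.intervalIntegrable _ _), hF.2, hG.2]⟩

lemma map (hF : HasPrimitive τ F J) (L : CT →L[ℂ] CT) :
    HasPrimitive τ (fun r => L (F r)) (L J) :=
  ⟨L.continuous.comp hF.1, by
    rw [ContinuousLinearMap.intervalIntegral_comp_comm L (hF.1.intervalIntegrable _ _), hF.2]⟩

lemma smul (hF : HasPrimitive τ F J) (c : ℂ) : HasPrimitive τ (fun r => c • F r) (c • J) :=
  hF.map (c • ContinuousLinearMap.id ℂ CT)

lemma const (f : CT) : HasPrimitive τ (fun _ => f) ((τ : ℂ) • f) :=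
  ⟨continuous_const, by rw [intervalIntegral.integral_const, sub_zero, Complex.coe_smul]⟩

end HasPrimitive

/-- `∫₀^τ f(· + c r) dr = τ φ₁(cτ∂ₓ) f`. -/
def avg (τ c : ℝ) (f : CT) : CT := ∫ r in (0 : ℝ)..τ, shift (c * r) f

lemma hasPrimitive_shift (τ c : ℝ) (f : CT) :
    HasPrimitive τ (fun r => shift (c * r) f) (avg τ c f) := ⟨continuous_shift_mul c f, rfl⟩

lemma Wiener.avg {f : CT} (hf : Wiener f) (τ c : ℝ) : Wiener (avg τ c f) := hf.integral_shift c τ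

/-- A component of the integral in the integrator, in closed form. -/
def pullIntegral (lam κ : ℝ) (V : CT) (τ σ : ℝ) (u v : CT) : CT :=
  avg τ (2 * σ) v + u * avg τ σ V
    + (((lam / 2 : ℝ) : ℂ) • (u * avg τ (2 * σ) (star v * v) + star u * avg τ (2 * σ) (v * v))
      - ((κ / 2 : ℝ) : ℂ) • (u * invDxxC ((τ : ℂ) • (u * star u) + avg τ (2 * σ) (v * star v))))

/-- Translating by `σ r` undoes the free motion of `u` and doubles that of `v`. Factors of `u`
become constant in `r` and leave the integral, while every group in `v` is integrated exactly by an
average with speed `2σ`. The values `σ = 1` and `σ = -1`, with `u` and `v` exchanged, give the two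
components. -/
lemma hasPrimitive_pullIntegral (lam κ : ℝ) (V : CT) (τ σ : ℝ) (u v : CT) :
    HasPrimitive τ (fun r => shift (σ * r) ((shift (σ * r) v + V * shift (-(σ * r)) u)
      + tri lam κ (shift (-(σ * r)) u) (shift (σ * r) v) (shift (-(σ * r)) u) (shift (σ * r) v)
        (shift (-(σ * r)) u) (shift (σ * r) v))) (pullIntegral lam κ V τ σ u v) := by
  have h := ((hasPrimitive_shift τ (2 * σ) v).add ((hasPrimitive_shift τ σ V).map (mulC u))).add
    (((((hasPrimitive_shift τ (2 * σ) (star v * v)).map (mulC u)).add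
      ((hasPrimitive_shift τ (2 * σ) (v * v)).map (mulC (star u)))).smul ((lam / 2 : ℝ) : ℂ)).sub
      (((((HasPrimitive.const (u * star u)).add
        (hasPrimitive_shift τ (2 * σ) (v * star v))).map invDxxC).map (mulC u)).smul
          ((κ / 2 : ℝ) : ℂ)))
  simp only [mulC_apply] at h
  have e : ∀ r : ℝ, shift (σ * r) ((shift (σ * r) v + V * shift (-(σ * r)) u)
      + tri lam κ (shift (-(σ * r)) u) (shift (σ * r) v) (shift (-(σ * r)) u) (shift (σ * r) v)
        (shift (-(σ * r)) u) (shift (σ * r) v))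
      = shift (2 * σ * r) v + u * shift (σ * r) V
        + (((lam / 2 : ℝ) : ℂ) • (u * shift (2 * σ * r) (star v * v)
            + star u * shift (2 * σ * r) (v * v))
          - ((κ / 2 : ℝ) : ℂ) • (u * invDxxC (u * star u + shift (2 * σ * r) (v * star v)))) := by
    intro r
    have e1 : ∀ f, shift (σ * r) (shift (σ * r) f) = shift (2 * σ * r) f := fun f => by
      rw [← shift_add]; ring_nf
    have e2 : ∀ f, shift (σ * r) (shift (-(σ * r)) f) = f := fun f => by
      rw [← shift_add, add_neg_cancel, shift_zero]
    rw [map_add, map_add, shift_mul, shift_tri, e1, e2]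
    simp only [tri, shift_mul, shift_star]
    congr 2
    · ring
    · congr 1; ring
    · rw [mul_comm u (invDxxC _)]
  simp only [e]
  exact h

lemma Wiener.pullIntegral {V u v : CT} (lam κ τ σ : ℝ) (hV : Wiener V) (hu : Wiener u)
    (hv : Wiener v) : Wiener (pullIntegral lam κ V τ σ u v) := by
  unfold NonlinearDirac.pullIntegral
  exact ((hv.avg _ _).add (hu.mul (hV.avg _ _))).add
    ((((hu.mul ((hv.star.mul hv).avg _ _)).add (hu.star.mul ((hv.mul hv).avg _ _))).smul _).sub
    ((hu.mul (((hu.mul hu.star).smul _).add ((hv.mul hv.star).avg _ _)).invDxxC).smul _))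

lemma integral_force (lam κ : ℝ) (V : CT) (τ : ℝ) (x : Pair) :
    ∫ r in (0 : ℝ)..τ, (diracSystem lam κ V).flow r
      ((diracSystem lam κ V).force ((diracSystem lam κ V).flow (-r) x))
      = (pullIntegral lam κ V τ 1 x.1 x.2, pullIntegral lam κ V τ (-1) x.2 x.1) := by
  have h1 := hasPrimitive_pullIntegral lam κ V τ 1 x.1 x.2
  have h2 := hasPrimitive_pullIntegral lam κ V τ (-1) x.2 x.1
  have c := (diracSystem lam κ V).continuous_pullback
    ((diracSystem lam κ V).continuous_flow_neg x)
  refine Prod.ext ?_ ?_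
  · rw [← h1.2]
    refine (ContinuousLinearMap.intervalIntegral_comp_comm (ContinuousLinearMap.fst ℂ CT CT)
      (c.intervalIntegrable 0 τ)).symm.trans ?_
    congr 1
    funext r
    simp only [one_mul]
    change shift r ((shift (- -r) x.2 + V * shift (-r) x.1)
      + tri lam κ (shift (-r) x.1) (shift (- -r) x.2) (shift (-r) x.1) (shift (- -r) x.2)
        (shift (-r) x.1) (shift (- -r) x.2)) = _
    rw [neg_neg]
  · rw [← h2.2]
    refine (ContinuousLinearMap.intervalIntegral_comp_comm (ContinuousLinearMap.snd ℂ CT CT)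
      (c.intervalIntegrable 0 τ)).symm.trans ?_
    congr 1
    funext r
    simp only [neg_one_mul]
    change shift (-r) ((shift (-r) x.1 + V * shift (- -r) x.2)
      + tri lam κ (shift (- -r) x.2) (shift (-r) x.1) (shift (- -r) x.2) (shift (-r) x.1)
        (shift (- -r) x.2) (shift (-r) x.1)) = _
    rfl

/-- Both components have absolutely convergent Fourier series. -/
def WienerPair (x : Pair) : Prop := Wiener x.1 ∧ Wiener x.2

lemma Wiener.tri {x₁ x₂ y₁ y₂ z₁ z₂ : CT} (lam κ : ℝ) (hx₁ : Wiener x₁) (hx₂ : Wiener x₂)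
    (hy₁ : Wiener y₁) (hy₂ : Wiener y₂) (hz₁ : Wiener z₁) (hz₂ : Wiener z₂) :
    Wiener (tri lam κ x₁ x₂ y₁ y₂ z₁ z₂) := by
  unfold NonlinearDirac.tri
  exact ((((hx₁.mul hy₂.star).mul hz₂).add ((hx₁.star.mul hy₂).mul hz₂)).smul _).sub
    (((((hx₁.mul hy₁.star).add (hx₂.mul hy₂.star)).invDxxC).mul hz₁).smul _)

namespace WienerPair

variable {x y z : Pair} {V : CT} {lam κ : ℝ}

lemma add (hx : WienerPair x) (hy : WienerPair y) : WienerPair (x + y) :=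
  ⟨hx.1.add hy.1, hx.2.add hy.2⟩

lemma sub (hx : WienerPair x) (hy : WienerPair y) : WienerPair (x - y) :=
  ⟨hx.1.sub hy.1, hx.2.sub hy.2⟩

lemma smul (hx : WienerPair x) (c : ℂ) : WienerPair (c • x) := ⟨hx.1.smul c, hx.2.smul c⟩

lemma flow (hx : WienerPair x) (s : ℝ) : WienerPair (diracFlow s x) :=
  ⟨hx.1.shift s, hx.2.shift (-s)⟩

lemma lin (hV : Wiener V) (hx : WienerPair x) : WienerPair (diracLin V x) :=
  ⟨hx.2.add (hV.mul hx.1), hx.1.add (hV.mul hx.2)⟩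

lemma cub (hx : WienerPair x) (hy : WienerPair y) (hz : WienerPair z) :
    WienerPair (diracCub lam κ x y z) :=
  ⟨Wiener.tri lam κ hx.1 hx.2 hy.1 hy.2 hz.1 hz.2, Wiener.tri lam κ hx.2 hx.1 hy.2 hy.1 hz.2 hz.1⟩

lemma force (hV : Wiener V) (hx : WienerPair x) : WienerPair ((diracSystem lam κ V).force x) :=
  (lin hV hx).add (cub hx hx hx)

lemma dforce (hV : Wiener V) (hx : WienerPair x) (hy : WienerPair y) :
    WienerPair ((diracSystem lam κ V).dforce x y) :=
  (((lin hV hy).add (cub hy hx hx)).add (cub hx hy hx)).add (cub hx hx hy)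

lemma corr (hV : Wiener V) (hx : WienerPair x) : WienerPair ((diracSystem lam κ V).corr x) :=
  (dforce hV hx ((force hV hx).smul _)).smul _

lemma integral_force (hV : Wiener V) (hx : WienerPair x) (τ : ℝ) :
    WienerPair (pullIntegral lam κ V τ 1 x.1 x.2, pullIntegral lam κ V τ (-1) x.2 x.1) :=
  ⟨Wiener.pullIntegral lam κ τ _ hV hx.1 hx.2, Wiener.pullIntegral lam κ τ _ hV hx.2 hx.1⟩

lemma step (hV : Wiener V) (hx : WienerPair x) (τ : ℝ) :
    WienerPair ((diracSystem lam κ V).step τ x) := by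
  rw [CubicSystem.step, NonlinearDirac.integral_force]
  exact ((hx.sub ((integral_force hV hx τ).smul _)).flow _).add ((corr hV hx).smul _)

end WienerPair

/-- The spinor with `ψ₊ = a`, `ψ₋ = b`. -/
def spin (a b : ℂ) : Spinor := !₂[(a + b) / 2, (a - b) / 2]

@[simp] lemma spin_zero (a b : ℂ) : spin a b 0 = (a + b) / 2 := rfl

@[simp] lemma spin_one (a b : ℂ) : spin a b 1 = (a - b) / 2 := rfl

lemma spinor_ext {v w : Spinor} (h0 : v 0 = w 0) (h1 : v 1 = w 1) : v = w := by
  ext i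
  fin_cases i
  · exact h0
  · exact h1

lemma act_beta_spin (a b : ℂ) : act beta (spin a b) = spin b a := by
  refine spinor_ext ?_ ?_ <;> simp [act, beta, spin] <;> ring

lemma act_projPlus (w : Spinor) : act projPlus w = (w 0 + w 1) • spin 1 0 := by
  refine spinor_ext ?_ ?_ <;> simp [act, projPlus, spin, dotProduct] <;> ring

lemma act_projMinus (w : Spinor) : act projMinus w = (w 0 - w 1) • spin 0 1 := by
  refine spinor_ext ?_ ?_ <;> simp [act, projMinus, spin, dotProduct] <;> ring

lemma act_beta_projPlus (w : Spinor) : act (beta * projPlus) w = (w 0 + w 1) • spin 0 1 := by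
  refine spinor_ext ?_ ?_ <;>
    simp [act, beta, projPlus, spin, dotProduct] <;> ring

lemma act_beta_projMinus (w : Spinor) : act (beta * projMinus) w = (w 0 - w 1) • spin 1 0 := by
  refine spinor_ext ?_ ?_ <;>
    simp [act, beta, projMinus, spin, dotProduct] <;> ring

/-- The spinor field with components `(ψ₊, ψ₋) = x`. -/
def toField (x : Pair) : Field := fun t => spin (x.1 t) (x.2 t)

lemma ofReal_norm_sq (z : ℂ) : (‖z‖ : ℂ) ^ 2 = z * (starRingEnd ℂ) z :=
  (Complex.mul_conj' z).symm

section representation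

variable {Ψ : Field} {x : Pair} (hΨ : Ψ =ᵐ[volume] toField x)
include hΨ

lemma compPlus_ae : compPlus Ψ =ᵐ[volume] x.1 := by
  filter_upwards [hΨ] with t ht
  simp only [compPlus, ht, toField, spin_zero, spin_one]; ring

lemma compMinus_ae : compMinus Ψ =ᵐ[volume] x.2 := by
  filter_upwards [hΨ] with t ht
  simp only [compMinus, ht, toField, spin_zero, spin_one]; ring

lemma density_ae : density Ψ
    =ᵐ[volume] ((1 / 2 : ℂ) • (x.1 * star x.1 + x.2 * star x.2) : CT) := by
  filter_upwards [hΨ] with t ht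
  simp only [density, ht, toField, spin_zero, spin_one, ofReal_norm_sq, ContinuousMap.smul_apply,
    ContinuousMap.add_apply, ContinuousMap.mul_apply, ContinuousMap.star_apply, smul_eq_mul,
    map_div₀, map_add, map_sub, Complex.conj_ofNat, RCLike.star_def]
  ring

lemma absSq_compPlus_ae : absSq (compPlus Ψ) =ᵐ[volume] (x.1 * star x.1 : CT) := by
  filter_upwards [compPlus_ae hΨ] with t ht
  simp only [absSq, ht, ofReal_norm_sq]; rfl

lemma absSq_compMinus_ae : absSq (compMinus Ψ) =ᵐ[volume] (x.2 * star x.2 : CT) := by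
  filter_upwards [compMinus_ae hΨ] with t ht
  simp only [absSq, ht, ofReal_norm_sq]; rfl

lemma expAlphaDx_eq (hx : WienerPair x) (s : ℝ) :
    expAlphaDx s Ψ = toField (diracFlow s x) := by
  funext t
  have h1 : (fun y => act projPlus (Ψ y)) = fun y => compPlus Ψ y • spin 1 0 :=
    funext fun y => act_projPlus _
  have h2 : (fun y => act projMinus (Ψ y)) = fun y => compMinus Ψ y • spin 0 1 :=
    funext fun y => act_projMinus _
  simp only [expAlphaDx, h1, h2]
  have h3 : expDx s (fun y => compPlus Ψ y • spin 1 0) t = expDx s (compPlus Ψ) t • spin 1 0 :=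
    congrFun (fourierMul_smul_const (compPlus Ψ) (spin 1 0)) t
  have h4 : expDx (-s) (fun y => compMinus Ψ y • spin 0 1) t
      = expDx (-s) (compMinus Ψ) t • spin 0 1 :=
    congrFun (fourierMul_smul_const (compMinus Ψ) (spin 0 1)) t
  rw [h3, h4, expDx_eq (compPlus_ae hΨ) hx.1, expDx_eq (compMinus_ae hΨ) hx.2]
  refine spinor_ext ?_ ?_ <;> simp [toField, diracFlow_apply] <;> ring

lemma termI1_eq (hx : WienerPair x) (τ : ℝ) (t : Torus) :
    termI1 τ Ψ t = spin (avg τ 2 x.2 t) (avg τ (-2) x.1 t) := by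
  have h1 : (fun y => act (beta * projPlus) (Ψ y)) = fun y => compPlus Ψ y • spin 0 1 :=
    funext fun y => act_beta_projPlus _
  have h2 : (fun y => act (beta * projMinus) (Ψ y)) = fun y => compMinus Ψ y • spin 1 0 :=
    funext fun y => act_beta_projMinus _
  have h3 : ∀ s, phi1Dx s (fun y => compPlus Ψ y • spin 0 1) t
      = phi1Dx s (compPlus Ψ) t • spin 0 1 := fun s =>
    congrFun (fourierMul_smul_const (compPlus Ψ) (spin 0 1)) t
  have h4 : ∀ s, phi1Dx s (fun y => compMinus Ψ y • spin 1 0) t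
      = phi1Dx s (compMinus Ψ) t • spin 1 0 := fun s =>
    congrFun (fourierMul_smul_const (compMinus Ψ) (spin 1 0)) t
  simp only [termI1, h1, h2, h3, h4, smul_add, ← smul_assoc, smul_eq_mul,
    phi1Dx_eq (compPlus_ae hΨ) hx.1, phi1Dx_eq (compMinus_ae hΨ) hx.2]
  refine spinor_ext ?_ ?_ <;> simp [avg] <;> ring

lemma termI3_ae (hx : WienerPair x) (lam τ : ℝ) : termI3 lam τ Ψ =ᵐ[volume] fun t =>
    spin ((lam / 2) * ((x.1 * avg τ 2 (star x.2 * x.2) + star x.1 * avg τ 2 (x.2 * x.2) : CT) t))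
      ((lam / 2) * ((x.2 * avg τ (-2) (star x.1 * x.1)
        + star x.2 * avg τ (-2) (x.1 * x.1) : CT) t)) := by
  have hp := compPlus_ae hΨ
  have hm := compMinus_ae hΨ
  have hp2 : (fun y => compPlus Ψ y ^ 2) =ᵐ[volume] (x.1 * x.1 : CT) := by
    filter_upwards [hp] with t ht
    rw [ht, sq]; rfl
  have hm2 : (fun y => compMinus Ψ y ^ 2) =ᵐ[volume] (x.2 * x.2 : CT) := by
    filter_upwards [hm] with t ht
    rw [ht, sq]; rfl
  filter_upwards [hp, hm] with t htp htm
  have e1 := phi1Dx_eq hp2 (hx.1.mul hx.1) (-2) τ t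
  have e2 := phi1Dx_eq hm2 (hx.2.mul hx.2) 2 τ t
  have e3 := phi1Dx_eq (absSq_compPlus_ae hΨ) (hx.1.mul hx.1.star) (-2) τ t
  have e4 := phi1Dx_eq (absSq_compMinus_ae hΨ) (hx.2.mul hx.2.star) 2 τ t
  rw [← avg] at e1 e2 e3 e4
  refine spinor_ext ?_ ?_ <;>
    simp only [termI3, htp, htm, spin_zero, spin_one, ContinuousMap.add_apply,
      ContinuousMap.mul_apply, ContinuousMap.star_apply, RCLike.star_def, mul_comm (star x.1) x.1,
      mul_comm (star x.2) x.2, ← e1, ← e2, ← e3, ← e4, PiLp.smul_apply,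
      smul_eq_mul, Matrix.cons_val_zero, Matrix.cons_val_one] <;> ring

lemma termI2Ext_ae {V : Torus → ℝ} {W : CT} (hV : (fun y => (V y : ℂ)) =ᵐ[volume] W)
    (hW : Wiener W) (τ : ℝ) : termI2Ext V τ Ψ =ᵐ[volume] fun t =>
      spin (x.1 t * avg τ 1 W t) (x.2 t * avg τ (-1) W t) := by
  filter_upwards [compPlus_ae hΨ, compMinus_ae hΨ] with t htp htm
  have e1 := phi1Dx_eq hV hW 1 τ t
  have e2 := phi1Dx_eq hV hW (-1) τ t
  rw [← avg] at e1 e2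
  rw [one_mul] at e1
  rw [neg_one_mul] at e2
  simp only [termI2Ext, act_projPlus, act_projMinus]
  rw [← e1, ← e2, ← htp, ← htm]
  simp only [compPlus, compMinus]
  refine spinor_ext ?_ ?_ <;> simp <;> ring

lemma termI2DP_ae (hx : WienerPair x) (τ : ℝ) : termI2DP τ Ψ =ᵐ[volume] fun t =>
    spin (-(1 / 2) * (x.1 * invDxxC ((τ : ℂ) • (x.1 * star x.1) + avg τ 2 (x.2 * star x.2)) : CT) t)
      (-(1 / 2) * (x.2 * invDxxC ((τ : ℂ) • (x.2 * star x.2)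
        + avg τ (-2) (x.1 * star x.1)) : CT) t) := by
  -- Below, `φ₁` occurs inside `∂ₓₓ⁻¹` without its factor `τ`, so the averages must be divided by
  -- `τ`.
  by_cases hτ : τ = 0
  · subst hτ
    refine Filter.Eventually.of_forall fun t => ?_
    refine spinor_ext ?_ ?_ <;> simp [termI2DP, avg]
  have hτ' : (τ : ℂ) ≠ 0 := Complex.ofReal_ne_zero.2 hτ
  have hp := absSq_compPlus_ae hΨ
  have hm := absSq_compMinus_ae hΨ
  have e1 : ∀ t, phi1Dx (-2 * τ) (absSq (compPlus Ψ)) t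
      = ((τ : ℂ)⁻¹ • avg τ (-2) (x.1 * star x.1) : CT) t := fun t => by
    have := phi1Dx_eq hp (hx.1.mul hx.1.star) (-2) τ t
    rw [← avg] at this
    rw [ContinuousMap.smul_apply, ← this, smul_eq_mul, inv_mul_cancel_left₀ hτ']
  have e2 : ∀ t, phi1Dx (2 * τ) (absSq (compMinus Ψ)) t
      = ((τ : ℂ)⁻¹ • avg τ 2 (x.2 * star x.2) : CT) t := fun t => by
    have := phi1Dx_eq hm (hx.2.mul hx.2.star) 2 τ t
    rw [← avg] at this
    rw [ContinuousMap.smul_apply, ← this, smul_eq_mul, inv_mul_cancel_left₀ hτ']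
  have a1 : (fun y => phi1Dx (2 * τ) (absSq (compMinus Ψ)) y + absSq (compPlus Ψ) y)
      =ᵐ[volume] ((τ : ℂ)⁻¹ • ((τ : ℂ) • (x.1 * star x.1) + avg τ 2 (x.2 * star x.2)) : CT) := by
    filter_upwards [hp] with t ht
    rw [e2, ht, smul_add, inv_smul_smul₀ hτ', add_comm]; rfl
  have a2 : (fun y => phi1Dx (-2 * τ) (absSq (compPlus Ψ)) y + absSq (compMinus Ψ) y)
      =ᵐ[volume] ((τ : ℂ)⁻¹ • ((τ : ℂ) • (x.2 * star x.2) + avg τ (-2) (x.1 * star x.1)) : CT) := by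
    filter_upwards [hm] with t ht
    rw [e1, ht, smul_add, inv_smul_smul₀ hτ', add_comm]; rfl
  have w1 := ((((hx.1.mul hx.1.star).smul (τ : ℂ)).add
    ((hx.2.mul hx.2.star).avg τ 2)).smul (τ : ℂ)⁻¹)
  have w2 := ((((hx.2.mul hx.2.star).smul (τ : ℂ)).add
    ((hx.1.mul hx.1.star).avg τ (-2))).smul (τ : ℂ)⁻¹)
  filter_upwards [compPlus_ae hΨ, compMinus_ae hΨ] with t htp htm
  simp only [termI2DP, invDxx_eq a1 w1, invDxx_eq a2 w2, htp, htm, map_smul,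
    ContinuousMap.smul_apply, ContinuousMap.mul_apply, smul_eq_mul]
  refine spinor_ext ?_ ?_ <;> simp <;> field_simp <;> ring

end representation

end

end NonlinearDirac

/-! ### The second-order correction, and identification of both schemes with the abstract step. -/

namespace NonlinearDirac

noncomputable section

/-- A component of the second-order correction, in terms of the force `(g₁, g₂)`. -/
def corrC (lam κ : ℝ) (V u v g₁ g₂ : CT) : CT :=
  -(g₂ + V * g₁)
    + ((lam / 2 : ℝ) : ℂ) • (star g₁ * v * v - g₁ * star v * v + u * star g₂ * v
      - star u * g₂ * v - u * star v * g₂ - star u * v * g₂)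
    + ((κ / 2 : ℝ) : ℂ) • (invDxxC (g₁ * star u + g₂ * star v - u * star g₁ - v * star g₂) * u
      + invDxxC (u * star u + v * star v) * g₁)

lemma star_neg_I_smul (f : CT) : star (-Complex.I • f) = Complex.I • star f := by
  rw [star_smul]; simp

/-- The outer `-i` meets `-i` in a linear slot, giving the sign `-1`, and `i` in a conjugated slot,
giving `+1`; this accounts for the signs in `corrC`. -/
lemma corrC_eq (lam κ : ℝ) (V u v g₁ g₂ : CT) :
    -Complex.I • ((-Complex.I • g₂ + V * (-Complex.I • g₁))
      + tri lam κ (-Complex.I • g₁) (-Complex.I • g₂) u v u v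
      + tri lam κ u v (-Complex.I • g₁) (-Complex.I • g₂) u v
      + tri lam κ u v u v (-Complex.I • g₁) (-Complex.I • g₂)) = corrC lam κ V u v g₁ g₂ := by
  simp only [tri, corrC, star_neg_I_smul, smul_mul_assoc, mul_smul_comm, ← smul_add, map_smul,
    map_add, map_sub]
  ext t
  simp only [ContinuousMap.add_apply, ContinuousMap.sub_apply, ContinuousMap.smul_apply,
    ContinuousMap.mul_apply, ContinuousMap.neg_apply, smul_eq_mul]
  set D₁ := invDxxC (g₁ * star u) t
  set D₂ := invDxxC (g₂ * star v) t
  set D₃ := invDxxC (u * star g₁) t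
  set D₄ := invDxxC (v * star g₂) t
  set D₅ := invDxxC (u * star u) t
  set D₆ := invDxxC (v * star v) t
  linear_combination (g₂ t + V t * g₁ t
    + ((lam / 2 : ℝ) : ℂ) * (g₁ t * star v t * v t - star g₁ t * v t * v t - u t * star g₂ t * v t
      + star u t * g₂ t * v t + u t * star v t * g₂ t + star u t * v t * g₂ t)
    - ((κ / 2 : ℝ) : ℂ) * ((D₁ + D₂ - D₃ - D₄) * u t + (D₅ + D₆) * g₁ t)) * Complex.I_mul_I

lemma corr_eq (lam κ : ℝ) (V : CT) (x : Pair) : (diracSystem lam κ V).corr x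
    = (corrC lam κ V x.1 x.2 ((diracSystem lam κ V).force x).1 ((diracSystem lam κ V).force x).2,
       corrC lam κ V x.2 x.1 ((diracSystem lam κ V).force x).2
        ((diracSystem lam κ V).force x).1) :=
  Prod.ext (corrC_eq lam κ V x.1 x.2 _ _) (corrC_eq lam κ V x.2 x.1 _ _)

lemma force_eq (lam κ : ℝ) (V : CT) (x : Pair) : (diracSystem lam κ V).force x
    = (x.2 + V * x.1 + tri lam κ x.1 x.2 x.1 x.2 x.1 x.2,
       x.1 + V * x.2 + tri lam κ x.2 x.1 x.2 x.1 x.2 x.1) := rfl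

lemma im_ofReal (z : ℂ) : ((z.im : ℝ) : ℂ) = -(Complex.I / 2) * (z - (starRingEnd ℂ) z) := by
  apply Complex.ext
  · simp; ring
  · simp

lemma toField_add (x y : Pair) (t : Torus) : toField (x + y) t = toField x t + toField y t := by
  refine spinor_ext ?_ ?_ <;> simp [toField] <;> ring

lemma toField_smul (c : ℂ) (x : Pair) (t : Torus) : toField (c • x) t = c • toField x t := by
  refine spinor_ext ?_ ?_ <;> simp [toField] <;> ring

section representation

variable {Ψ : Field} {x : Pair} (hΨ : Ψ =ᵐ[volume] toField x)
include hΨ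

lemma scalarDensity_ae : scalarDensity Ψ
    =ᵐ[volume] ((1 / 2 : ℂ) • (x.1 * star x.2 + star x.1 * x.2) : CT) := by
  filter_upwards [hΨ] with t ht
  simp only [scalarDensity, ht, toField, spin_zero, spin_one, ofReal_norm_sq,
    ContinuousMap.smul_apply, ContinuousMap.add_apply, ContinuousMap.mul_apply,
    ContinuousMap.star_apply, smul_eq_mul, map_div₀, map_add, map_sub, Complex.conj_ofNat,
    RCLike.star_def]
  ring

lemma imPlus_ae {G : Field} {g : Pair} (hG : G =ᵐ[volume] toField g) :
    (fun t => (imPlus Ψ G t : ℂ)) =ᵐ[volume] ((-(Complex.I / 4)) •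
      (x.1 * star g.2 + x.2 * star g.1 - star x.1 * g.2 - star x.2 * g.1) : CT) := by
  filter_upwards [hΨ, hG] with t ht hg
  simp only [imPlus, im_ofReal, ht, hg, toField, spin_zero, spin_one,
    ContinuousMap.smul_apply, ContinuousMap.add_apply, ContinuousMap.sub_apply,
    ContinuousMap.mul_apply, ContinuousMap.star_apply, smul_eq_mul, map_div₀, map_add, map_sub,
    map_mul, Complex.conj_ofNat, RCLike.star_def, Complex.conj_conj]
  ring

lemma imMinus_ae {G : Field} {g : Pair} (hG : G =ᵐ[volume] toField g) :
    (fun t => (imMinus Ψ G t : ℂ)) =ᵐ[volume] ((Complex.I / 4) •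
      (g.1 * star x.1 + g.2 * star x.2 - x.1 * star g.1 - x.2 * star g.2) : CT) := by
  filter_upwards [hΨ, hG] with t ht hg
  simp only [imMinus, im_ofReal, ht, hg, toField, spin_zero, spin_one,
    ContinuousMap.smul_apply, ContinuousMap.add_apply, ContinuousMap.sub_apply,
    ContinuousMap.mul_apply, ContinuousMap.star_apply, smul_eq_mul, map_div₀, map_add, map_sub,
    map_mul, Complex.conj_ofNat, RCLike.star_def, Complex.conj_conj]
  ring

lemma invDxx_density (hx : WienerPair x) :
    invDxx (density Ψ) = ((1 / 2 : ℂ) • invDxxC (x.1 * star x.1 + x.2 * star x.2) : CT) := by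
  rw [invDxx_eq (density_ae hΨ) (((hx.1.mul hx.1.star).add (hx.2.mul hx.2.star)).smul _), map_smul]

lemma thirring_ae (lam : ℝ) : thirring lam Ψ =ᵐ[volume] fun t =>
    spin ((lam / 2) * (x.1 * star x.2 + star x.1 * x.2 : CT) t * x.2 t)
      ((lam / 2) * (x.1 * star x.2 + star x.1 * x.2 : CT) t * x.1 t) := by
  filter_upwards [hΨ, scalarDensity_ae hΨ] with t ht hs
  simp only [thirring, hs, ht, toField, act_beta_spin]
  refine spinor_ext ?_ ?_ <;> simp <;> ring

lemma forceExt_ae (lam : ℝ) {V : Torus → ℝ} {W : CT} (hV : (fun y => (V y : ℂ)) =ᵐ[volume] W) :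
    forceExt lam V Ψ =ᵐ[volume] toField ((diracSystem lam 0 W).force x) := by
  filter_upwards [hΨ, thirring_ae hΨ lam, hV] with t ht h hv
  simp only [forceExt, h, ht, hv, toField, act_beta_spin, force_eq, tri]
  refine spinor_ext ?_ ?_ <;> simp <;> ring

lemma forceDP_ae (hx : WienerPair x) (lam : ℝ) :
    forceDP lam Ψ =ᵐ[volume] toField ((diracSystem lam 1 0).force x) := by
  filter_upwards [hΨ, thirring_ae hΨ lam] with t ht h
  simp only [forceDP, h, ht, toField, act_beta_spin, force_eq, tri, invDxx_density hΨ hx,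
    add_comm (x.2 * star x.2) (x.1 * star x.1)]
  refine spinor_ext ?_ ?_ <;> simp <;> ring

lemma thetaExt_eq (hx : WienerPair x) (lam τ : ℝ) {V : Torus → ℝ} {W : CT}
    (hV : (fun y => (V y : ℂ)) =ᵐ[volume] W) (hW : Wiener W) (t : Torus) :
    thetaExt lam V τ Ψ t = toField (diracFlow (-τ) (x - Complex.I •
      (pullIntegral lam 0 W τ 1 x.1 x.2, pullIntegral lam 0 W τ (-1) x.2 x.1))) t := by
  have h : (fun y => termI1 τ Ψ y + termI2Ext V τ Ψ y + termI3 lam τ Ψ y) =ᵐ[volume]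
      toField (pullIntegral lam 0 W τ 1 x.1 x.2, pullIntegral lam 0 W τ (-1) x.2 x.1) := by
    filter_upwards [termI2Ext_ae hΨ hV hW τ, termI3_ae hΨ hx lam τ] with t h2 h3
    rw [termI1_eq hΨ hx, h2, h3]
    refine spinor_ext ?_ ?_ <;> simp [toField, pullIntegral] <;> ring
  rw [thetaExt, expAlphaDx_eq hΨ hx, expAlphaDx_eq h (WienerPair.integral_force hW hx τ), map_sub,
    map_smul, sub_eq_add_neg, sub_eq_add_neg, toField_add, ← neg_smul, ← neg_smul, toField_smul]

lemma thetaDP_eq (hx : WienerPair x) (lam τ : ℝ) (t : Torus) :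
    thetaDP lam τ Ψ t = toField (diracFlow (-τ) (x - Complex.I •
      (pullIntegral lam 1 0 τ 1 x.1 x.2, pullIntegral lam 1 0 τ (-1) x.2 x.1))) t := by
  have hW : Wiener (0 : CT) := by simp only [Wiener, map_zero]; exact summable_zero
  have h0 : ∀ c, avg τ c 0 = 0 := fun c => by simp [avg]
  have h : (fun y => termI1 τ Ψ y + termI2DP τ Ψ y + termI3 lam τ Ψ y) =ᵐ[volume]
      toField (pullIntegral lam 1 0 τ 1 x.1 x.2, pullIntegral lam 1 0 τ (-1) x.2 x.1) := by
    filter_upwards [termI2DP_ae hΨ hx τ, termI3_ae hΨ hx lam τ] with t h2 h3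
    rw [termI1_eq hΨ hx, h2, h3]
    refine spinor_ext ?_ ?_ <;> simp [toField, pullIntegral, h0] <;> ring
  rw [thetaDP, expAlphaDx_eq hΨ hx, expAlphaDx_eq h (WienerPair.integral_force hW hx τ), map_sub,
    map_smul, sub_eq_add_neg, sub_eq_add_neg, toField_add, ← neg_smul, ← neg_smul, toField_smul]

/-- The scheme for an external potential in terms of `(ψ₊, ψ₋)`. -/
theorem stepExt_ae (hx : WienerPair x) (lam τ : ℝ) {V : Torus → ℝ} {W : CT}
    (hV : (fun y => (V y : ℂ)) =ᵐ[volume] W) (hW : Wiener W) :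
    stepExt lam V τ Ψ =ᵐ[volume] toField ((diracSystem lam 0 W).step τ x) := by
  have hG := forceExt_ae hΨ lam hV
  filter_upwards [hΨ, hG, hV, scalarDensity_ae hΨ, imPlus_ae hΨ hG] with t ht hg hv hs hi
  rw [CubicSystem.step, integral_force, toField_add, toField_smul]
  simp only [stepExt, thetaExt_eq hΨ hx lam τ hV hW]
  rw [hs, hi, hv, hg, ht, corr_eq]
  set g := (diracSystem lam 0 W).force x
  change toField (diracFlow (-τ) _) t - _ - _ + _ = toField (diracFlow (-τ) _) t + _
  rw [sub_sub, sub_add, sub_eq_add_neg]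
  congr 1
  simp only [toField, act_beta_spin, corrC]
  refine spinor_ext ?_ ?_ <;> simp
  -- The two sides differ only by the product of the `i` in the scheme with the `i` in the formula
  -- for the imaginary part.
  · linear_combination ((lam : ℂ) * (τ : ℂ) ^ 2 / 8 * (x.1 t + x.2 t) * (x.1 t * (starRingEnd ℂ) (g.2 t)
      + x.2 t * (starRingEnd ℂ) (g.1 t) - (starRingEnd ℂ) (x.1 t) * g.2 t
      - (starRingEnd ℂ) (x.2 t) * g.1 t)) * -Complex.I_mul_I
  · linear_combination ((lam : ℂ) * (τ : ℂ) ^ 2 / 8 * (x.2 t - x.1 t) * (x.1 t * (starRingEnd ℂ) (g.2 t)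
      + x.2 t * (starRingEnd ℂ) (g.1 t) - (starRingEnd ℂ) (x.1 t) * g.2 t
      - (starRingEnd ℂ) (x.2 t) * g.1 t)) * -Complex.I_mul_I

/-- The scheme for the Dirac-Poisson system in terms of `(ψ₊, ψ₋)`. -/
theorem stepDP_ae (hx : WienerPair x) (lam τ : ℝ) :
    stepDP lam τ Ψ =ᵐ[volume] toField ((diracSystem lam 1 0).step τ x) := by
  have hW : Wiener (0 : CT) := by simp only [Wiener, map_zero]; exact summable_zero
  have hG := forceDP_ae hΨ hx lam
  have hgW : WienerPair ((diracSystem lam 1 0).force x) := WienerPair.force hW hx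
  have hD := invDxx_eq (imMinus_ae hΨ hG)
    (((((hgW.1.mul hx.1.star).add (hgW.2.mul hx.2.star)).sub (hx.1.mul hgW.1.star)).sub
      (hx.2.mul hgW.2.star)).smul _)
  filter_upwards [hΨ, hG, scalarDensity_ae hΨ, imPlus_ae hΨ hG] with t ht hg hs hi
  rw [CubicSystem.step, integral_force, toField_add, toField_smul]
  simp only [stepDP, thetaDP_eq hΨ hx lam τ, hD, invDxx_density hΨ hx, map_smul]
  rw [hs, hi, hg, ht, corr_eq]
  set g := (diracSystem lam 1 0).force x
  change toField (diracFlow (-τ) _) t - _ - _ + _ + _ - _ = toField (diracFlow (-τ) _) t + _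
  rw [sub_sub, sub_add, sub_add, sub_sub, sub_eq_add_neg]
  congr 1
  have e1 : invDxxC (g.2 * star x.2 + g.1 * star x.1 - x.2 * star g.2 - x.1 * star g.1)
      = invDxxC (g.1 * star x.1 + g.2 * star x.2 - x.1 * star g.1 - x.2 * star g.2) := by
    congr 1; ring
  simp only [toField, act_beta_spin, corrC, e1, add_comm (x.2 * star x.2) (x.1 * star x.1)]
  set D₁ := invDxxC (x.1 * star x.1 + x.2 * star x.2)
  set D₂ := invDxxC (g.1 * star x.1 + g.2 * star x.2 - x.1 * star g.1 - x.2 * star g.2)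
  refine spinor_ext ?_ ?_ <;> simp
  · linear_combination ((lam : ℂ) * (τ : ℂ) ^ 2 / 8 * (x.1 t + x.2 t) * (x.1 t * (starRingEnd ℂ) (g.2 t)
      + x.2 t * (starRingEnd ℂ) (g.1 t) - (starRingEnd ℂ) (x.1 t) * g.2 t
      - (starRingEnd ℂ) (x.2 t) * g.1 t)
      + (τ : ℂ) ^ 2 / 8 * D₂ t * (x.1 t + x.2 t)) * -Complex.I_mul_I
  · linear_combination ((lam : ℂ) * (τ : ℂ) ^ 2 / 8 * (x.2 t - x.1 t) * (x.1 t * (starRingEnd ℂ) (g.2 t)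
      + x.2 t * (starRingEnd ℂ) (g.1 t) - (starRingEnd ℂ) (x.1 t) * g.2 t
      - (starRingEnd ℂ) (x.2 t) * g.1 t)
      + (τ : ℂ) ^ 2 / 8 * D₂ t * (x.1 t - x.2 t)) * -Complex.I_mul_I

end representation

end

end NonlinearDirac

/-! ### `H¹` coefficient sequences, Fourier coefficients of fields and scalar Duhamel. -/

namespace NonlinearDirac

noncomputable section

/-- `∑ (1 + l²) |c_l|² ≤ M²`, as a bound on all finite partial sums. -/
def H1Seq (M : ℝ) (c : ℤ → ℂ) : Prop :=
  ∀ s : Finset ℤ, ∑ l ∈ s, (1 + (l : ℝ) ^ 2) * ‖c l‖ ^ 2 ≤ M ^ 2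

/-- The summable weight `(1 + l²)⁻¹`. -/
def weight (l : ℤ) : ℝ := (1 + (l : ℝ) ^ 2)⁻¹

lemma weight_nonneg (l : ℤ) : 0 ≤ weight l := by unfold weight; positivity

lemma summable_weight : Summable weight := by
  rw [← (Set.finite_singleton (0 : ℤ)).summable_compl_iff]
  refine Summable.of_nonneg_of_le (fun _ => weight_nonneg _) (fun l => ?_)
    ((Real.summable_one_div_int_pow.2 one_lt_two).subtype _)
  have hl : (l.1 : ℝ) ≠ 0 := by
    have := l.2
    simp only [Set.mem_compl_iff, Set.mem_singleton_iff] at this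
    exact_mod_cast this
  have : 0 < (l.1 : ℝ) ^ 2 := by positivity
  simp only [weight, Function.comp, one_div]
  exact inv_anti₀ this (by linarith)

namespace H1Seq

variable {M : ℝ} {c : ℤ → ℂ}

/-- This is a Young inequality with free parameter: `δ = 1` gives the supremum bound, and small `δ`
makes tails small uniformly over an `H¹` ball. -/
lemma sum_norm_le (h : H1Seq M c) {δ : ℝ} (hδ : 0 < δ) (s : Finset ℤ) :
    ∑ l ∈ s, ‖c l‖ ≤ δ * M ^ 2 + δ⁻¹ * ∑ l ∈ s, weight l := by
  have h1 : ∀ l : ℤ, ‖c l‖ ≤ δ * ((1 + (l : ℝ) ^ 2) * ‖c l‖ ^ 2) + δ⁻¹ * weight l := by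
    intro l
    have hw : 0 < 1 + (l : ℝ) ^ 2 := by positivity
    set a := ‖c l‖
    unfold weight
    rw [← sub_nonneg]
    -- Completing the square exhibits the difference as a nonnegative quantity.
    have e : δ * ((1 + (l : ℝ) ^ 2) * a ^ 2) + δ⁻¹ * (1 + (l : ℝ) ^ 2)⁻¹ - a
        = (δ * (1 + (l : ℝ) ^ 2))⁻¹ * ((δ * (1 + (l : ℝ) ^ 2) * a - 1 / 2) ^ 2 + 3 / 4) := by
      field_simp
      ring
    rw [e]
    positivity
  calc ∑ l ∈ s, ‖c l‖
      ≤ ∑ l ∈ s, (δ * ((1 + (l : ℝ) ^ 2) * ‖c l‖ ^ 2) + δ⁻¹ * weight l) :=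
        Finset.sum_le_sum fun l _ => h1 l
    _ = δ * ∑ l ∈ s, (1 + (l : ℝ) ^ 2) * ‖c l‖ ^ 2 + δ⁻¹ * ∑ l ∈ s, weight l := by
        rw [Finset.sum_add_distrib, Finset.mul_sum, Finset.mul_sum]
    _ ≤ _ := by
        have := h s
        gcongr

lemma summable_norm (h : H1Seq M c) : Summable fun l => ‖c l‖ := by
  refine summable_of_sum_le (c := 1 * M ^ 2 + 1⁻¹ * ∑' l, weight l) (fun _ => norm_nonneg _)
    fun s => (h.sum_norm_le one_pos s).trans ?_
  have := summable_weight.sum_le_tsum s fun l _ => weight_nonneg l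
  gcongr

end H1Seq

/-- The continuous function with absolutely summable Fourier coefficients `c`. -/
def series (c : ℤ → ℂ) : CT := ∑' l : ℤ, c l • (fourier l : CT)

/-- The bound for functions whose coefficients satisfy `H1Seq M`. -/
def supBound (M : ℝ) : ℝ := M ^ 2 + ∑' l, weight l

namespace H1Seq

variable {M : ℝ} {c : ℤ → ℂ} (h : H1Seq M c)
include h

lemma hasSum_series : HasSum (fun l : ℤ => c l • (fourier l : CT)) (series c) := by
  refine Summable.hasSum (Summable.of_norm_bounded h.summable_norm fun l => ?_)
  rw [norm_smul, fourier_norm, mul_one]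

lemma coeff_series (n : ℤ) : coeff n (series c) = c n := by
  have h2 := (coeff n).hasSum h.hasSum_series
  simp only [map_smul, coeff_fourier, smul_eq_mul] at h2
  refine h2.unique ?_
  convert hasSum_ite_eq n (c n) using 2 with l
  by_cases h : n = l
  · subst h; simp
  · simp [h, Ne.symm h]

lemma wiener_series : Wiener (series c) := by
  unfold Wiener
  simp only [h.coeff_series]
  exact h.summable_norm.of_norm

lemma norm_partial_le {δ : ℝ} (hδ : 0 < δ) (s : Finset ℤ) :
    ‖∑ l ∈ s, c l • (fourier l : CT)‖ ≤ δ * M ^ 2 + δ⁻¹ * ∑ l ∈ s, weight l := by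
  refine (norm_sum_le _ _).trans (le_trans (Finset.sum_le_sum fun l _ => ?_)
    (h.sum_norm_le hδ s))
  rw [norm_smul, fourier_norm, mul_one]

lemma norm_series_le : ‖series c‖ ≤ supBound M := by
  refine le_of_tendsto (Filter.Tendsto.norm h.hasSum_series)
    (Filter.Eventually.of_forall fun s => ?_)
  refine (h.norm_partial_le one_pos s).trans ?_
  have := summable_weight.sum_le_tsum s fun l _ => weight_nonneg l
  unfold supBound
  linarith

/-- Mode by mode, `|e^{isn} - 1| ≤ |s n|`, and Parseval sums the squares. This is the only form in
which `H¹` regularity enters the error analysis. -/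
lemma lipschitz_series (s : ℝ) : ‖toL2 (shift s (series c) - series c)‖ ≤ |M| * |s| := by
  refine (le_abs_self _).trans (abs_le_of_sq_le_sq ?_ (by positivity))
  refine hasSum_le_of_sum_le (hasSum_norm_toL2 _) fun F => ?_
  have h1 : ∀ n : ℤ, ‖coeff n (shift s (series c) - series c)‖ ^ 2
      ≤ s ^ 2 * ((1 + (n : ℝ) ^ 2) * ‖c n‖ ^ 2) := by
    intro n
    rw [map_sub, coeff_shift, h.coeff_series, ← sub_one_mul, norm_mul, mul_pow]
    have h2 := Real.norm_exp_I_mul_ofReal_sub_one_le (x := s * (n : ℝ))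
    push_cast at h2
    have h3 : ‖Complex.exp (Complex.I * ((s : ℂ) * (n : ℂ))) - 1‖ ^ 2 ≤ (s * (n : ℝ)) ^ 2 := by
      rw [← sq_abs (s * (n : ℝ)), ← Real.norm_eq_abs]
      gcongr
    have h4 : (s * (n : ℝ)) ^ 2 ≤ s ^ 2 * (1 + (n : ℝ) ^ 2) := by nlinarith [sq_nonneg s]
    calc _ ≤ s ^ 2 * (1 + (n : ℝ) ^ 2) * ‖c n‖ ^ 2 := by gcongr; exact h3.trans h4
      _ = _ := by ring
  calc _ ≤ ∑ n ∈ F, s ^ 2 * ((1 + (n : ℝ) ^ 2) * ‖c n‖ ^ 2) := Finset.sum_le_sum fun n _ => h1 n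
    _ = s ^ 2 * ∑ n ∈ F, (1 + (n : ℝ) ^ 2) * ‖c n‖ ^ 2 := by rw [Finset.mul_sum]
    _ ≤ s ^ 2 * M ^ 2 := by gcongr; exact h F
    _ = (|M| * |s|) ^ 2 := by rw [mul_pow, sq_abs, sq_abs]; ring

end H1Seq

/-- A family bounded in `H¹` with continuous Fourier coefficients is uniformly continuous in the
supremum norm. -/
lemma continuous_series {Y : Type*} [TopologicalSpace Y] {M : ℝ} {c : Y → ℤ → ℂ}
    (h : ∀ y, H1Seq M (c y)) (hc : ∀ l, Continuous fun y => c y l) :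
    Continuous fun y => series (c y) := by
  have hu : TendstoUniformly (fun (s : Finset ℤ) y => ∑ l ∈ s, c y l • (fourier l : CT))
      (fun y => series (c y)) Filter.atTop := by
    rw [Metric.tendstoUniformly_iff]
    intro ε hε
    -- With this choice `δ M² ≤ ε/4`; a weight tail below `δ ε/4` contributes another `ε/4`. The
    -- limit in `F` is then at most `ε/2`, which leaves room for the strict inequality.
    set δ := ε / (4 * (M ^ 2 + 1)) with hδ
    have hδ0 : 0 < δ := by positivity
    obtain ⟨s₀, hs₀⟩ := summable_iff_vanishing_norm.1 summable_weight (δ * (ε / 4)) (by positivity)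
    filter_upwards [Filter.eventually_ge_atTop s₀] with s hs y
    have hlim : Filter.Tendsto (fun F : Finset ℤ =>
        ‖∑ l ∈ F, c y l • (fourier l : CT) - ∑ l ∈ s, c y l • (fourier l : CT)‖) Filter.atTop
        (nhds ‖series (c y) - ∑ l ∈ s, c y l • (fourier l : CT)‖) :=
      Filter.Tendsto.norm (Filter.Tendsto.sub_const (h y).hasSum_series _)
    rw [dist_eq_norm]
    refine lt_of_le_of_lt (le_of_tendsto hlim (b := ε / 2) ?_) (by linarith)
    filter_upwards [Filter.eventually_ge_atTop s] with F hF
    rw [← Finset.sum_sdiff hF, add_sub_cancel_right]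
    refine ((h y).norm_partial_le hδ0 (F \ s)).trans ?_
    have h1 : ∑ l ∈ F \ s, weight l ≤ δ * (ε / 4) :=
      (le_abs_self _).trans (hs₀ (F \ s)
        (Finset.disjoint_of_subset_right hs Finset.sdiff_disjoint)).le
    have h2 : δ * M ^ 2 ≤ ε / 4 := by
      rw [hδ, div_mul_eq_mul_div, div_le_div_iff₀ (by positivity) (by norm_num)]
      nlinarith [sq_nonneg M]
    have h3 : δ⁻¹ * ∑ l ∈ F \ s, weight l ≤ δ⁻¹ * (δ * (ε / 4)) := by gcongr
    rw [inv_mul_cancel_left₀ hδ0.ne'] at h3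
    linarith
  refine hu.continuous (Filter.Frequently.of_forall fun s => ?_)
  exact continuous_finsetSum s fun l _ => (hc l).smul continuous_const

lemma volume_eq_smul : (volume : Measure Torus) = ENNReal.ofReal (2 * Real.pi) • haar :=
  AddCircle.volume_eq_smul_haarAddCircle

lemma ae_volume_iff {p : Torus → Prop} : (∀ᵐ x ∂volume, p x) ↔ ∀ᵐ x ∂haar, p x := by
  rw [volume_eq_smul, Measure.ae_ennreal_smul_measure_iff]
  simpa using Real.pi_pos

/-- An `L²` function is determined by its Fourier coefficients. -/
lemma ae_eq_of_coeff {f : Torus → ℂ} (hf : MemLp f 2 volume) {g : CT}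
    (h : ∀ n, fourierCoeff f n = coeff n g) : f =ᵐ[volume] g := by
  have hf' : MemLp f 2 haar := hf.haarAddCircle
  have e : hf'.toLp f = toL2 g := by
    refine fourierBasis.repr.injective ?_
    ext n
    rw [fourierBasis_repr, fourierBasis_repr, fourierCoeff_congr_ae hf'.coeFn_toLp, h, toL2,
      fourierCoeff_toLp, coeff_apply]
  refine ae_volume_iff.2 ?_
  have h1 := hf'.coeFn_toLp
  rw [e] at h1
  exact h1.symm.trans (ContinuousMap.coeFn_toLp (p := 2) (𝕜 := ℂ) haar g)

lemma integrable_haar {E : Type*} [NormedAddCommGroup E] {F : Torus → E} (hF : MemLp F 2 volume) : Integrable F haar := by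
  have h := hF.integrable one_le_two
  rw [volume_eq_smul] at h
  exact (integrable_smul_measure (by simpa using Real.pi_pos) ENNReal.ofReal_ne_top).1 h

lemma fourierCoeff_clm {E : Type*} [NormedAddCommGroup E] [NormedSpace ℂ E] [CompleteSpace E]
    (ℓ : E →L[ℂ] ℂ) {F : Torus → E} (hF : MemLp F 2 volume) (n : ℤ) : fourierCoeff (fun t => ℓ (F t)) n = ℓ (fourierCoeff F n) := by
  have h := ContinuousLinearMap.integral_comp_comm ℓ ((integrable_haar hF).fourier_smul (-n))
  simpa only [fourierCoeff, map_smul] using h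

/-- The Fourier coefficient of a scalar component of an `L²` spinor field. -/
def fieldCoeff (ℓ : Spinor →L[ℂ] ℂ) (n : ℤ) : L2 →L[ℂ] ℂ :=
  ((2 * Real.pi : ℝ) : ℂ)⁻¹ • (innerSL ℂ (ContinuousMap.toLp 2 volume ℂ (fourier n : CT))).comp
    (ℓ.compLpL 2 volume)

lemma fieldCoeff_apply (ℓ : Spinor →L[ℂ] ℂ) (n : ℤ) (F : L2) :
    fieldCoeff ℓ n F = fourierCoeff (fun t => ℓ (F t)) n := by
  have h : inner ℂ (ContinuousMap.toLp 2 volume ℂ (fourier n : CT)) (ℓ.compLpL 2 volume F)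
      = ∫ t : Torus, fourier (-n) t • ℓ (F t) := by
    rw [L2.inner_def]
    refine integral_congr_ae ?_
    filter_upwards [ContinuousMap.coeFn_toLp (p := 2) (𝕜 := ℂ) volume (fourier n : CT),
      ℓ.coeFn_compLpL (p := 2) F] with t h1 h2
    rw [h1, h2, fourier_neg, RCLike.inner_apply', smul_eq_mul]
  rw [fourierCoeff, AddCircle.integral_haarAddCircle, ← h]
  simp [fieldCoeff, -mul_inv_rev]

/-- The functionals `ψ ↦ ψ₊` and `ψ ↦ ψ₋`. -/
def plusL : Spinor →L[ℂ] ℂ := EuclideanSpace.proj 0 + EuclideanSpace.proj 1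

/-- See `plusL`. -/
def minusL : Spinor →L[ℂ] ℂ := EuclideanSpace.proj 0 - EuclideanSpace.proj 1

lemma plusL_apply (w : Spinor) : plusL w = w 0 + w 1 := rfl

lemma minusL_apply (w : Spinor) : minusL w = w 0 - w 1 := rfl

lemma spin_plusL_minusL (w : Spinor) : spin (plusL w) (minusL w) = w := by
  rw [plusL_apply, minusL_apply]
  refine spinor_ext ?_ ?_ <;> simp

lemma norm_plusL_sq_le (w : Spinor) : ‖plusL w‖ ^ 2 ≤ 2 * ‖w‖ ^ 2 := by
  rw [plusL_apply, EuclideanSpace.norm_sq_eq, Fin.sum_univ_two]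
  have h := norm_add_le (w 0) (w 1)
  have : ‖w 0 + w 1‖ ^ 2 ≤ (‖w 0‖ + ‖w 1‖) ^ 2 := by gcongr
  nlinarith [sq_nonneg (‖w 0‖ - ‖w 1‖)]

lemma norm_minusL_sq_le (w : Spinor) : ‖minusL w‖ ^ 2 ≤ 2 * ‖w‖ ^ 2 := by
  rw [minusL_apply, EuclideanSpace.norm_sq_eq, Fin.sum_univ_two]
  have h := norm_sub_le (w 0) (w 1)
  have : ‖w 0 - w 1‖ ^ 2 ≤ (‖w 0‖ + ‖w 1‖) ^ 2 := by gcongr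
  nlinarith [sq_nonneg (‖w 0‖ - ‖w 1‖)]

/-- The coefficients of the components of an `H¹` field. -/
lemma MemSobolev.h1Seq {E : Type*} [NormedAddCommGroup E] [NormedSpace ℂ E] [CompleteSpace E]
    {F : Torus → E} (hF : MemSobolev 1 F) {M : ℝ} (hM : sobolevNorm 1 F ≤ M) {ℓ : E →L[ℂ] ℂ}
    (hℓ : ∀ w, ‖ℓ w‖ ^ 2 ≤ 2 * ‖w‖ ^ 2) : H1Seq M fun n => fourierCoeff (fun t => ℓ (F t)) n := by
  intro s
  have hs := hF.2
  simp only [sobolevNorm, Real.rpow_one] at hM hs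
  have h1 := hs.sum_le_tsum s fun l _ => by positivity
  set S := ∑' l : ℤ, (1 + (l : ℝ) ^ 2) * ‖fourierCoeff F l‖ ^ 2
  have hS : 0 ≤ S := tsum_nonneg fun l => by positivity
  have h2 : 2 * Real.pi * S ≤ M ^ 2 := by
    rw [← Real.sq_sqrt (by positivity : 0 ≤ 2 * Real.pi * S)]
    gcongr
  calc ∑ l ∈ s, (1 + (l : ℝ) ^ 2) * ‖fourierCoeff (fun t => ℓ (F t)) l‖ ^ 2
      ≤ ∑ l ∈ s, 2 * ((1 + (l : ℝ) ^ 2) * ‖fourierCoeff F l‖ ^ 2) := by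
        refine Finset.sum_le_sum fun l _ => ?_
        rw [fourierCoeff_clm ℓ hF.1]
        have := mul_le_mul_of_nonneg_left (hℓ (fourierCoeff F l))
          (by positivity : 0 ≤ 1 + (l : ℝ) ^ 2)
        linarith
    _ = 2 * ∑ l ∈ s, (1 + (l : ℝ) ^ 2) * ‖fourierCoeff F l‖ ^ 2 := by rw [Finset.mul_sum]
    _ ≤ 2 * S := by gcongr
    -- The factor `2` from `|ψ±|² ≤ 2|Ψ|²` is absorbed by the `2π` in `sobolevNorm`.
    _ ≤ 2 * Real.pi * S := by nlinarith [Real.pi_gt_three]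
    _ ≤ M ^ 2 := h2

/-- Variation of constants for a scalar equation `u' = -a u - i g`. -/
lemma scalar_duhamel {T : ℝ} {u g : ℝ → ℂ} (hu : Continuous u) (hg : Continuous g) (a : ℂ)
    (h : ∀ t, 0 ≤ t → t ≤ T → u t = u 0 + ∫ s in (0 : ℝ)..t, (-a * u s - Complex.I * g s))
    {t : ℝ} (ht : 0 ≤ t) (htT : t ≤ T) :
    Complex.exp (a * t) * u t = u 0 - Complex.I * ∫ s in (0 : ℝ)..t, Complex.exp (a * s) * g s := by
  have hk : Continuous fun s => -a * u s - Complex.I * g s := by fun_prop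
  -- The right-hand side is differentiable on the whole line, whereas `u` agrees with it only on
  -- `[0, T]`; hence the product rule is applied to `U`.
  set U : ℝ → ℂ := fun t => u 0 + ∫ s in (0 : ℝ)..t, (-a * u s - Complex.I * g s) with hU
  have hUd : ∀ t, HasDerivAt U (-a * u t - Complex.I * g t) t := fun t =>
    ((hk.integral_hasStrictDerivAt 0 t).hasDerivAt).const_add _
  have hE : ∀ t : ℝ, HasDerivAt (fun s : ℝ => Complex.exp (a * s)) (Complex.exp (a * t) * a) t := by
    intro t
    have h1 : HasDerivAt (fun s : ℝ => a * (s : ℂ)) a t := by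
      simpa using (Complex.ofRealCLM.hasDerivAt (x := t)).const_mul a
    exact h1.cexp
  have hUc : Continuous U := continuous_iff_continuousAt.2 fun t => (hUd t).continuousAt
  have hW : ∀ t : ℝ, HasDerivAt (fun s : ℝ => Complex.exp (a * s) * U s)
      (Complex.exp (a * t) * a * U t
        + Complex.exp (a * t) * (-a * u t - Complex.I * g t)) t := fun t => (hE t).mul (hUd t)
  have hft := intervalIntegral.integral_eq_sub_of_hasDerivAt (a := 0) (b := t)
    (fun s _ => hW s) (Continuous.intervalIntegrable (by fun_prop) _ _)
  have hcongr : ∫ s in (0 : ℝ)..t, (Complex.exp (a * s) * a * U s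
      + Complex.exp (a * s) * (-a * u s - Complex.I * g s))
      = ∫ s in (0 : ℝ)..t, -Complex.I * (Complex.exp (a * s) * g s) := by
    refine intervalIntegral.integral_congr fun s hs => ?_
    rw [Set.uIcc_of_le ht] at hs
    have : U s = u s := (h s hs.1 (hs.2.trans htT)).symm
    simp only [this]; ring
  have hUt : U t = u t := (h t ht htT).symm
  rw [hcongr, intervalIntegral.integral_const_mul, hUt] at hft
  have hU0 : U 0 = u 0 := by simp [hU]
  simp only [Complex.ofReal_zero, mul_zero, Complex.exp_zero, one_mul, hU0] at hft
  linear_combination -hft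

/-- The `L²` norm of a spinor field in terms of `(ψ₊, ψ₋)`. -/
lemma norm_le_pairL2 {F : L2} {y : Pair} (h : F =ᵐ[volume] toField y) :
    ‖F‖ ≤ Real.sqrt (2 * Real.pi) * ‖pairL2 y‖ := by
  have hsq : ∀ f : CT, ‖toL2 f‖ ^ 2 = ∫ t, ‖f t‖ ^ 2 ∂haar := by
    intro f
    have h1 := congrArg RCLike.re (L2.inner_def (𝕜 := ℂ) (toL2 f) (toL2 f))
    rw [← integral_re (L2.integrable_inner _ _)] at h1
    simp only [← norm_sq_eq_re_inner] at h1
    rw [h1]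
    refine integral_congr_ae ?_
    filter_upwards [ContinuousMap.coeFn_toLp (p := 2) (𝕜 := ℂ) haar f] with t ht
    rw [toL2, ht]
  have hF : ‖F‖ ^ 2 = ∫ t, ‖toField y t‖ ^ 2 := by
    have h1 := congrArg RCLike.re (L2.inner_def (𝕜 := ℂ) F F)
    rw [← integral_re (L2.integrable_inner _ _)] at h1
    simp only [← norm_sq_eq_re_inner] at h1
    rw [h1]
    refine integral_congr_ae ?_
    filter_upwards [h] with t ht
    rw [ht]
  have hpt : ∀ t, ‖toField y t‖ ^ 2 = 1 / 2 * (‖y.1 t‖ ^ 2 + ‖y.2 t‖ ^ 2) := by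
    intro t
    have h1 := parallelogram_law_with_norm ℝ (y.1 t) (y.2 t)
    rw [EuclideanSpace.norm_sq_eq, Fin.sum_univ_two]
    simp only [toField, spin_zero, spin_one, norm_div, Complex.norm_ofNat, div_pow]
    linarith
  have hint : ∀ f : CT, Integrable (fun t => ‖f t‖ ^ 2) haar := fun f =>
    Continuous.integrable_of_hasCompactSupport (by fun_prop) (HasCompactSupport.of_compactSpace _)
  have hvol : ‖F‖ ^ 2 = Real.pi * (‖toL2 y.1‖ ^ 2 + ‖toL2 y.2‖ ^ 2) := by
    have h2 := AddCircle.integral_haarAddCircle (T := 2 * Real.pi)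
      (f := fun t => ‖toField y t‖ ^ 2)
    rw [← hF] at h2
    simp only [hpt] at h2
    rw [integral_const_mul, integral_add (hint _) (hint _), ← hsq, ← hsq, smul_eq_mul] at h2
    have hpi := Real.pi_pos
    field_simp at h2
    linarith
  have h1 := norm_fst_le (pairL2 y)
  have h2 := norm_snd_le (pairL2 y)
  have h1' : ‖toL2 y.1‖ ^ 2 ≤ ‖pairL2 y‖ ^ 2 := by gcongr; exact h1
  have h2' : ‖toL2 y.2‖ ^ 2 ≤ ‖pairL2 y‖ ^ 2 := by gcongr; exact h2
  refine (le_abs_self _).trans (abs_le_of_sq_le_sq ?_ (by positivity))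
  rw [hvol, mul_pow, Real.sq_sqrt (by positivity)]
  nlinarith [Real.pi_pos]

end

end NonlinearDirac

/-! ### From the `L²` solution to a mild solution, and conclusion. -/

namespace NonlinearDirac

noncomputable section

lemma fourierCoeff_linear {f : Torus → ℂ} (hf : Integrable f haar) (g : CT) (a b : ℂ) (n : ℤ) :
    fourierCoeff (fun y => a * f y + b * g y) n = a * fourierCoeff f n + b * coeff n g := by
  have h := congrFun (fourierCoeff.add (hf.const_mul a) ((integrable_coe g).const_mul b)) n
  rw [Pi.add_apply, fourierCoeff.const_mul, fourierCoeff.const_mul] at h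
  exact h

namespace IsSolution

variable {G : Field → Field} {T : ℝ} {Φ Φt : ℝ → L2}

lemma continuousOn (h : IsSolution G T Φ Φt) (hT : 0 ≤ T) : ContinuousOn Φ (Set.Icc 0 T) := by
  have h1 := intervalIntegral.continuousOn_primitive_interval' h.integrable
    (Set.left_mem_uIcc (a := (0 : ℝ)) (b := T))
  rw [Set.uIcc_of_le hT] at h1
  exact (continuousOn_const.add h1).congr fun t ht => h.primitive t ht

/-- The Sobolev bound is given only for almost every `t`. Finite partial sums are continuous in `t`,
so the bound extends to every `t`, endpoints included. -/
lemma h1Seq (h : IsSolution G T Φ Φt) (hT : 0 < T) {M : ℝ} (hM : BoundedSobolev 1 T M Φ)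
    {ℓ : Spinor →L[ℂ] ℂ} (hℓ : ∀ w, ‖ℓ w‖ ^ 2 ≤ 2 * ‖w‖ ^ 2) {t : ℝ} (ht : t ∈ Set.Icc 0 T) :
    H1Seq M fun n => fieldCoeff ℓ n (Φ t) := by
  intro s
  set f : ℝ → ℝ := fun t => ∑ l ∈ s, (1 + (l : ℝ) ^ 2) * ‖fieldCoeff ℓ l (Φ t)‖ ^ 2 with hf
  have hfc : ContinuousOn f (Set.Icc 0 T) := by
    refine continuousOn_finsetSum s fun l _ => ContinuousOn.mul continuousOn_const ?_
    exact (((fieldCoeff ℓ l).continuous.comp_continuousOn (h.continuousOn hT.le)).norm).pow 2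
  -- Taking the maximum with `M²` turns an inequality into an equality, to which uniqueness for
  -- almost everywhere equal continuous functions applies.
  have hae : (fun t => max (f t) (M ^ 2)) =ᵐ[volume.restrict (Set.Ioo 0 T)] fun _ => M ^ 2 := by
    filter_upwards [hM] with t ht
    refine max_eq_right ?_
    have := ht.1.h1Seq ht.2 hℓ s
    simpa only [hf, fieldCoeff_apply] using this
  have hIoo := Measure.eqOn_open_of_ae_eq hae isOpen_Ioo
    ((hfc.mono Set.Ioo_subset_Icc_self).sup continuousOn_const) continuousOn_const
  have hIcc : Set.EqOn (fun t => max (f t) (M ^ 2)) (fun _ => M ^ 2) (Set.Icc 0 T) :=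
    hIoo.of_subset_closure (hfc.sup continuousOn_const) continuousOn_const
      Set.Ioo_subset_Icc_self (by rw [closure_Ioo hT.ne])
  exact max_eq_right_iff.1 (hIcc ht)

/-- The components of the solution satisfy scalar linear equations with forcing. -/
lemma coeff_equation (h : IsSolution G T Φ Φt) {ℓ : Spinor →L[ℂ] ℂ} {σ : ℂ}
    (hσ : ∀ w, ℓ (act alpha w) = σ * ℓ w) {γ : ℝ → CT}
    (hγ : ∀ t ∈ Set.Icc 0 T, (fun y => ℓ (G (Φ t) y)) =ᵐ[volume] γ t) (n : ℤ) :
    ∀ᵐ t ∂(volume.restrict (Set.Ioo 0 T)), fieldCoeff ℓ n (Φt t)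
      = -(Complex.I * n * σ) * fieldCoeff ℓ n (Φ t) - Complex.I * coeff n (γ t) := by
  filter_upwards [h.equation, ae_restrict_mem measurableSet_Ioo] with t ht hmem
  obtain ⟨D, hD, heq⟩ := ht
  have hγt := hγ t (Set.Ioo_subset_Icc_self hmem)
  have hae : (fun y => ℓ (Φt t y)) =ᵐ[haar] fun y => -σ * ℓ (D y) + -Complex.I * γ t y := by
    refine ae_volume_iff.1 ?_
    filter_upwards [heq, hγt] with y hy hg
    have h1 := congrArg (fun w => -Complex.I * ℓ w) hy
    simp only [map_add, map_neg, map_smul, smul_eq_mul, hσ, hg] at h1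
    linear_combination h1 + (ℓ (Φt t y) + σ * ℓ (D y)) * Complex.I_mul_I
  have e := fourierCoeff_linear (integrable_haar (ℓ.comp_memLp' hD.1)) (γ t) (-σ) (-Complex.I) n
  simp only [Function.comp_apply] at e
  rw [fieldCoeff_apply, fieldCoeff_apply, fourierCoeff_congr_ae hae, e, Function.comp_def,
    fourierCoeff_clm ℓ hD.1, hD.2, map_smul, fourierCoeff_clm ℓ (Lp.memLp (Φ t)), smul_eq_mul]
  ring

lemma coeff_integral_equation (h : IsSolution G T Φ Φt) {ℓ : Spinor →L[ℂ] ℂ} {σ : ℂ}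
    (hσ : ∀ w, ℓ (act alpha w) = σ * ℓ w) {γ : ℝ → CT}
    (hγ : ∀ t ∈ Set.Icc 0 T, (fun y => ℓ (G (Φ t) y)) =ᵐ[volume] γ t) (n : ℤ) {u : ℝ → ℂ}
    (hu : ∀ t ∈ Set.Icc 0 T, u t = fieldCoeff ℓ n (Φ t)) {t : ℝ} (ht : 0 ≤ t) (htT : t ≤ T) :
    u t = u 0 + ∫ s in (0 : ℝ)..t,
      (-(Complex.I * n * σ) * u s - Complex.I * coeff n (γ s)) := by
  have hT : 0 ≤ T := ht.trans htT
  have hint : IntervalIntegrable Φt volume 0 t := h.integrable.mono_set (by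
    rw [Set.uIcc_of_le ht, Set.uIcc_of_le hT]; exact Set.Icc_subset_Icc le_rfl htT)
  rw [hu t ⟨ht, htT⟩, hu 0 ⟨le_rfl, hT⟩, h.primitive t ⟨ht, htT⟩, map_add,
    ← ContinuousLinearMap.intervalIntegral_comp_comm _ hint]
  congr 1
  refine intervalIntegral.integral_congr_ae ?_
  have h1 := (ae_restrict_iff' measurableSet_Ioo).1 (h.coeff_equation hσ hγ n)
  -- The integral runs over a half-open interval that may contain `T`, whereas the equation is known
  -- on the open one.
  have hne : ∀ᵐ s : ℝ ∂volume, s ≠ T := by simp [ae_iff]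
  filter_upwards [h1, hne] with s hs hsT hmem
  rw [Set.uIoc_of_le ht] at hmem
  have hsT' : s < T := lt_of_le_of_ne (hmem.2.trans htT) hsT
  rw [hs ⟨hmem.1, hsT'⟩, hu s ⟨hmem.1.le, hsT'.le⟩]

end IsSolution

lemma plusL_alpha (w : Spinor) : plusL (act alpha w) = 1 * plusL w := by
  simp [plusL_apply, act, alpha, Matrix.vecHead, Matrix.vecTail, add_comm (w 1)]

lemma minusL_alpha (w : Spinor) : minusL (act alpha w) = -1 * minusL w := by
  simp [minusL_apply, act, alpha, Matrix.vecHead, Matrix.vecTail]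

lemma plusL_toField (x : Pair) (t : Torus) : plusL (toField x t) = x.1 t := by
  simp only [plusL_apply, toField, spin_zero, spin_one]; ring

lemma minusL_toField (x : Pair) (t : Torus) : minusL (toField x t) = x.2 t := by
  simp only [minusL_apply, toField, spin_zero, spin_one]; ring

/-- The solution as a mild solution in the space of pairs of continuous functions. -/
theorem IsSolution.exists_isMild {G : Field → Field} {T : ℝ} {Φ Φt : ℝ → L2} {lam κ : ℝ} {W : CT}
    (hG : ∀ (Ψ : Field) (x : Pair), Ψ =ᵐ[volume] toField x → WienerPair x →
      G Ψ =ᵐ[volume] toField ((diracSystem lam κ W).force x))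
    (h : IsSolution G T Φ Φt) (hT : 0 < T) {M : ℝ} (hM : BoundedSobolev 1 T M Φ) :
    ∃ x : ℝ → Pair, (diracSystem lam κ W).IsMild pairL2 T (supBound M + |M|) x ∧
      (∀ t, WienerPair (x t)) ∧ ∀ t ∈ Set.Icc 0 T, Φ t =ᵐ[volume] toField (x t) := by
  -- Clamping time to `[0, T]` extends the solution by its end values, so that the curve `x` is
  -- continuous and bounded on the whole line.
  set Φ' : ℝ → L2 := fun t => Φ (Set.projIcc 0 T hT.le t) with hΦ'
  have hmem : ∀ t, (Set.projIcc 0 T hT.le t : ℝ) ∈ Set.Icc 0 T := fun t =>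
    (Set.projIcc 0 T hT.le t).2
  have hcont : Continuous Φ' := (h.continuousOn hT.le).comp_continuous
    (continuous_subtype_val.comp continuous_projIcc) hmem
  have hres : ∀ t ∈ Set.Icc 0 T, Φ' t = Φ t := fun t ht => by
    rw [hΦ']; simp only; rw [Set.projIcc_of_mem hT.le ht]
  have sp : ∀ t, H1Seq M fun n => fieldCoeff plusL n (Φ' t) := fun t =>
    h.h1Seq hT hM norm_plusL_sq_le (hmem t)
  have sm : ∀ t, H1Seq M fun n => fieldCoeff minusL n (Φ' t) := fun t =>
    h.h1Seq hT hM norm_minusL_sq_le (hmem t)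
  set x : ℝ → Pair := fun t => (series fun n => fieldCoeff plusL n (Φ' t),
    series fun n => fieldCoeff minusL n (Φ' t)) with hx
  have hxc : Continuous x := (continuous_series sp fun l =>
    (fieldCoeff plusL l).continuous.comp hcont).prodMk (continuous_series sm fun l =>
    (fieldCoeff minusL l).continuous.comp hcont)
  have hxW : ∀ t, WienerPair (x t) := fun t => ⟨(sp t).wiener_series, (sm t).wiener_series⟩
  have hrep' : ∀ t, Φ' t =ᵐ[volume] toField (x t) := by
    intro t
    have h1 : (fun y => plusL (Φ' t y)) =ᵐ[volume] (x t).1 :=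
      ae_eq_of_coeff (plusL.comp_memLp' (Lp.memLp (Φ' t))) fun n => by
        exact (fieldCoeff_apply _ _ _).symm.trans ((sp t).coeff_series n).symm
    have h2 : (fun y => minusL (Φ' t y)) =ᵐ[volume] (x t).2 :=
      ae_eq_of_coeff (minusL.comp_memLp' (Lp.memLp (Φ' t))) fun n => by
        exact (fieldCoeff_apply _ _ _).symm.trans ((sm t).coeff_series n).symm
    filter_upwards [h1, h2] with y hy1 hy2
    rw [← spin_plusL_minusL (Φ' t y), hy1, hy2]; rfl
  have hrep : ∀ t ∈ Set.Icc 0 T, Φ t =ᵐ[volume] toField (x t) := fun t ht => by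
    rw [← hres t ht]; exact hrep' t
  have hforce : ∀ t ∈ Set.Icc 0 T,
      G (Φ t) =ᵐ[volume] toField ((diracSystem lam κ W).force (x t)) := fun t ht =>
    hG _ _ (hrep t ht) (hxW t)
  set g : ℝ → Pair := fun t => (diracSystem lam κ W).force (x t) with hg
  have hgc : Continuous g := (diracSystem lam κ W).continuous_force.comp hxc
  have hsup : 0 ≤ supBound M := add_nonneg (sq_nonneg M) (tsum_nonneg weight_nonneg)
  refine ⟨x, ⟨hxc, fun t => ?_, fun t s => ?_, fun t ht htT => ?_⟩, hxW, hrep⟩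
  · exact (max_le (sp t).norm_series_le (sm t).norm_series_le).trans
      (le_add_of_nonneg_right (abs_nonneg M))
  · refine (max_le ((sp t).lipschitz_series s) ?_).trans
      (mul_le_mul_of_nonneg_right (le_add_of_nonneg_left hsup) (abs_nonneg s))
    have := (sm t).lipschitz_series (-s)
    rwa [abs_neg] at this
  · have cF := (diracSystem lam κ W).continuous_pullback hxc
    -- The functionals `plusL` and `minusL` diagonalize `α` with eigenvalues `1` and `-1`, so each
    -- Fourier mode satisfies a scalar Duhamel formula whose exponential is the symbol of `shift t`
    -- or `shift (-t)`.
    refine Prod.ext (ext_coeff fun n => ?_) (ext_coeff fun n => ?_)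
    · have hd := scalar_duhamel (u := fun t => fieldCoeff plusL n (Φ' t))
        (g := fun t => coeff n (g t).1) ((fieldCoeff plusL n).continuous.comp hcont)
        ((coeff n).continuous.comp hgc.fst) (Complex.I * n * 1)
        (fun t ht htT => by
          have := h.coeff_integral_equation plusL_alpha (γ := fun t => (g t).1) (fun t ht => by
            filter_upwards [hforce t ht] with y hy
            rw [hy, plusL_toField]) n (u := fun t => fieldCoeff plusL n (Φ' t))
            (fun t ht => by rw [hres t ht]) ht htT
          exact this) ht htT
      have e1 : ∀ (s : ℝ), Complex.I * n * 1 * (s : ℂ) = Complex.I * ((s : ℂ) * n) :=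
        fun s => by ring
      simp only [e1] at hd
      rw [← (sp t).coeff_series n, ← (sp 0).coeff_series n] at hd
      have e2 : coeff n (∫ r in (0 : ℝ)..t, (diracSystem lam κ W).flow r
          ((diracSystem lam κ W).force (x r))).1
          = ∫ s in (0 : ℝ)..t, Complex.exp (Complex.I * ((s : ℂ) * n)) * coeff n (g s).1 := by
        have := ContinuousLinearMap.intervalIntegral_comp_comm
          ((coeff n).comp (ContinuousLinearMap.fst ℂ CT CT)) (cF.intervalIntegrable (μ := volume) 0 t)
        refine this.symm.trans ?_
        congr 1
        funext r
        exact coeff_shift n r (g r).1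
      rw [← e2, ← coeff_shift] at hd
      rw [Prod.fst_sub, Prod.smul_fst, map_sub, map_smul, smul_eq_mul]
      exact hd
    · have hd := scalar_duhamel (u := fun t => fieldCoeff minusL n (Φ' t))
        (g := fun t => coeff n (g t).2) ((fieldCoeff minusL n).continuous.comp hcont)
        ((coeff n).continuous.comp hgc.snd) (Complex.I * n * -1)
        (fun t ht htT => by
          have := h.coeff_integral_equation minusL_alpha (γ := fun t => (g t).2) (fun t ht => by
            filter_upwards [hforce t ht] with y hy
            rw [hy, minusL_toField]) n (u := fun t => fieldCoeff minusL n (Φ' t))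
            (fun t ht => by rw [hres t ht]) ht htT
          exact this) ht htT
      have e1 : ∀ (s : ℝ), Complex.I * n * -1 * (s : ℂ) = Complex.I * (((-s : ℝ) : ℂ) * n) :=
        fun s => by push_cast; ring
      simp only [e1] at hd
      rw [← (sm t).coeff_series n, ← (sm 0).coeff_series n] at hd
      have e2 : coeff n (∫ r in (0 : ℝ)..t, (diracSystem lam κ W).flow r
          ((diracSystem lam κ W).force (x r))).2
          = ∫ s in (0 : ℝ)..t, Complex.exp (Complex.I * (((-s : ℝ) : ℂ) * n)) * coeff n (g s).2 := by
        have := ContinuousLinearMap.intervalIntegral_comp_comm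
          ((coeff n).comp (ContinuousLinearMap.snd ℂ CT CT)) (cF.intervalIntegrable (μ := volume) 0 t)
        refine this.symm.trans ?_
        congr 1
        funext r
        exact coeff_shift n (-r) (g r).2
      rw [← e2, ← coeff_shift] at hd
      rw [Prod.snd_sub, Prod.smul_snd, map_sub, map_smul, smul_eq_mul]
      exact hd

lemma memLp_toField (x : Pair) : MemLp (toField x) 2 (volume : Measure Torus) := by
  refine Continuous.memLp_of_hasCompactSupport ?_ (HasCompactSupport.of_compactSpace _)
  have e : toField x = fun t => x.1 t • spin 1 0 + x.2 t • spin 0 1 := by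
    funext t
    refine spinor_ext ?_ ?_ <;> simp [toField] <;> ring
  rw [e]
  fun_prop

lemma toField_sub (x y : Pair) (t : Torus) : toField (x - y) t = toField x t - toField y t := by
  refine spinor_ext ?_ ?_ <;> simp [toField] <;> ring

/-- Convergence of a scheme that is represented by the step of the abstract integrator. -/
theorem scheme_convergence {G : Field → Field} {step : ℝ → Field → Field} {lam κ : ℝ} {W : CT}
    (hW : Wiener W) {κV : ℝ} (hκV : 0 ≤ κV) (hWlip : ∀ s, ‖toL2 (shift s W - W)‖ ≤ κV * |s|)
    (hG : ∀ (Ψ : Field) (x : Pair), Ψ =ᵐ[volume] toField x → WienerPair x →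
      G Ψ =ᵐ[volume] toField ((diracSystem lam κ W).force x))
    (hstep : ∀ (τ : ℝ) (Ψ : Field) (x : Pair), Ψ =ᵐ[volume] toField x → WienerPair x →
      step τ Ψ =ᵐ[volume] toField ((diracSystem lam κ W).step τ x))
    {T : ℝ} (M : ℝ) (hT : 0 < T) :
    ∃ τ₀ C : ℝ, 0 < τ₀ ∧ 0 < C ∧ ∀ Φ Φt : ℝ → L2, IsSolution G T Φ Φt →
      BoundedSobolev 1 T M Φ → ∀ τ : ℝ, 0 < τ → τ ≤ τ₀ → ∀ n : ℕ, (n : ℝ) * τ ≤ T →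
        ∃ h : MemLp (numSol (step τ) (Φ 0) n) 2 (volume : Measure Torus),
          ‖Φ (n * τ) - h.toLp‖ ≤ C * τ ^ 2 := by
  have hR : 0 ≤ supBound M + |M| := add_nonneg
    (add_nonneg (sq_nonneg M) (tsum_nonneg weight_nonneg)) (abs_nonneg M)
  obtain ⟨τ₀, C, hτ₀, hC, hconv⟩ := CubicSystem.convergence
    (diracTranslations (lam := lam) (κ := κ) hκV hWlip) diracSystem_compatible
    diracSystem_strongCompatible hT hR
  refine ⟨τ₀, Real.sqrt (2 * Real.pi) * C, hτ₀, by positivity, ?_⟩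
  intro Φ Φt hsol hM τ hτ hτle n hn
  obtain ⟨x, hmild, hxW, hrep⟩ := hsol.exists_isMild hG hT hM
  have hnum : ∀ m : ℕ, WienerPair (((diracSystem lam κ W).step τ)^[m] (x 0)) ∧
      numSol (step τ) (Φ 0) m =ᵐ[volume] toField (((diracSystem lam κ W).step τ)^[m] (x 0)) := by
    intro m
    induction m with
    | zero => exact ⟨hxW 0, hrep 0 ⟨le_rfl, hT.le⟩⟩
    | succ m ih =>
      rw [Function.iterate_succ_apply']
      exact ⟨WienerPair.step hW ih.1 τ, hstep τ _ _ ih.2 ih.1⟩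
  have hmem : MemLp (numSol (step τ) (Φ 0) n) 2 (volume : Measure Torus) :=
    (memLp_toField _).ae_eq (hnum n).2.symm
  refine ⟨hmem, ?_⟩
  have h1 : (Φ (n * τ) - hmem.toLp : L2) =ᵐ[volume]
      toField (x (n * τ) - ((diracSystem lam κ W).step τ)^[n] (x 0)) := by
    filter_upwards [Lp.coeFn_sub (Φ (n * τ)) hmem.toLp, hmem.coeFn_toLp, (hnum n).2,
      hrep (n * τ) ⟨by positivity, hn⟩] with t e1 e2 e3 e4
    rw [e1, Pi.sub_apply, e2, e3, e4, toField_sub]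
  refine (norm_le_pairL2 h1).trans ?_
  rw [mul_assoc]
  exact mul_le_mul_of_nonneg_left (hconv x hmild τ hτ hτle n hn) (Real.sqrt_nonneg _)

lemma MemSobolev.exists_continuous {f : Torus → ℂ} (hf : MemSobolev 1 f) :
    ∃ (W : CT) (κV : ℝ), f =ᵐ[volume] W ∧ Wiener W ∧ 0 ≤ κV ∧
      ∀ s, ‖toL2 (shift s W - W)‖ ≤ κV * |s| := by
  have hs : H1Seq (sobolevNorm 1 f) fun n => fourierCoeff f n :=
    hf.h1Seq le_rfl (ℓ := ContinuousLinearMap.id ℂ ℂ) fun w => by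
      rw [ContinuousLinearMap.id_apply]; nlinarith [sq_nonneg ‖w‖]
  exact ⟨series fun n => fourierCoeff f n, |sobolevNorm 1 f|,
    ae_eq_of_coeff hf.1 fun n => (hs.coeff_series n).symm, hs.wiener_series, abs_nonneg _,
    hs.lipschitz_series⟩

end

end NonlinearDirac

theorem corollary4p2 (lam : ℝ) :
    -- the Dirac-Poisson system
    (∀ T M₀ M₁ : ℝ, 0 < T →
      ∃ τ₀ C : ℝ, 0 < τ₀ ∧ 0 < C ∧
        ∀ Φ Φt : ℝ → L2, IsSolution (forceDP lam) T Φ Φt →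
          BoundedSobolev 1 T M₀ Φ → BoundedL2 T M₁ Φt →
            ∀ τ : ℝ, 0 < τ → τ ≤ τ₀ → ∀ n : ℕ, (n : ℝ) * τ ≤ T →
              ∃ h : MemLp (numSol (stepDP lam τ) (Φ 0) n) 2 (volume : Measure Torus),
                ‖Φ (n * τ) - h.toLp‖ ≤ C * τ ^ 2) ∧
    -- the nonlinear Dirac equation with a given external potential
    (∀ V : Torus → ℝ, MemSobolev 1 (fun x => (V x : ℂ)) →
      ∀ T M₀ M₁ : ℝ, 0 < T →
        ∃ τ₀ C : ℝ, 0 < τ₀ ∧ 0 < C ∧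
          ∀ Φ Φt : ℝ → L2, IsSolution (forceExt lam V) T Φ Φt →
            BoundedSobolev 1 T M₀ Φ → BoundedL2 T M₁ Φt →
              ∀ τ : ℝ, 0 < τ → τ ≤ τ₀ → ∀ n : ℕ, (n : ℝ) * τ ≤ T →
                ∃ h : MemLp (numSol (stepExt lam V τ) (Φ 0) n) 2 (volume : Measure Torus),
                  ‖Φ (n * τ) - h.toLp‖ ≤ C * τ ^ 2) := by
  refine ⟨fun T M₀ M₁ hT => ?_, fun V hV T M₀ M₁ hT => ?_⟩
  -- The Dirac-Poisson system has `κ = 1` and zero external potential. The other case has `κ = 0`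
  -- and the continuous representative `W` of `V`.
  · obtain ⟨τ₀, C, hτ₀, hC, H⟩ := scheme_convergence (W := 0) (κ := 1) (lam := lam)
      (by simp only [Wiener, map_zero]; exact summable_zero) le_rfl (by simp)
      (fun Ψ x hΨ hx => forceDP_ae hΨ hx lam) (fun τ Ψ x hΨ hx => stepDP_ae hΨ hx lam τ) M₀ hT
    exact ⟨τ₀, C, hτ₀, hC, fun Φ Φt hsol hM _ => H Φ Φt hsol hM⟩
  · obtain ⟨W, κV, hVW, hW, hκV, hlip⟩ := hV.exists_continuous
    obtain ⟨τ₀, C, hτ₀, hC, H⟩ := scheme_convergence (W := W) (κ := 0) (lam := lam) hW hκV hlip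
      (fun Ψ x hΨ _ => forceExt_ae hΨ lam hVW)
      (fun τ Ψ x hΨ hx => stepExt_ae hΨ hx lam τ hVW hW) M₀ hT
    exact ⟨τ₀, C, hτ₀, hC, fun Φ Φt hsol hM _ => H Φ Φt hsol hM⟩
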